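/- **Setting.** Fix an energy conversion efficiency $\chi\in(0,1)$, a time splitting factor $\rho\in[0,1)$ and a power splitting factor $\varepsilon\in[0,1)$ with $\rho+\varepsilon>0$, a spectrum sharing factor $\mu\in(0,1)$, a saturation threshold power $\mathcal P_{th}>0$, a satellite transmit power (times gains) $\eta_s>0$, noise variances $\sigma_r^2,\sigma_{rb}^2,\sigma_t^2>0$, lengths $w_e,h_0,w_{\min}>0$ and $0<h_1<h_2$, an angle $\phi\in(0,\pi/2)$, fading parameters $m_{sr}\in\{1,2,\dots\}$, $\flat_{sr}>0$, $\Omega_{sr}\ge0$, $K_{rt}\ge0$, and a path loss exponent $\nu_{rt}>0$. Put $w_{er}=w_e+h_0$, $w_{\max}=\sqrt{w_{\min}^2+2w_{er}w_{\min}}$, $\mu'=\mu/(1-\mu)$, $\chi_{\rho,\varepsilon}=\chi\big(\frac{2\rho}{1-\rho}+\varepsilon\big)$, $\mu_\varepsilon=\mu\big(\sigma_r^2+\frac{\sigma_{rb}^2}{1-\varepsilon}\big)$. A transmitter $R$ is at altitude $h_0$ above the Earth (a ball of radius $w_e$). The satellite $S$ is uniform (surface measure) on the part of the sphere of radius $w_{er}+w_{\min}$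 about the Earth's centre that lies above the horizontal plane through $R$. The aerial receiver $T$ is uniform (volume) in the vertical cone with apex $R$ and half-angle $\phi$ below $R$, truncated at the depths $h_1$ and $h_2$ below $R$. Let $w_{sr}=|S-R|$, $w_{rt}=|R-T|$. The complex channel coefficients $g_{sr},g_{rt}$ and the positions $S,T$ are independent; $|g_{sr}|^2$ and $|g_{rt}|^2$ have on $[0,\infty)$ the densities $$\alpha_{sr}\sum_{k=0}^{m_{sr}-1}\zeta(k)x^ke^{-\bar\beta_{sr}x},\qquad (1+K_{rt})e^{-K_{rt}-(1+K_{rt})x}I_0\big(2\sqrt{K_{rt}(1+K_{rt})x}\big),$$ where $\alpha_{sr}=\frac1{2\flat_{sr}}\big(\frac{2\flat_{sr}m_{sr}}{2\flat_{sr}m_{sr}+\Omega_{sr}}\big)^{m_{sr}}$, $\delta_{sr}=\frac{\Omega_{sr}}{2\flat_{sr}(2\flat_{sr}m_{sr}+\Omega_{sr})}$, $\bar\beta_{sr}=\frac1{2\flat_{sr}}-\delta_{sr}$, $\zeta(k)=(-1)^k(1-m_{sr})_k\delta_{sr}^k/(k!)^2$, with $(\cdot)_k$ the Pochhammer symbol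 and $I_0$ the modified Bessel function. For $\gamma_A>0$ let $$\mathcal P_4(\gamma_A)=\Pr\big[\Lambda>\gamma_A,\ \eta_s|g_{sr}|^2w_{sr}^{-2}>\mathcal P_{th}\big],$$ $$\Lambda=\frac{(1-\mu)\chi_{\rho,\varepsilon}\mathcal P_{th}\eta_s|g_{sr}|^2w_{sr}^{-2}|g_{rt}|^2w_{rt}^{-\nu_{rt}}}{\mu_\varepsilon\chi_{\rho,\varepsilon}\mathcal P_{th}|g_{rt}|^2w_{rt}^{-\nu_{rt}}+\mu\chi_{\rho,\varepsilon}\mathcal P_{th}\eta_s|g_{sr}|^2w_{sr}^{-2}|g_{rt}|^2w_{rt}^{-\nu_{rt}}+\eta_s|g_{sr}|^2w_{sr}^{-2}\sigma_t^2}$$ (the probability that the harvester is saturated and the signal-to-noise ratio at $T$ under imperfect interference cancellation exceeds $\gamma_A$). Put $\mathcal C=\chi_{\rho,\varepsilon}\eta_s((1-\mu)-\mu\gamma_A)$, $\mathcal D=\mu_\varepsilon\chi_{\rho,\varepsilon}\gamma_A$, $\mathcal P_{\mathcal C,\mathcal D}=\mathcal P_{th}\mathcal C/\eta_s-\mathcal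 D$, $a=\eta_s(1+K_{rt})\sigma_t^2\gamma_A/\mathcal P_{th}$, $\nu=\nu_{rt}$, $c=\cos\phi$, $\varsigma_2=\frac{n+k_1+2k_2+1}2$, $\varsigma_3=\frac{-n+k_1+1}2$. Let $\Gamma(\cdot,\cdot)$ be the upper incomplete Gamma function, $\Delta_s(x,y)=\Gamma(s,ax^\nu/\mathcal C)-\Gamma(s,ay^\nu/\mathcal C)$, $\mathbb W$ the Whittaker function and $G$ the Meijer G-function. **Theorem.** $$\mathcal P_4(\gamma_A)=\begin{cases}\widetilde\Psi_2(\gamma_A),&\gamma_A<1/\mu'\text{ and }\mathcal P_{th}>(\mathcal D/\mathcal C)\eta_s,\\ \widetilde\Psi_3(\gamma_A),&\gamma_A<1/\mu'\text{ and }\mathcal P_{th}\le(\mathcal D/\mathcal C)\eta_s,\\ 0,&\gamma_A\ge1/\mu',\end{cases}$$ where $$\widetilde\Psi_2=\frac{6\alpha_{sr}}{\nu w_{er}w_{\min}\tan^2\!\phi\,(h_2^3-h_1^3)}\sum_{k=0}^{m_{sr}-1}\zeta(k)\sum_{m=0}^\infty\sum_{n=0}^m\frac{K_{rt}^me^{-K_{rt}}}{m!\,n!}\sum_{k_1=0}^{n+k}\binom{n+k}{k_1}\sum_{k_2=0}^\infty\frac{(-1)^{k_2}}{k_2!}\,a^{-2/\nu}\,\bar\beta_{sr}^{\frac{n-k_1+k_2}2-1}\,\mathcal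 P_{\mathcal C,\mathcal D}^{\frac{-n+k_1-k_2}2}\,\frac{\mathcal D^{k+n-k_1+k_2}}{\mathcal C^{k+\frac{n-k_1+k_2}2-\frac2\nu}}\,B\,\tilde{\mathbb I}_1,$$ $$B=\big(\tfrac a{\mathcal C}\big)^{-1/\nu}\Delta_{n+k_2+3/\nu}(h_1,h_2)-h_1\Delta_{n+k_2+2/\nu}(h_1,\tfrac{h_1}c)+h_2\Delta_{n+k_2+2/\nu}(h_2,\tfrac{h_2}c)-\big(\tfrac a{\mathcal C}\big)^{-1/\nu}c\,\Delta_{n+k_2+3/\nu}(\tfrac{h_1}c,\tfrac{h_2}c),$$ $$\tilde{\mathbb I}_1=\int_{w_{\min}}^{w_{\max}}w^{2k+n-k_1+k_2+1}e^{-\frac{\bar\beta_{sr}w^2}{\mathcal C}\left(\mathcal D+\frac{\mathcal P_{\mathcal C,\mathcal D}}2\right)}\,\mathbb W_{\frac{-n+k_1-k_2}2,\frac{n-k_1+k_2-1}2}\Big(\frac{\bar\beta_{sr}w^2\mathcal P_{\mathcal C,\mathcal D}}{\mathcal C}\Big)dw,$$ and $$\widetilde\Psi_3=\frac{6\alpha_{sr}}{\nu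 w_{er}w_{\min}\tan^2\!\phi\,(h_2^3-h_1^3)}\sum_{k=0}^{m_{sr}-1}\zeta(k)\sum_{m=0}^\infty\sum_{n=0}^m\frac{K_{rt}^me^{-K_{rt}}}{m!\,n!}\sum_{k_1=0}^{k+n}\binom{k+n}{k_1}\sum_{k_2=0}^\infty\frac{(-1)^{k_2}}{k_2!}\,\frac{\mathcal D^{\frac{2k+n-k_1+1}2}}{\bar\beta_{sr}^{\varsigma_3}\mathcal C^{k+n+k_2+1}}\,a^{n+k_2+\varsigma_3}\,\big[\tilde{\mathbb I}_2-\tilde{\mathbb I}_3-\tilde{\mathbb I}_4+\tilde{\mathbb I}_5\big].$$ Here, with $$M_q(h,w)=h^{\varsigma_2\nu+q}\,G^{2,1}_{1,3}\Big[\tfrac{a h^\nu\mathcal D\bar\beta_{sr}w^2}{\mathcal C^2}\Big|{1-\varsigma_2-\frac q\nu\atop\varsigma_3,\,-\varsigma_3,\,-\varsigma_2-\frac q\nu}\Big],\quad J_q(x,y)=\int_{w_{\min}}^{w_{\max}}\big[M_q(y,w)-M_q(x,w)\big]w^{2k+n-k_1+2}e^{-\mathcal D\bar\beta_{sr}w^2/\mathcal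 C}dw,$$ $\tilde{\mathbb I}_2=J_3(h_1,h_2)$, $\tilde{\mathbb I}_3=h_1J_2(h_1,\frac{h_1}c)$, $\tilde{\mathbb I}_4=c\,J_3(\frac{h_1}c,\frac{h_2}c)$, $\tilde{\mathbb I}_5=h_2J_2(h_2,\frac{h_2}c)$. The integrals over $w$ exist, and the series converge as iterated series (the inner series over $k_2$, then the series over $m$). -/

import Mathlib

open MeasureTheory ProbabilityTheory Set

noncomputable section

namespace OSAGIN

/-! ### Special functions -/

/-- The upper incomplete Gamma function `Γ(a, x) = ∫_x^∞ t^(a-1) e^(-t) dt`, for `x > 0`. -/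
def upperGamma (a x : ℝ) : ℝ := ∫ t in Ioi x, t ^ (a - 1) * Real.exp (-t)

/-- `Δ_Γ(a, b, c) = Γ(a, b) - Γ(a, c)`. -/
def deltaGamma (a b c : ℝ) : ℝ := upperGamma a b - upperGamma a c

/-- The Whittaker function `W_{κ,m}(z)` for `z > 0` and real `κ, m`, through its standard integral
`W_{κ,m}(z) = e^{-z/2} z^κ / Γ(1/2 + m - κ) ∫_0^∞ t^{m-κ-1/2} (1 + t/z)^{m+κ-1/2} e^{-t} dt`
(valid for `1/2 + m - κ > 0`), with `m` replaced by `|m|`, as `W_{κ,m} = W_{κ,-m}`.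
It is meaningful whenever `1/2 + |m| - κ > 0`. -/
def whittakerW (κ m z : ℝ) : ℝ :=
  Real.exp (-z / 2) * z ^ κ / Real.Gamma (1 / 2 + |m| - κ) *
    ∫ t in Ioi (0 : ℝ), t ^ (|m| - κ - 1 / 2) * (1 + t / z) ^ (|m| + κ - 1 / 2) * Real.exp (-t)

/-- The modified Bessel function of the first kind and order zero. -/
def besselI0 (z : ℝ) : ℝ := ∑' m : ℕ, 1 / ((m.factorial : ℝ) ^ 2) * (z / 2) ^ (2 * m)

/-- The Mellin-Barnes integrand of the Meijer G-function with upper parameters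
`a₁` (the first `n`) and `a₂` (the others), and lower parameters `b₁` (the first `m`) and `b₂`
(the others). (`Complex.Gamma` is `0` at its poles, so `1 / Γ` is `0` there, as it should be.) -/
def meijerIntegrand (a₁ a₂ b₁ b₂ : List ℂ) (z s : ℂ) : ℂ :=
  (b₁.map fun b => Complex.Gamma (b - s)).prod * (a₁.map fun a => Complex.Gamma (1 - a + s)).prod /
    ((b₂.map fun b => Complex.Gamma (1 - b + s)).prod *
      (a₂.map fun a => Complex.Gamma (a - s)).prod) * z ^ s

/-- The vertical line `Re s = c` separates the poles of the `Γ(b - s)`, `b ∈ b₁` (to its right),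
from those of the `Γ(1 - a + s)`, `a ∈ a₁` (to its left). -/
def Separates (a₁ b₁ : List ℂ) (c : ℝ) : Prop :=
  (∀ a ∈ a₁, a.re - 1 < c) ∧ ∀ b ∈ b₁, c < b.re

open Classical in
/-- The Meijer G-function `G^{m,n}_{p,q}[z | a₁, a₂ ; b₁, b₂]`, i.e. `(1/2πi) ∫_L … ds`, for
parameters for which the contour `L` can be taken to be a vertical line (which line is
immaterial); this is so for all the parameters used below. -/
def meijerG (a₁ a₂ b₁ b₂ : List ℂ) (z : ℂ) : ℂ :=
  if h : ∃ c : ℝ, Separates a₁ b₁ c then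
    1 / (2 * (Real.pi : ℂ)) *
      ∫ y : ℝ, meijerIntegrand a₁ a₂ b₁ b₂ z ((h.choose : ℂ) + (y : ℂ) * Complex.I)
  else 0

/-- `G^{2,1}_{1,3}[z | a ; b₁, b₂, b₃]` with real parameters and `z > 0` (a real number). -/
def meijerG2113 (a b₁ b₂ b₃ z : ℝ) : ℝ :=
  (meijerG [(a : ℂ)] [] [(b₁ : ℂ), (b₂ : ℂ)] [(b₃ : ℂ)] (z : ℂ)).re

/-! ### The system -/

/-- Three-dimensional Euclidean space; the origin is the centre of the Earth, and the coordinate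
of index `2` is the height. -/
abbrev Space := EuclideanSpace ℝ (Fin 3)

/-- The numerical parameters of the system. -/
structure Params where
  /-- energy conversion efficiency `χ` -/
  chi : ℝ
  /-- time splitting factor `ρ` -/
  rho : ℝ
  /-- power splitting factor `ε` -/
  eps : ℝ
  /-- spectrum sharing factor `μ` -/
  mu : ℝ
  /-- saturation threshold power of the harvester -/
  Pth : ℝ
  /-- transmit power of the satellite times free-space, antenna and beam gains, `η_s` -/
  eta : ℝ
  /-- standard deviations of the noises `n_r`, `n_rb`, `n_t` -/
  sigmaR : ℝ
  sigmaRB : ℝ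
  sigmaT : ℝ
  /-- radius of the Earth -/
  wE : ℝ
  /-- altitude of the aerial transmitter -/
  h0 : ℝ
  /-- least distance between the satellite and the aerial transmitter -/
  wMin : ℝ
  /-- depths below the transmitter of the upper and the lower face of the truncated cone -/
  h1 : ℝ
  h2 : ℝ
  /-- half-beamwidth angle of the cone -/
  phi : ℝ
  /-- severity, half the multipath power, and line-of-sight power of the shadowed-Rician fading -/
  mSR : ℕ
  bSR : ℝ
  OmegaSR : ℝ
  /-- Rician factor and path loss exponent of the air-to-air link -/
  K : ℝ
  nu : ℝ

namespace Params

variable (P : Params)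

/-- The ranges of the parameters. -/
structure Valid : Prop where
  chi_pos : 0 < P.chi
  chi_lt : P.chi < 1
  rho_nonneg : 0 ≤ P.rho
  rho_lt : P.rho < 1
  eps_nonneg : 0 ≤ P.eps
  eps_lt : P.eps < 1
  /-- some energy is harvested -/
  harvest : 0 < P.rho + P.eps
  mu_pos : 0 < P.mu
  mu_lt : P.mu < 1
  Pth_pos : 0 < P.Pth
  eta_pos : 0 < P.eta
  sigmaR_pos : 0 < P.sigmaR
  sigmaRB_pos : 0 < P.sigmaRB
  sigmaT_pos : 0 < P.sigmaT
  wE_pos : 0 < P.wE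
  h0_pos : 0 < P.h0
  wMin_pos : 0 < P.wMin
  h1_pos : 0 < P.h1
  h1_lt : P.h1 < P.h2
  phi_pos : 0 < P.phi
  phi_lt : P.phi < Real.pi / 2
  mSR_pos : 1 ≤ P.mSR
  bSR_pos : 0 < P.bSR
  OmegaSR_nonneg : 0 ≤ P.OmegaSR
  K_nonneg : 0 ≤ P.K
  nu_pos : 0 < P.nu

/-- `χ_{ρ,ε}` -/
def chiRE : ℝ := P.chi * (2 * P.rho / (1 - P.rho) + P.eps)

/-- `μ' = μ / (1 - μ)` -/
def mu' : ℝ := P.mu / (1 - P.mu)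

/-- `μ_ε` -/
def muEps : ℝ := P.mu * (P.sigmaR ^ 2 + P.sigmaRB ^ 2 / (1 - P.eps))

/-- Distance of the aerial transmitter from the centre of the Earth. -/
def wER : ℝ := P.wE + P.h0

/-- Largest distance between the satellite and the aerial transmitter. -/
def wMax : ℝ := Real.sqrt (P.wMin ^ 2 + 2 * P.wER * P.wMin)

/-! #### Fading laws -/

def alphaSR : ℝ :=
  (2 * P.bSR * P.mSR / (2 * P.bSR * P.mSR + P.OmegaSR)) ^ P.mSR / (2 * P.bSR)

def betaSR : ℝ := 1 / (2 * P.bSR)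

def deltaSR : ℝ := P.OmegaSR / ((2 * P.bSR) * (2 * P.bSR * P.mSR + P.OmegaSR))

/-- `β̄ = β - δ` -/
def betaBar : ℝ := P.betaSR - P.deltaSR

/-- `ζ(k) = (-1)^k (1 - m)_k δ^k / (k!)^2`, with the Pochhammer symbol `(·)_k`. -/
def zeta (k : ℕ) : ℝ :=
  (-1) ^ k * (ascPochhammer ℝ k).eval (1 - (P.mSR : ℝ)) * P.deltaSR ^ k / (k.factorial : ℝ) ^ 2

/-- The shadowed-Rician law of the power gain `|g_sr|²`. -/
def shadowedRicianLaw : Measure ℝ :=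
  (volume.restrict (Ici 0)).withDensity fun x => ENNReal.ofReal
    (P.alphaSR * ∑ k ∈ Finset.range P.mSR,
      P.zeta k * x ^ k * Real.exp (-(P.betaSR - P.deltaSR) * x))

/-- The Rician law of the power gain `|g_rt|²`. -/
def ricianLaw : Measure ℝ :=
  (volume.restrict (Ici 0)).withDensity fun x => ENNReal.ofReal
    ((1 + P.K) * Real.exp (-P.K - (1 + P.K) * x) *
      besselI0 (2 * Real.sqrt (P.K * (1 + P.K) * x)))

/-! #### Positions -/

/-- The position of the aerial transmitter. -/
def transmitter : Space := EuclideanSpace.single 2 P.wER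

/-- The directions in which the orbital sphere (of radius `w_er + w_min`) lies above the
horizontal plane of the aerial transmitter. -/
def capDirections : Set (Metric.sphere (0 : Space) 1) :=
  {u | P.wER ≤ (P.wER + P.wMin) * (u : Space) 2}

/-- The uniform law on the part of the orbital sphere above the horizontal plane of the
aerial transmitter. -/
def satelliteLaw : Measure Space :=
  (((volume : Measure Space).toSphere)[|P.capDirections]).map
    fun u : Metric.sphere (0 : Space) 1 => (P.wER + P.wMin) • (u : Space)

/-- The vertical cone of half-angle `φ` with apex at the transmitter, truncated at the depths
`h₁ < h₂` below the transmitter. -/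
def truncatedCone : Set Space :=
  {x | P.h1 ≤ P.wER - x 2 ∧ P.wER - x 2 ≤ P.h2 ∧
    (x 0) ^ 2 + (x 1) ^ 2 ≤ ((P.wER - x 2) * Real.tan P.phi) ^ 2}

/-- The uniform law on the truncated cone. -/
def receiverLaw : Measure Space := (volume : Measure Space)[|P.truncatedCone]

end Params

/-- The random channels `g_sr`, `g_rt` and the random positions `S` of the satellite and `T` of
the aerial receiver: their laws, and their mutual independence. -/
structure IsModel (P : Params) {Ω : Type*} [MeasurableSpace Ω] (Pr : Measure Ω)
    (gsr grt : Ω → ℂ) (S T : Ω → Space) : Prop where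
  measurable_gsr : Measurable gsr
  measurable_grt : Measurable grt
  measurable_S : Measurable S
  measurable_T : Measurable T
  law_gsr : HasLaw (fun ω => ‖gsr ω‖ ^ 2) P.shadowedRicianLaw Pr
  law_grt : HasLaw (fun ω => ‖grt ω‖ ^ 2) P.ricianLaw Pr
  law_S : HasLaw S P.satelliteLaw Pr
  law_T : HasLaw T P.receiverLaw Pr
  indep_gsr : IndepFun gsr (fun ω => (grt ω, S ω, T ω)) Pr
  indep_grt : IndepFun grt (fun ω => (S ω, T ω)) Pr
  indep_S : IndepFun S T Pr

namespace Params

variable (P : Params)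

/-- The signal-to-noise ratio at the aerial receiver under imperfect interference cancellation
when the harvester is saturated; `X = |g_sr|²`, `w = w_sr`, `Z = |g_rt|²`, `u = w_rt`. -/
def snrSaturated (X w Z u : ℝ) : ℝ :=
  (1 - P.mu) * P.chiRE * P.Pth * P.eta * X * (w ^ 2)⁻¹ * Z * u ^ (-P.nu) /
    (P.muEps * P.chiRE * P.Pth * Z * u ^ (-P.nu)
      + P.mu * P.chiRE * P.Pth * P.eta * X * (w ^ 2)⁻¹ * Z * u ^ (-P.nu)
      + P.eta * X * (w ^ 2)⁻¹ * P.sigmaT ^ 2)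

/-- The probability `P₄(γ)` that the harvester is saturated and the signal-to-noise ratio at the
aerial receiver exceeds `γ`. -/
def P4 {Ω : Type*} [MeasurableSpace Ω] (Pr : Measure Ω)
    (gsr grt : Ω → ℂ) (S T : Ω → Space) (γ : ℝ) : ℝ :=
  Pr.real {ω |
    γ < P.snrSaturated (‖gsr ω‖ ^ 2) (dist (S ω) P.transmitter)
          (‖grt ω‖ ^ 2) (dist P.transmitter (T ω)) ∧
    P.Pth < P.eta * ‖gsr ω‖ ^ 2 * (dist (S ω) P.transmitter ^ 2)⁻¹}

/-! ### The closed forms -/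

/-- `𝒞` -/
def C (γ : ℝ) : ℝ := P.chiRE * P.eta * ((1 - P.mu) - P.mu * γ)

/-- `𝒟` -/
def D (γ : ℝ) : ℝ := P.muEps * P.chiRE * γ

/-- `𝒫_{𝒞,𝒟}` -/
def PCD (γ : ℝ) : ℝ := P.Pth * P.C γ / P.eta - P.D γ

/-- `Θ(γ)` -/
def Theta (γ : ℝ) : ℝ := (1 + P.K) * P.sigmaT ^ 2 * γ

/-- `η_s Θ(γ) / P_th` -/
def a (γ : ℝ) : ℝ := P.eta * P.Theta γ / P.Pth

/-- The density of the distance between transmitter and receiver carries the factor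
`6 / (tan² φ (h₂³ - h₁³))`; this is that of all closed forms. -/
def prefactor : ℝ :=
  6 * P.alphaSR /
    (P.wER * P.wMin * P.nu * Real.tan P.phi ^ 2 * (P.h2 ^ 3 - P.h1 ^ 3))

/-- The integrand of `Ĩ₁`. -/
def I1Integrand (γ : ℝ) (k n k1 k2 : ℕ) (w : ℝ) : ℝ :=
  w ^ (2 * (k : ℝ) + n - k1 + k2 + 1) *
    Real.exp (-(P.betaBar * w ^ 2 / P.C γ * (P.D γ + P.PCD γ / 2))) *
    whittakerW ((-(n : ℝ) + k1 - k2) / 2) (((n : ℝ) - k1 + k2 - 1) / 2)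
      (P.betaBar * w ^ 2 * P.PCD γ / P.C γ)

def I1 (γ : ℝ) (k n k1 k2 : ℕ) : ℝ := ∫ w in P.wMin..P.wMax, P.I1Integrand γ k n k1 k2 w

/-- `Δ_Γ(s, a x^ν / 𝒞, a y^ν / 𝒞)` -/
def deltaGammaAt (γ s x y : ℝ) : ℝ :=
  deltaGamma s (P.a γ * x ^ P.nu / P.C γ) (P.a γ * y ^ P.nu / P.C γ)

/-- The bracket of four incomplete-Gamma terms. -/
def gammaBracket (γ : ℝ) (n k2 : ℕ) : ℝ :=
  (P.a γ / P.C γ) ^ (-1 / P.nu) * P.deltaGammaAt γ (n + k2 + 3 / P.nu) P.h1 P.h2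
  - P.h1 * P.deltaGammaAt γ (n + k2 + 2 / P.nu) P.h1 (P.h1 / Real.cos P.phi)
  + P.h2 * P.deltaGammaAt γ (n + k2 + 2 / P.nu) P.h2 (P.h2 / Real.cos P.phi)
  - (P.a γ / P.C γ) ^ (-1 / P.nu) * Real.cos P.phi *
      P.deltaGammaAt γ (n + k2 + 3 / P.nu) (P.h1 / Real.cos P.phi) (P.h2 / Real.cos P.phi)

/-- The term of `Ψ̃₂` of index `(k, m, n, k₁, k₂)`. -/
def psi2Term (γ : ℝ) (k m n k1 k2 : ℕ) : ℝ :=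
  P.zeta k * (P.K ^ m * Real.exp (-P.K) / (m.factorial * n.factorial)) *
    ((n + k).choose k1 : ℝ) * ((-1) ^ k2 / (k2.factorial : ℝ)) *
    P.a γ ^ (-2 / P.nu) *
    P.betaBar ^ (((n : ℝ) - k1 + k2) / 2 - 1) *
    P.PCD γ ^ ((-(n : ℝ) + k1 - k2) / 2) *
    (P.D γ ^ ((k : ℝ) + n - k1 + k2) /
      P.C γ ^ ((k : ℝ) + ((n : ℝ) - k1 + k2) / 2 - 2 / P.nu)) *
    P.gammaBracket γ n k2 * P.I1 γ k n k1 k2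

def Psi2 (γ : ℝ) : ℝ :=
  P.prefactor * ∑ k ∈ Finset.range P.mSR, ∑' m : ℕ, ∑ n ∈ Finset.range (m + 1),
    ∑ k1 ∈ Finset.range (n + k + 1), ∑' k2 : ℕ, P.psi2Term γ k m n k1 k2

/-- `ς₂` -/
def s2 (n k1 k2 : ℕ) : ℝ := ((n : ℝ) + k1 + 2 * k2 + 1) / 2

/-- `ς₃` -/
def s3 (n k1 : ℕ) : ℝ := (-(n : ℝ) + k1 + 1) / 2

/-- `h^{ς₂ ν + q} G^{2,1}_{1,3}[a h^ν 𝒟 β̄ w² / 𝒞² | 1 - ς₂ - q/ν ; ς₃, -ς₃, -ς₂ - q/ν]` -/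
def meijerTerm (γ : ℝ) (n k1 k2 : ℕ) (q h w : ℝ) : ℝ :=
  h ^ (s2 n k1 k2 * P.nu + q) *
    meijerG2113 (1 - s2 n k1 k2 - q / P.nu) (s3 n k1) (-s3 n k1) (-s2 n k1 k2 - q / P.nu)
      (P.a γ * h ^ P.nu * P.D γ * P.betaBar * w ^ 2 / P.C γ ^ 2)

/-- The integrand common to `Ĩ₂, …, Ĩ₅`, between the lengths `x` and `y`. -/
def meijerIntegrandBetween (γ : ℝ) (k n k1 k2 : ℕ) (q x y w : ℝ) : ℝ :=
  (P.meijerTerm γ n k1 k2 q y w - P.meijerTerm γ n k1 k2 q x w) *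
    w ^ (2 * (k : ℝ) + n - k1 + 2) * Real.exp (-(P.D γ * P.betaBar * w ^ 2 / P.C γ))

def I2 (γ : ℝ) (k n k1 k2 : ℕ) : ℝ :=
  ∫ w in P.wMin..P.wMax, P.meijerIntegrandBetween γ k n k1 k2 3 P.h1 P.h2 w

def I3 (γ : ℝ) (k n k1 k2 : ℕ) : ℝ :=
  ∫ w in P.wMin..P.wMax,
    P.h1 * P.meijerIntegrandBetween γ k n k1 k2 2 P.h1 (P.h1 / Real.cos P.phi) w

def I4 (γ : ℝ) (k n k1 k2 : ℕ) : ℝ :=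
  ∫ w in P.wMin..P.wMax, Real.cos P.phi *
    P.meijerIntegrandBetween γ k n k1 k2 3 (P.h1 / Real.cos P.phi) (P.h2 / Real.cos P.phi) w

def I5 (γ : ℝ) (k n k1 k2 : ℕ) : ℝ :=
  ∫ w in P.wMin..P.wMax,
    P.h2 * P.meijerIntegrandBetween γ k n k1 k2 2 P.h2 (P.h2 / Real.cos P.phi) w

/-- The term of `Ψ̃₃` of index `(k, m, n, k₁, k₂)`. -/
def psi3Term (γ : ℝ) (k m n k1 k2 : ℕ) : ℝ :=
  P.zeta k * (P.K ^ m * Real.exp (-P.K) / (m.factorial * n.factorial)) *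
    ((k + n).choose k1 : ℝ) * ((-1) ^ k2 / (k2.factorial : ℝ)) *
    (P.D γ ^ ((2 * (k : ℝ) + n - k1 + 1) / 2) /
      (P.betaBar ^ (s3 n k1) * P.C γ ^ (k + n + k2 + 1))) *
    P.a γ ^ ((n : ℝ) + k2 + s3 n k1) *
    (P.I2 γ k n k1 k2 - P.I3 γ k n k1 k2 - P.I4 γ k n k1 k2 + P.I5 γ k n k1 k2)

def Psi3 (γ : ℝ) : ℝ :=
  P.prefactor * ∑ k ∈ Finset.range P.mSR, ∑' m : ℕ, ∑ n ∈ Finset.range (m + 1),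
    ∑ k1 ∈ Finset.range (k + n + 1), ∑' k2 : ℕ, P.psi3Term γ k m n k1 k2

/-- Convergence of the iterated series
`∑_{k < m_sr} ∑_{m ≥ 0} ∑_{n ≤ m} ∑_{k₁ ≤ k + n} ∑_{k₂ ≥ 0} t k m n k₁ k₂`. -/
def SeriesConverge (t : ℕ → ℕ → ℕ → ℕ → ℕ → ℝ) : Prop :=
  ∀ k < P.mSR,
    (∀ m, ∀ n ≤ m, ∀ k1 ≤ k + n, Summable fun k2 => t k m n k1 k2) ∧
    Summable fun m => ∑ n ∈ Finset.range (m + 1), ∑ k1 ∈ Finset.range (k + n + 1),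
      ∑' k2 : ℕ, t k m n k1 k2

end Params

end OSAGIN

end

/-! Write `X = |g_sr|²`, `Z = |g_rt|²` and `w`, `u` for the two distances. Clearing denominators
turns `Λ > γ` into `γ η σ_t² X < P_th Z u^(-ν) (𝒞 X - 𝒟 w²)` (`lt_snrSaturated_iff`). For `𝒞 ≤ 0`
this is impossible: the third case. For `𝒞 > 0` put `X = w² (y + 𝒟) / 𝒞`; the bracket becomes `w²
y`, saturation becomes `y > 𝒫_{𝒞,𝒟}`, and the event becomes `(1 + K) Z > s` with `s = c + c 𝒟 / y`,
`c = a u^ν / 𝒞`, on the half-line `y > max(𝒫_{𝒞,𝒟}, 0)`. The first two cases are the two values of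
this maximum (`P4_eq_sum_fadingIntegral`).

The Rician power law is a Poisson mixture of Erlang laws, so its tail is `∑_m (K^m e^(-K) / m!) ∑_{n
≤ m} s^n e^(-s) / n!` (`ricianLaw_Ioi`); expanding `(y + 𝒟)^(k+n)` gives the sum over `k₁`. There
remains `e^(-s) = e^(-c) e^(-c𝒟/y)`. One of the two factors is expanded into the series over `k₂`,
and its exponent must be bounded for dominated convergence to apply.

If `𝒫_{𝒞,𝒟} > 0`, then `y` stays away from `0` and `e^(-c𝒟/y)` is expanded. The variables separate:
the integral over `y` is an incomplete Gamma function, hence a Whittaker function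
(`whittakerW_eq_upperGamma`), and the one over `u` gives differences of incomplete Gamma functions.
If `𝒫_{𝒞,𝒟} ≤ 0`, then `c𝒟/y` is unbounded, so `e^(-c)` is expanded, while `e^(-c𝒟/y)` is kept and
tames `y^(-n)`. The integral over `y` is now a Bessel `K` function of a power of `u`, and
integrating it over `u` gives differences of Meijer G-functions, by Mellin inversion
(`meijerG2113_eq`).

The geometry enters through the laws of the distances. By Archimedes the height of a uniform point
of a spherical cap is uniform, and `w²` is affine in it, so `w` has density `w / (w_er w_min)`
(`integral_satelliteDistLaw`). In the cone, cylindrical coordinates with `u` in place of the radius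
lead to `∫_{h₁}^{h₂} ∫_h^{h/cos φ} u f(u) du dh`, which reduces to four single integrals
(`integral_integral_eq_distBracket`). Both series are assembled by `seriesConverge_and_sum_eq`. -/

namespace OSAGIN

/-! ### Incomplete Gamma functions -/

lemma integrableOn_Ioi_rpow_mul_exp_neg (s : ℝ) {x : ℝ} (hx : 0 < x) :
    IntegrableOn (fun t : ℝ => t ^ (s - 1) * Real.exp (-t)) (Ioi x) := by
  refine integrable_of_isBigO_exp_neg one_half_pos ?_ ?_
  · refine ContinuousOn.mul (continuousOn_id.rpow_const fun t ht => Or.inl ?_) (by fun_prop)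
    exact (hx.trans_le ht).ne'
  · have h := (Real.Gamma_integrand_isLittleO (s - 1)).isBigO
    exact h.congr_left fun t => mul_comm _ _

lemma deltaGamma_eq_intervalIntegral (s : ℝ) {x y : ℝ} (hx : 0 < x) (hy : 0 < y) :
    deltaGamma s x y = ∫ t in x..y, t ^ (s - 1) * Real.exp (-t) := by
  unfold deltaGamma upperGamma
  rw [intervalIntegral.integral_Ioi_sub_Ioi' (integrableOn_Ioi_rpow_mul_exp_neg s hx)
    (integrableOn_Ioi_rpow_mul_exp_neg s hy)]

/-- Near `z` the function is a constant minus a primitive. This is what makes the Whittaker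
integrand of `Ĩ₁` continuous in `w`. -/
lemma continuousOn_upperGamma (s : ℝ) : ContinuousOn (upperGamma s) (Ioi 0) := by
  intro z hz
  have hz : 0 < z := hz
  have h2 : 0 < z / 2 := by positivity
  have hI := integrableOn_Ioi_rpow_mul_exp_neg s h2
  have hc : ContinuousOn (fun y => upperGamma s (z / 2) -
      ∫ t in (z / 2)..y, t ^ (s - 1) * Real.exp (-t)) (Icc (z / 2) (2 * z)) := by
    refine continuousOn_const.sub ?_
    have hle : z / 2 ≤ 2 * z := by linarith
    rw [← uIcc_of_le hle]
    refine intervalIntegral.continuousOn_primitive_interval' ?_ left_mem_uIcc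
    refine ContinuousOn.intervalIntegrable
      (ContinuousOn.mul (continuousOn_id.rpow_const fun t ht => Or.inl ?_) (by fun_prop))
    rw [uIcc_of_le hle] at ht
    exact (h2.trans_le ht.1).ne'
  have hmem : Icc (z / 2) (2 * z) ∈ nhds z := Icc_mem_nhds (by linarith) (by linarith)
  refine ((hc.continuousAt hmem).congr ?_).continuousWithinAt
  filter_upwards [hmem] with y hy
  rw [← deltaGamma_eq_intervalIntegral s h2 (h2.trans_le hy.1), deltaGamma]
  ring

lemma integral_Ioi_comp_add_right (f : ℝ → ℝ) (x z : ℝ) :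
    ∫ t in Ioi x, f (t + z) = ∫ t in Ioi (x + z), f t := by
  have h := (measurePreserving_add_right volume z).setIntegral_preimage_emb
    (measurableEmbedding_addRight z) f (Ioi (x + z))
  rw [← h]
  congr 2
  ext t
  simp

lemma integral_Ioi_rpow_mul_exp_neg_mul (s : ℝ) {b y₀ : ℝ} (hb : 0 < b) (hy : 0 ≤ y₀) :
    ∫ y in Ioi y₀, y ^ (s - 1) * Real.exp (-(b * y)) = b ^ (-s) * upperGamma s (b * y₀) := by
  have h := integral_comp_mul_left_Ioi (fun t : ℝ => t ^ (s - 1) * Real.exp (-t)) y₀ hb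
  have h1 : ∫ y in Ioi y₀, y ^ (s - 1) * Real.exp (-(b * y)) =
      b ^ (1 - s) * ∫ y in Ioi y₀, (b * y) ^ (s - 1) * Real.exp (-(b * y)) := by
    rw [← integral_const_mul]
    refine setIntegral_congr_fun measurableSet_Ioi fun y hy' => ?_
    have : 0 < y := hy.trans_lt hy'
    rw [Real.mul_rpow hb.le this.le, ← mul_assoc, ← mul_assoc, ← Real.rpow_add hb]
    simp
  rw [h1, h, smul_eq_mul, ← mul_assoc, upperGamma]
  congr 1
  rw [← Real.rpow_neg_one, ← Real.rpow_add hb]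
  congr 1
  ring

/-- The factor `(1 + t/z)⁻¹` comes from `e^(-(t+z)) / (t + z) = ∫_1^∞ e^(-(t+z)p) dp`. Exchanging
the integrals leaves a Gamma integral in `t` and an incomplete Gamma integral in `p`. -/
lemma integral_Ioi_rpow_mul_exp_of_neg {s z : ℝ} (hs : s < 0) (hz : 0 < z) :
    ∫ t in Ioi (0 : ℝ), t ^ (-s) * (1 + t / z) ^ (-1 : ℝ) * Real.exp (-t) =
      Real.Gamma (1 - s) * Real.exp z * z ^ (1 - s) * upperGamma s z := by
  set F : ℝ → ℝ → ℝ := fun t p => t ^ (-s) * Real.exp (-(p * t)) * Real.exp (-(z * p)) with hF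
  have hin : ∀ p ∈ Ioi (1 : ℝ), ∫ t in Ioi (0 : ℝ), F t p =
      Real.Gamma (1 - s) * (p ^ (s - 1) * Real.exp (-(z * p))) := by
    intro p hp
    have hp0 : 0 < p := zero_lt_one.trans hp
    rw [hF]
    simp only
    rw [integral_mul_const]
    have := Real.integral_rpow_mul_exp_neg_mul_Ioi (a := 1 - s) (r := p) (by linarith) hp0
    rw [show 1 - s - 1 = -s by ring] at this
    rw [this, one_div, Real.inv_rpow hp0.le, ← Real.rpow_neg hp0.le]
    rw [show -(1 - s) = s - 1 by ring]; ring
  have hout : ∀ t ∈ Ioi (0 : ℝ), ∫ p in Ioi (1 : ℝ), F t p =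
      Real.exp (-z) * z⁻¹ * (t ^ (-s) * (1 + t / z) ^ (-1 : ℝ) * Real.exp (-t)) := by
    intro t ht
    have ht : 0 < t := ht
    have h1 : ∀ p, F t p = t ^ (-s) * Real.exp (-(t + z) * p) := by
      intro p; rw [hF]; simp only
      rw [mul_assoc, ← Real.exp_add]; congr 2; ring
    simp_rw [h1]
    rw [integral_const_mul, integral_exp_mul_Ioi (by linarith)]
    rw [Real.rpow_neg_one, show -(t + z) * 1 = -t + -z by ring, Real.exp_add]
    field_simp
    ring
  have hFm : AEStronglyMeasurable (Function.uncurry F)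
      ((volume.restrict (Ioi 0)).prod (volume.restrict (Ioi 1))) := by
    have : Measurable (Function.uncurry F) := by
      rw [hF]; unfold Function.uncurry; fun_prop
    exact this.aestronglyMeasurable
  have hFint : Integrable (Function.uncurry F)
      ((volume.restrict (Ioi 0)).prod (volume.restrict (Ioi 1))) := by
    rw [integrable_prod_iff' hFm]
    have hnn : ∀ t ∈ Ioi (0:ℝ), ∀ p, ‖F t p‖ = F t p := by
      intro t ht p
      have ht : 0 < t := ht
      rw [Real.norm_of_nonneg]; rw [hF]; positivity
    constructor
    · filter_upwards [ae_restrict_mem measurableSet_Ioi] with p hp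
      have hp0 : 0 < p := zero_lt_one.trans hp
      have := integrableOn_rpow_mul_exp_neg_mul_rpow (s := -s) (p := 1) (b := p)
        (by linarith) one_pos hp0
      simp only [Real.rpow_one] at this
      refine Integrable.congr (this.mul_const (Real.exp (-(z * p)))) ?_
      filter_upwards with t
      simp [hF]
    · have : IntegrableOn (fun p => Real.Gamma (1 - s) * (p ^ (s - 1) * Real.exp (-(z * p))))
          (Ioi 1) := by
        refine Integrable.const_mul ?_ _
        have h := integrableOn_Ioi_rpow_mul_exp_neg s (x := z * 1) (by linarith)
        rw [← integrableOn_Ioi_comp_mul_left_iff _ _ hz] at h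
        have h' : IntegrableOn (fun p => z ^ (1 - s) * ((z * p) ^ (s - 1) * Real.exp (-(z * p))))
          (Ioi 1) := h.const_mul _
        refine h'.congr_fun (fun p hp => ?_) measurableSet_Ioi
        have hp0 : 0 < p := zero_lt_one.trans hp
        dsimp only
        rw [Real.mul_rpow hz.le hp0.le, ← mul_assoc, ← mul_assoc, ← Real.rpow_add hz]
        simp
      refine this.congr_fun (fun p hp => ?_) measurableSet_Ioi
      dsimp only
      rw [← hin p hp]
      refine setIntegral_congr_fun measurableSet_Ioi fun t ht => ?_
      simp only [Function.uncurry]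
      exact (hnn t ht p).symm
  have hswap := integral_integral_swap hFint
  rw [setIntegral_congr_fun measurableSet_Ioi hout, setIntegral_congr_fun measurableSet_Ioi hin,
    integral_const_mul, integral_const_mul,
    integral_Ioi_rpow_mul_exp_neg_mul s hz zero_le_one, mul_one] at hswap
  have hz1 : z ^ (1 - s) = z * z ^ (-s) := by
    rw [sub_eq_add_neg, Real.rpow_add hz, Real.rpow_one]
  have he : Real.exp (-z) = (Real.exp z)⁻¹ := Real.exp_neg z
  rw [he] at hswap
  rw [hz1]
  have := Real.exp_pos z
  generalize (∫ t in Ioi (0 : ℝ), t ^ (-s) * (1 + t / z) ^ (-1 : ℝ) * Real.exp (-t)) = W at *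
  field_simp at hswap
  linear_combination hswap

/-- As `whittakerW` is defined through `|m|`, the sign of `s` decides the integral. For `s ≥ 0` the
power of `t` disappears and the shift `t ↦ t + z` gives `Γ(s, z)`; for `s < 0` the exponents are
`-s` and `-1`, and the previous lemma applies. -/
lemma whittakerW_eq_upperGamma (s : ℝ) {z : ℝ} (hz : 0 < z) :
    whittakerW ((s - 1) / 2) (-s / 2) z =
      Real.exp (z / 2) * z ^ ((1 - s) / 2) * upperGamma s z := by
  unfold whittakerW
  rcases lt_or_ge s 0 with hs | hs
  · have h1 : |-s / 2| = -s / 2 := abs_of_pos (by linarith)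
    rw [h1, show -s / 2 - (s - 1) / 2 - 1 / 2 = -s by ring,
      show -s / 2 + (s - 1) / 2 - 1 / 2 = -1 by ring,
      show 1 / 2 + -s / 2 - (s - 1) / 2 = 1 - s by ring,
      integral_Ioi_rpow_mul_exp_of_neg hs hz]
    have hG : Real.Gamma (1 - s) ≠ 0 := (Real.Gamma_pos_of_pos (by linarith)).ne'
    have h2 : z ^ ((s - 1) / 2) * z ^ (1 - s) = z ^ ((1 - s) / 2) := by
      rw [← Real.rpow_add hz]; congr 1; ring
    have h3 : Real.exp (-z / 2) * Real.exp z = Real.exp (z / 2) := by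
      rw [← Real.exp_add]; congr 1; ring
    rw [← h2, ← h3]
    field_simp
  · have h1 : |-s / 2| = s / 2 := by rw [neg_div, abs_neg, abs_of_nonneg (by linarith)]
    rw [h1, show s / 2 - (s - 1) / 2 - 1 / 2 = 0 by ring,
      show s / 2 + (s - 1) / 2 - 1 / 2 = s - 1 by ring,
      show 1 / 2 + s / 2 - (s - 1) / 2 = 1 by ring, Real.Gamma_one, div_one]
    have h4 : ∫ t in Ioi (0 : ℝ), t ^ (0 : ℝ) * (1 + t / z) ^ (s - 1) * Real.exp (-t) =
        z ^ (1 - s) * Real.exp z * upperGamma s z := by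
      have h5 := integral_Ioi_comp_add_right (fun t : ℝ => t ^ (s - 1) * Real.exp (-t)) 0 z
      rw [zero_add] at h5
      rw [upperGamma, ← h5, ← integral_const_mul]
      refine setIntegral_congr_fun measurableSet_Ioi fun t ht => ?_
      have ht : 0 < t := ht
      have h6 : t + z = z * (1 + t / z) := by field_simp; ring
      rw [Real.rpow_zero, h6, Real.mul_rpow hz.le (by positivity), ← h6, neg_add, Real.exp_add,
        Real.exp_neg z]
      have h7 : z ^ (1 - s) * z ^ (s - 1) = 1 := by rw [← Real.rpow_add hz]; simp
      rw [show z ^ (1 - s) * Real.exp z * (z ^ (s - 1) * (1 + t / z) ^ (s - 1) *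
        (Real.exp (-t) * (Real.exp z)⁻¹)) = (z ^ (1 - s) * z ^ (s - 1)) *
        (Real.exp z * (Real.exp z)⁻¹) * ((1 + t / z) ^ (s - 1) * Real.exp (-t)) by ring,
        h7, mul_inv_cancel₀ (Real.exp_pos z).ne']
      ring
    rw [h4]
    have h2 : z ^ ((s - 1) / 2) * z ^ (1 - s) = z ^ ((1 - s) / 2) := by
      rw [← Real.rpow_add hz]; congr 1; ring
    have h3 : Real.exp (-z / 2) * Real.exp z = Real.exp (z / 2) := by
      rw [← Real.exp_add]; congr 1; ring
    rw [← h2, ← h3]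
    ring

/-! ### Substitution of a power -/

/-- The substitution `t = A u^ν`. It is used with `φ` an exponential, for the incomplete Gamma
functions, and with `φ` a Bessel kernel, for the Meijer G-functions. -/
lemma intervalIntegral_comp_rpow {φ : ℝ → ℝ} (hφ : ContinuousOn φ (Ioi 0)) {A ν x y : ℝ}
    (hA : 0 < A) (hx : 0 < x) (hy : 0 < y) (r : ℝ) :
    ∫ t in (A * x ^ ν)..(A * y ^ ν), t ^ (r - 1) * φ t =
      ν * A ^ r * ∫ u in x..y, u ^ (ν * r - 1) * φ (A * u ^ ν) := by
  have hpos : ∀ u ∈ uIcc x y, 0 < u := fun u hu => (lt_min hx hy).trans_le hu.1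
  have h := intervalIntegral.integral_comp_mul_deriv' (a := x) (b := y)
    (f := fun u => A * u ^ ν) (f' := fun u => A * (ν * u ^ (ν - 1)))
    (g := fun t => t ^ (r - 1) * φ t) ?_ ?_ ?_
  · rw [← h, ← intervalIntegral.integral_const_mul]
    refine intervalIntegral.integral_congr fun u hu => ?_
    have hu := hpos u hu
    simp only [Function.comp]
    rw [Real.mul_rpow hA.le (by positivity), ← Real.rpow_mul hu.le]
    have h1 : A ^ r = A ^ (r - 1) * A := by
      rw [← Real.rpow_add_one hA.ne']; congr 1; ring
    have h2 : u ^ (ν * r - 1) = u ^ (ν * (r - 1)) * u ^ (ν - 1) := by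
      rw [← Real.rpow_add hu]; congr 1; ring
    rw [h1, h2]; ring
  · intro u hu
    exact (Real.hasDerivAt_rpow_const (Or.inl (hpos u hu).ne')).const_mul A
  · refine continuousOn_const.mul (continuousOn_const.mul ?_)
    exact continuousOn_id.rpow_const fun u hu => Or.inl (hpos u hu).ne'
  · refine ContinuousOn.mono (s := Ioi 0) ?_ ?_
    · exact (continuousOn_id.rpow_const fun u hu => Or.inl (ne_of_gt hu)).mul hφ
    · rintro _ ⟨u, hu, rfl⟩
      have := hpos u hu
      exact mul_pos hA (by positivity)

/-! ### Tails of the Erlang laws -/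

/-- The derivative of `∑_{n ≤ m} t^n e^(-t) / n!` telescopes to `-t^m e^(-t) / m!`. This is the
origin of the sums over `n ≤ m`. -/
lemma integral_Ioi_pow_mul_exp_neg (m : ℕ) (s : ℝ) :
    IntegrableOn (fun t : ℝ => t ^ m * Real.exp (-t)) (Ioi s) ∧
    ∫ t in Ioi s, t ^ m * Real.exp (-t) =
      m.factorial * ∑ n ∈ Finset.range (m + 1), s ^ n / n.factorial * Real.exp (-s) := by
  have hint : IntegrableOn (fun t : ℝ => t ^ m * Real.exp (-t)) (Ioi s) := by
    refine integrable_of_isBigO_exp_neg one_half_pos (by fun_prop) ?_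
    have h := (Real.Gamma_integrand_isLittleO m).isBigO
    refine h.congr_left fun t => ?_
    rw [Real.rpow_natCast, mul_comm]
  refine ⟨hint, ?_⟩
  set f : ℝ → ℝ := fun t =>
    -(m.factorial * ∑ n ∈ Finset.range (m + 1), t ^ n / n.factorial * Real.exp (-t)) with hf
  have hd : ∀ k : ℕ, ∀ t : ℝ, HasDerivAt (fun t : ℝ => ∑ n ∈ Finset.range (k + 1),
      t ^ n / n.factorial * Real.exp (-t)) (-(t ^ k / k.factorial * Real.exp (-t))) t := by
    intro k t
    have he : HasDerivAt (fun t : ℝ => Real.exp (-t)) (-Real.exp (-t)) t := by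
      simpa using (hasDerivAt_neg t).exp
    induction k with
    | zero => simpa using he
    | succ k ih =>
      simp_rw [Finset.sum_range_succ _ (k + 1)]
      have h1 := ((hasDerivAt_pow (k + 1) t).div_const ((k + 1).factorial : ℝ)).mul he
      refine (ih.add h1).congr_deriv ?_
      have : ((k + 1).factorial : ℝ) = (k + 1) * k.factorial := by
        push_cast [Nat.factorial_succ]; ring
      rw [this]
      have h2 : (k.factorial : ℝ) ≠ 0 := by positivity
      have h3 : (k : ℝ) + 1 ≠ 0 := by positivity
      push_cast
      field_simp
      ring
  have hder : ∀ t ∈ Ici s, HasDerivAt f (t ^ m * Real.exp (-t)) t := by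
    intro t _
    refine ((hd m t).const_mul (m.factorial : ℝ)).neg.congr_deriv ?_
    have h2 : (m.factorial : ℝ) ≠ 0 := by positivity
    field_simp
  have hlim : Filter.Tendsto f Filter.atTop (nhds 0) := by
    have : Filter.Tendsto (fun t : ℝ => ∑ n ∈ Finset.range (m + 1),
        t ^ n / n.factorial * Real.exp (-t)) Filter.atTop (nhds 0) := by
      rw [← Finset.sum_const_zero (s := Finset.range (m + 1))]
      refine tendsto_finsetSum _ fun n _ => ?_
      have := (Real.tendsto_pow_mul_exp_neg_atTop_nhds_zero n).div_const (n.factorial : ℝ)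
      rw [zero_div] at this
      refine this.congr fun t => ?_
      ring
    simpa [hf] using (this.const_mul (m.factorial : ℝ)).neg
  rw [integral_Ioi_of_hasDerivAt_of_tendsto' hder hint hlim]
  simp [hf]

/-! ### Multiplicative convolution and the Mellin transform -/

/-- The multiplicative convolution of two functions on the positive half-line. -/
noncomputable def mulConv (k g : ℝ → ℂ) (x : ℝ) : ℂ := ∫ p in Ioi (0 : ℝ), k p * g (x / p) / p

/-- Fubini: for fixed `p`, rescaling `x` by `p` splits off `p^s`. Absolute convergence on the
product follows from that of the two factors at the same `s`. -/
lemma hasMellin_mulConv {k g : ℝ → ℂ} (hkm : Measurable k) (hgm : Measurable g) {s : ℂ}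
    (hk : MellinConvergent k s) (hg : MellinConvergent g s) :
    HasMellin (mulConv k g) s (mellin k s * mellin g s) := by
  set F : ℝ → ℝ → ℂ := fun x p => (x : ℂ) ^ (s - 1) * (k p * g (x / p) / p) with hF
  have hFm : AEStronglyMeasurable (Function.uncurry F)
      ((volume.restrict (Ioi 0)).prod (volume.restrict (Ioi 0))) := by
    have : Measurable (Function.uncurry F) := by
      rw [hF]; unfold Function.uncurry; fun_prop
    exact this.aestronglyMeasurable
  have hscale : ∀ p ∈ Ioi (0 : ℝ), ∀ x,
      F x p = k p / p * ((x : ℂ) ^ (s - 1) • g (p⁻¹ * x)) := by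
    intro p _ x
    rw [hF, smul_eq_mul, inv_mul_eq_div]; ring
  have hcong : ∀ p ∈ Ioi (0 : ℝ), MellinConvergent (fun x => g (p⁻¹ * x)) s := fun p hp =>
    (MellinConvergent.comp_mul_left (inv_pos.2 hp)).2 hg
  have hFint : Integrable (Function.uncurry F)
      ((volume.restrict (Ioi 0)).prod (volume.restrict (Ioi 0))) := by
    rw [integrable_prod_iff' hFm]
    constructor
    · filter_upwards [ae_restrict_mem measurableSet_Ioi] with p hp
      simp only [Function.uncurry]
      simp_rw [hscale p hp]
      exact (hcong p hp).const_mul _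
    · have h1 : IntegrableOn (fun p : ℝ => ‖(p : ℂ) ^ (s - 1) • k p‖ *
          ∫ x in Ioi (0 : ℝ), ‖(x : ℂ) ^ (s - 1) • g x‖) (Ioi 0) := Integrable.mul_const hk.norm _
      refine h1.congr_fun (fun p hp => ?_) measurableSet_Ioi
      have hp' : 0 < p := hp
      have h2 := integral_comp_mul_left_Ioi (fun x : ℝ => ‖(x : ℂ) ^ (s - 1) • g x‖) 0
        (inv_pos.2 hp')
      rw [mul_zero, inv_inv, smul_eq_mul] at h2
      simp only [Function.uncurry]
      simp_rw [hscale p hp, norm_mul]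
      rw [integral_const_mul]
      -- The modulus of `x^(s-1)` is homogeneous of degree `Re s - 1`, so the norms rescale like the
      -- integrals themselves.
      have h3 : ∫ x in Ioi (0 : ℝ), ‖(x : ℂ) ^ (s - 1) • g (p⁻¹ * x)‖ =
          p ^ (s.re - 1) * ∫ x in Ioi (0 : ℝ), ‖((p⁻¹ * x : ℝ) : ℂ) ^ (s - 1) • g (p⁻¹ * x)‖ := by
        rw [← integral_const_mul]
        refine setIntegral_congr_fun measurableSet_Ioi fun x hx => ?_
        have hx : 0 < x := hx
        simp only [norm_smul]
        rw [Complex.norm_cpow_eq_rpow_re_of_pos hx,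
          Complex.norm_cpow_eq_rpow_re_of_pos (by positivity),
          Real.mul_rpow (by positivity) hx.le, Real.inv_rpow hp'.le]
        have : 0 < p ^ (s - 1).re := by positivity
        simp only [Complex.sub_re, Complex.one_re] at *
        field_simp
      rw [h3, h2, norm_smul, Complex.norm_cpow_eq_rpow_re_of_pos hp', norm_div, Complex.norm_real,
        Real.norm_of_nonneg hp'.le]
      simp only [Complex.sub_re, Complex.one_re]
      field_simp
  constructor
  · have := hFint.integral_prod_left
    refine Integrable.congr this ?_
    filter_upwards with x
    simp only [Function.uncurry, hF, mulConv]
    rw [integral_const_mul, smul_eq_mul]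
  · have h4 : mellin (mulConv k g) s = ∫ x in Ioi (0 : ℝ), ∫ p in Ioi (0 : ℝ), F x p := by
      unfold mellin mulConv
      refine setIntegral_congr_fun measurableSet_Ioi fun x _ => ?_
      simp only [hF]
      rw [integral_const_mul, smul_eq_mul]
    rw [h4, integral_integral_swap hFint, mellin, ← integral_mul_const]
    refine setIntegral_congr_fun measurableSet_Ioi fun p hp => ?_
    have hp' : 0 < p := hp
    have hpc : (p : ℂ) ≠ 0 := Complex.ofReal_ne_zero.2 hp'.ne'
    simp_rw [hscale p hp]
    rw [integral_const_mul]
    have h5 := mellin_comp_mul_left g s (inv_pos.2 hp')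
    rw [mellin] at h5
    rw [h5, Complex.ofReal_inv, Complex.inv_cpow _ _ (by
      rw [Complex.arg_ofReal_of_nonneg hp'.le]; exact Real.pi_pos.ne), ← Complex.cpow_neg, neg_neg,
      smul_eq_mul, smul_eq_mul, Complex.cpow_sub _ _ hpc, Complex.cpow_one]
    field_simp

/-! ### Vertical decay of the Gamma function -/

lemma norm_Gamma_le {s : ℂ} (hs : 0 < s.re) : ‖Complex.Gamma s‖ ≤ Real.Gamma s.re := by
  rw [Complex.Gamma_eq_integral hs, Real.Gamma_eq_integral hs, Complex.GammaIntegral]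
  refine (norm_integral_le_integral_norm _).trans (le_of_eq ?_)
  refine setIntegral_congr_fun measurableSet_Ioi fun x hx => ?_
  have hx : 0 < x := hx
  simp only [norm_mul]
  rw [Complex.norm_cpow_eq_rpow_re_of_pos hx, Complex.norm_real,
    Real.norm_of_nonneg (Real.exp_pos _).le]
  simp

/-- One use of `Γ(s + 1) = s Γ(s)` trades the uniform bound on a vertical line for decay of order
`1/|s|`. -/
lemma norm_Gamma_le_div {s : ℂ} (hs : 0 < s.re) :
    ‖Complex.Gamma s‖ ≤ Real.Gamma (s.re + 1) / ‖s‖ := by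
  have h0 : s ≠ 0 := by rintro rfl; simp at hs
  have h1 := norm_Gamma_le (s := s + 1) (by simp; linarith)
  rw [Complex.Gamma_add_one s h0, norm_mul] at h1
  rw [le_div_iff₀ (norm_pos_iff.2 h0), mul_comm]
  simpa using h1

lemma continuousAt_Gamma_of_re_pos {s : ℂ} (hs : 0 < s.re) : ContinuousAt Complex.Gamma s := by
  refine (Complex.differentiableAt_Gamma s fun m hm => ?_).continuousAt
  rw [hm] at hs
  simp only [Complex.neg_re, Complex.natCast_re] at hs
  have : (0 : ℝ) ≤ m := Nat.cast_nonneg m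
  linarith

/-- Exponential decay is not needed: one Gamma factor and `1/(r - s)` each decay like `1/|y|` and
the other Gamma factor is bounded, so the product is `O(1/(1 + y²))`. -/
lemma verticalIntegrable_Gamma_mul_Gamma_div {a b r σ : ℝ} (ha : 0 < σ + a) (hb : 0 < σ + b)
    (hr : σ < r) :
    Complex.VerticalIntegrable
      (fun s : ℂ => Complex.Gamma (s + a) * Complex.Gamma (s + b) * (1 / (r - s))) σ := by
  unfold Complex.VerticalIntegrable
  -- From `m ≤ 1` and `m ≤ d` follows `d² + y² ≥ m² (1 + y²)`; one constant serves both
  -- denominators.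
  set m := min (min (σ + a) (r - σ)) 1 with hm
  have hm0 : 0 < m := by
    rw [hm]; exact lt_min (lt_min ha (by linarith)) one_pos
  have hm1 : m ≤ 1 := min_le_right _ _
  have hnorm : ∀ (d y : ℝ) (z : ℂ), m ≤ d → z.re = d → z.im ^ 2 = y ^ 2 →
      m * Real.sqrt (1 + y ^ 2) ≤ ‖z‖ := by
    intro d y z hd hz1 hz2
    rw [Complex.norm_eq_sqrt_sq_add_sq, hz1, hz2, ← Real.sqrt_sq hm0.le,
      ← Real.sqrt_mul (sq_nonneg _)]
    refine Real.sqrt_le_sqrt ?_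
    have h1 : m ^ 2 ≤ d ^ 2 := pow_le_pow_left₀ hm0.le hd 2
    have h2 : m ^ 2 ≤ 1 := pow_le_one₀ hm0.le hm1
    nlinarith [sq_nonneg y]
  refine Integrable.mono' ((integrable_inv_one_add_sq).const_mul
    (Real.Gamma (σ + a + 1) * Real.Gamma (σ + b) / m ^ 2)) ?_ ?_
  · refine Continuous.aestronglyMeasurable ?_
    have hline : Continuous fun y : ℝ => (σ : ℂ) + y * Complex.I := by fun_prop
    have hG : ∀ c : ℝ, 0 < σ + c → Continuous fun y : ℝ =>
        Complex.Gamma (σ + y * Complex.I + c) := by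
      intro c hc
      refine continuous_iff_continuousAt.2 fun y => ?_
      refine ContinuousAt.comp (f := fun y : ℝ => (σ : ℂ) + y * Complex.I + c)
        (continuousAt_Gamma_of_re_pos (by simpa using hc)) (by fun_prop)
    refine ((hG a ha).mul (hG b hb)).mul (Continuous.div continuous_const (by fun_prop) ?_)
    intro y h
    have := congrArg Complex.re h
    simp at this
    linarith
  · filter_upwards with y
    have h1 := norm_Gamma_le_div (s := (σ : ℂ) + y * Complex.I + a) (by simpa using ha)
    have h2 := norm_Gamma_le (s := (σ : ℂ) + y * Complex.I + b) (by simpa using hb)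
    simp only [Complex.add_re, Complex.ofReal_re, Complex.mul_re, Complex.I_re, mul_zero,
      Complex.ofReal_im, Complex.I_im, mul_one, sub_self, add_zero] at h1 h2
    have h3 := hnorm (σ + a) y ((σ : ℂ) + y * Complex.I + a)
      ((min_le_left _ _).trans (min_le_left _ _)) (by simp) (by simp)
    have h4 := hnorm (r - σ) y ((r : ℂ) - (σ + y * Complex.I))
      ((min_le_left _ _).trans (min_le_right _ _)) (by simp) (by simp)
    have hS : 0 < Real.sqrt (1 + y ^ 2) := Real.sqrt_pos.2 (by positivity)
    have hSS : Real.sqrt (1 + y ^ 2) ^ 2 = 1 + y ^ 2 := Real.sq_sqrt (by positivity)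
    have hG1 : 0 < Real.Gamma (σ + a + 1) := Real.Gamma_pos_of_pos (by linarith)
    have hG2 : 0 < Real.Gamma (σ + b) := Real.Gamma_pos_of_pos hb
    rw [norm_mul, norm_mul, norm_div, norm_one]
    calc _ ≤ (Real.Gamma (σ + a + 1) / (m * Real.sqrt (1 + y ^ 2))) * Real.Gamma (σ + b) *
          (1 / (m * Real.sqrt (1 + y ^ 2))) := by
          gcongr
          exact h1.trans (by gcongr)
      _ = _ := by
        rw [← hSS, Real.sqrt_sq hS.le]
        field_simp

/-! ### The kernel `2 K_{2ς}(2 √x)` -/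

/-- The function `x^{-ς} ∫_0^∞ p^{2ς-1} e^{-p-x/p} dp = 2 K_{2ς}(2 √x)`. -/
noncomputable def besselKernel (ς x : ℝ) : ℝ :=
  x ^ (-ς) * ∫ p in Ioi (0 : ℝ), p ^ (2 * ς - 1) * Real.exp (-(x / p)) * Real.exp (-p)

/-- Any real exponent is allowed, because `e^(-b/p) ≤ n! (p/b)^n` cancels the singularity of `p^e`
at `0` once `n ≥ -e`. -/
lemma integrableOn_rpow_mul_exp_neg_div (e : ℝ) {b c : ℝ} (hb : 0 < b) (hc : 0 < c) :
    IntegrableOn (fun p : ℝ => p ^ e * Real.exp (-(b / p)) * Real.exp (-(c * p))) (Ioi 0) := by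
  obtain ⟨n, hn⟩ := exists_nat_ge (-e)
  have h1 := integrableOn_rpow_mul_exp_neg_mul_rpow (s := e + n) (p := 1) (b := c) (by linarith)
    one_pos hc
  refine Integrable.mono' (h1.const_mul (n.factorial / b ^ n))
    (Measurable.aestronglyMeasurable (by fun_prop)) ?_
  filter_upwards [ae_restrict_mem measurableSet_Ioi] with p hp
  have hp : 0 < p := hp
  rw [Real.norm_of_nonneg (by positivity), Real.rpow_one]
  have h2 := Real.pow_div_factorial_le_exp (x := b / p) (by positivity) n
  have h3 : Real.exp (-(b / p)) ≤ n.factorial / b ^ n * p ^ n := by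
    rw [Real.exp_neg]
    refine (inv_anti₀ (by positivity) h2).trans (le_of_eq ?_)
    rw [div_pow]
    field_simp
  calc _ ≤ p ^ e * (n.factorial / b ^ n * p ^ n) * Real.exp (-(c * p)) := by gcongr
    _ = _ := by
      rw [Real.rpow_add hp, Real.rpow_natCast, neg_mul]
      ring

lemma continuousOn_besselKernel (ς : ℝ) : ContinuousOn (besselKernel ς) (Ioi 0) := by
  intro x hx
  have hx : 0 < x := hx
  refine ContinuousAt.continuousWithinAt ?_
  unfold besselKernel
  refine (Real.continuousAt_rpow_const x _ (Or.inl hx.ne')).mul ?_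
  -- For `y > x/2` the factor `e^(-y/p)` is at most `e^(-(x/2)/p)`, which still controls negative
  -- powers of `p` at `0`.
  refine continuousAt_of_dominated
    (bound := fun p => p ^ (2 * ς - 1) * Real.exp (-(x / 2 / p)) * Real.exp (-(1 * p))) ?_ ?_
    (integrableOn_rpow_mul_exp_neg_div _ (by positivity) one_pos) ?_
  · filter_upwards with y
    exact Measurable.aestronglyMeasurable (by fun_prop)
  · filter_upwards [Ioi_mem_nhds (show x / 2 < x by linarith)] with y hy
    filter_upwards [ae_restrict_mem measurableSet_Ioi] with p hp
    have hp : 0 < p := hp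
    have hy : x / 2 < y := hy
    rw [Real.norm_of_nonneg (by positivity), one_mul]
    gcongr
  · filter_upwards with p
    fun_prop

lemma besselKernel_nonneg (ς : ℝ) {x : ℝ} (hx : 0 < x) : 0 ≤ besselKernel ς x := by
  refine mul_nonneg (by positivity) (setIntegral_nonneg measurableSet_Ioi fun p hp => ?_)
  have hp : 0 < p := hp
  positivity

lemma HasMellin.congr_on {f g : ℝ → ℂ} {s m : ℂ} (hf : HasMellin f s m)
    (h : ∀ x, 0 < x → f x = g x) : HasMellin g s m := by
  have h' : EqOn (fun t : ℝ => (t : ℂ) ^ (s - 1) • f t) (fun t : ℝ => (t : ℂ) ^ (s - 1) • g t)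
      (Ioi 0) := fun x hx => by simp only [h x hx]
  exact ⟨IntegrableOn.congr_fun hf.1 h' measurableSet_Ioi,
    by rw [mellin, ← setIntegral_congr_fun measurableSet_Ioi h']; exact hf.2⟩

lemma measurable_besselKernel (ς : ℝ) : Measurable (besselKernel ς) := by
  unfold besselKernel
  refine Measurable.mul (by fun_prop) ?_
  refine StronglyMeasurable.measurable ?_
  refine StronglyMeasurable.integral_prod_right
    (f := fun x p : ℝ => p ^ (2 * ς - 1) * Real.exp (-(x / p)) * Real.exp (-p)) ?_
  refine Measurable.stronglyMeasurable ?_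
  unfold Function.uncurry
  fun_prop

lemma hasMellin_cpow_mul_exp_neg {a s : ℂ} (h : 0 < (s + a).re) :
    HasMellin (fun x : ℝ => (x : ℂ) ^ a • ((Real.exp (-x) : ℝ) : ℂ)) s (Complex.Gamma (s + a)) := by
  constructor
  · rw [MellinConvergent.cpow_smul]
    refine IntegrableOn.congr_fun (Complex.GammaIntegral_convergent h) (fun x _ => ?_)
      measurableSet_Ioi
    simp [mul_comm]
  · rw [mellin_cpow_smul, Complex.Gamma_eq_integral h, Complex.GammaIntegral_eq_mellin]

/-- The kernel is the multiplicative convolution of `p^ς e^(-p)` and `p^(-ς) e^(-p)`; the condition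
`|ς| < Re s` is the convergence of both Gamma integrals. -/
lemma hasMellin_besselKernel {ς : ℝ} {s : ℂ} (hs : |ς| < s.re) :
    HasMellin (fun x => (besselKernel ς x : ℂ)) s
      (Complex.Gamma (s + ς) * Complex.Gamma (s + (-ς : ℝ))) := by
  obtain ⟨h1, h2⟩ := abs_lt.1 hs
  have hk := hasMellin_cpow_mul_exp_neg (a := ς) (s := s) (by simp; linarith)
  have hg := hasMellin_cpow_mul_exp_neg (a := (-ς : ℝ)) (s := s) (by simp; linarith)
  have h := hasMellin_mulConv (by fun_prop) (by fun_prop) hk.1 hg.1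
  rw [hk.2, hg.2] at h
  refine HasMellin.congr_on h fun x hx => ?_
  rw [besselKernel, mulConv, ← integral_const_mul, ← integral_complex_ofReal]
  refine setIntegral_congr_fun measurableSet_Ioi fun p hp => ?_
  have hp : 0 < p := hp
  simp only [smul_eq_mul]
  rw [← Complex.ofReal_cpow hp.le, ← Complex.ofReal_cpow (by positivity),
    Real.div_rpow hx.le hp.le, Real.rpow_neg hp.le,
    show 2 * ς - 1 = ς + ς - 1 by ring, Real.rpow_sub_one hp.ne', Real.rpow_add hp]
  push_cast
  have h3 : ((p ^ ς : ℝ) : ℂ) ≠ 0 := Complex.ofReal_ne_zero.2 (by positivity)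
  have h4 : (p : ℂ) ≠ 0 := Complex.ofReal_ne_zero.2 hp.ne'
  field_simp

/-- The Mellin multiplier `1 / (r - s)` applied to `besselKernel ς`. -/
noncomputable def incompleteKernel (r ς z : ℝ) : ℝ :=
  z ^ (-r) * ∫ t in (0 : ℝ)..z, t ^ (r - 1) * besselKernel ς t

lemma integrableOn_rpow_mul_besselKernel {r ς : ℝ} (hr : |ς| < r) :
    IntegrableOn (fun t => t ^ (r - 1) * besselKernel ς t) (Ioi 0) := by
  have h := (hasMellin_besselKernel (s := r) (by simpa using hr)).1
  refine IntegrableOn.congr_fun (Integrable.re h) (fun t ht => ?_) measurableSet_Ioi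
  have ht : 0 < t := ht
  simp only [smul_eq_mul]
  rw [← Complex.ofReal_one, ← Complex.ofReal_sub, ← Complex.ofReal_cpow ht.le,
    ← Complex.ofReal_mul]
  rfl

lemma intervalIntegrable_rpow_mul_besselKernel {r ς : ℝ} (hr : |ς| < r) {x y : ℝ} (hx : 0 ≤ x)
    (hy : 0 ≤ y) :
    IntervalIntegrable (fun t => t ^ (r - 1) * besselKernel ς t) volume x y := by
  rw [intervalIntegrable_iff]
  refine (integrableOn_rpow_mul_besselKernel hr).mono_set ?_
  exact fun t ht => (le_min hx hy).trans_lt ht.1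

lemma continuousOn_incompleteKernel {r ς : ℝ} (hr : |ς| < r) :
    ContinuousOn (incompleteKernel r ς) (Ioi 0) := by
  intro z hz
  have hz : 0 < z := hz
  refine ContinuousAt.continuousWithinAt ?_
  unfold incompleteKernel
  refine (Real.continuousAt_rpow_const z _ (Or.inl hz.ne')).mul ?_
  have h := intervalIntegral.continuousOn_primitive_interval'
    (intervalIntegrable_rpow_mul_besselKernel hr le_rfl (by positivity : 0 ≤ 2 * z)) left_mem_uIcc
  refine h.continuousAt ?_
  rw [uIcc_of_le (by positivity)]
  exact Icc_mem_nhds hz (by linarith)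

/-- Truncating the integral at `z` is a multiplicative convolution with `x^(-r)` on `x > 1`, whose
Mellin transform is `1/(r - s)` for `Re s < r`. -/
lemma hasMellin_incompleteKernel {r ς : ℝ} {s : ℂ} (hs : |ς| < s.re) (hr : s.re < r) :
    HasMellin (fun x => (incompleteKernel r ς x : ℂ)) s
      (Complex.Gamma (s + ς) * Complex.Gamma (s + (-ς : ℝ)) * (1 / (r - s))) := by
  have hk := hasMellin_besselKernel hs
  have hg : HasMellin ((Ioi (1 : ℝ)).indicator fun x : ℝ => (x : ℂ) ^ (-r : ℂ)) s
      (1 / (r - s)) := by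
    have hneg : (s - 1 + -r).re < -1 := by simp; linarith
    have heq : (fun t : ℝ => (t : ℂ) ^ (s - 1) • (Ioi (1 : ℝ)).indicator
        (fun x : ℝ => (x : ℂ) ^ (-r : ℂ)) t) =
        (Ioi (1 : ℝ)).indicator fun t : ℝ => (t : ℂ) ^ (s - 1 + -r) := by
      ext t
      by_cases ht : t ∈ Ioi (1 : ℝ)
      · have : (t : ℂ) ≠ 0 := Complex.ofReal_ne_zero.2 (zero_lt_one.trans ht).ne'
        rw [indicator_of_mem ht, indicator_of_mem ht, smul_eq_mul, Complex.cpow_add _ _ this]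
      · rw [indicator_of_notMem ht, indicator_of_notMem ht, smul_zero]
    have hsub : Ioi (1 : ℝ) ∩ Ioi 0 = Ioi 1 := inter_eq_left.2 (Ioi_subset_Ioi zero_le_one)
    constructor
    · unfold MellinConvergent IntegrableOn
      rw [heq, integrable_indicator_iff measurableSet_Ioi, IntegrableOn,
        Measure.restrict_restrict measurableSet_Ioi, hsub]
      exact integrableOn_Ioi_cpow_of_lt hneg one_pos
    · unfold mellin
      rw [heq, integral_indicator measurableSet_Ioi, Measure.restrict_restrict measurableSet_Ioi,
        hsub, integral_Ioi_cpow_of_lt hneg one_pos, Complex.ofReal_one, Complex.one_cpow,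
        show s - 1 + -(r : ℂ) + 1 = -(r - s) by ring, div_neg, neg_div, neg_neg]
  have h := hasMellin_mulConv
    (Complex.measurable_ofReal.comp (measurable_besselKernel ς))
    (Measurable.indicator (by fun_prop) measurableSet_Ioi) hk.1 hg.1
  rw [hg.2] at h
  rw [show mellin (Complex.ofReal ∘ besselKernel ς) s = _ from hk.2] at h
  refine HasMellin.congr_on h fun x hx => ?_
  rw [incompleteKernel, intervalIntegral.integral_of_le hx.le, mulConv,
    ← integral_const_mul, ← integral_complex_ofReal, integral_Ioc_eq_integral_Ioo,
    ← Ioi_inter_Iio, ← setIntegral_indicator measurableSet_Iio]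
  refine setIntegral_congr_fun measurableSet_Ioi fun p hp => ?_
  have hp : 0 < p := hp
  have hpc : (p : ℂ) ≠ 0 := Complex.ofReal_ne_zero.2 hp.ne'
  by_cases hpx : p < x
  · rw [indicator_of_mem (mem_Iio.2 hpx)]
    simp only [Function.comp]
    rw [indicator_of_mem (mem_Ioi.2 ((one_lt_div hp).2 hpx)), ← Complex.ofReal_neg,
      ← Complex.ofReal_cpow (by positivity), Real.div_rpow hx.le hp.le, Real.rpow_neg hp.le r,
      Real.rpow_sub_one hp.ne']
    push_cast
    have : ((p ^ r : ℝ) : ℂ) ≠ 0 := Complex.ofReal_ne_zero.2 (by positivity)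
    field_simp
  · rw [indicator_of_notMem (a := x / p) (by rw [mem_Ioi, one_lt_div hp]; exact hpx),
      indicator_of_notMem (a := p) (by simpa using hpx), mul_zero, zero_div]

/-- As `Γ(r + s) / Γ(1 + r + s) = 1/(r + s)`, the Mellin-Barnes integrand at `-s` is `Γ(s + ς) Γ(s -
ς) z^(-s) / (r - s)`, so the contour integral is the inverse Mellin transform of that of
`incompleteKernel r ς`. The hypothesis `|ς| < r` makes a separating vertical line exist. -/
lemma meijerG2113_eq {r ς z : ℝ} (hr : |ς| < r) (hz : 0 < z) :
    meijerG2113 (1 - r) ς (-ς) (-r) z = incompleteKernel r ς z := by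
  have hsep : ∃ c : ℝ, Separates [((1 - r : ℝ) : ℂ)] [(ς : ℂ), ((-ς : ℝ) : ℂ)] c := by
    -- The midpoint of `-r` and `-|ς|`, which bound the two families of poles.
    refine ⟨(-r - |ς|) / 2, ?_, ?_⟩
    · simp
      linarith
    · simp
      constructor <;> linarith [neg_abs_le ς, le_abs_self ς]
  unfold meijerG2113 meijerG
  rw [dif_pos hsep]
  -- The chosen line is unknown, but separation alone places `-c` strictly between `|ς|` and `r`, in
  -- the strip where the Mellin transform converges.
  obtain ⟨hc1, hc2⟩ := hsep.choose_spec
  set c := hsep.choose with hc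
  have hc3 : -c < r := by
    have := hc1 _ (List.mem_singleton_self _)
    rw [Complex.ofReal_re] at this
    linarith
  have hc4 : |ς| < -c := by
    have h1 := hc2 ς (by simp)
    have h2 := hc2 ((-ς : ℝ) : ℂ) (by simp)
    rw [Complex.ofReal_re] at h1 h2
    exact abs_lt.2 ⟨by linarith, by linarith⟩
  have hM : ∀ y : ℝ, HasMellin (fun x => (incompleteKernel r ς x : ℂ))
      (((-c : ℝ) : ℂ) + y * Complex.I) _ := fun y =>
    hasMellin_incompleteKernel (by simpa using hc4) (by simpa using hc3)
  have hinv := mellinInv_mellin_eq (-c) (fun x => (incompleteKernel r ς x : ℂ)) hz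
    (by simpa using (hM 0).1) ?_ ?_
  · have h5 : (incompleteKernel r ς z : ℂ) = 1 / (2 * (Real.pi : ℂ)) *
        ∫ y : ℝ, meijerIntegrand [((1 - r : ℝ) : ℂ)] [] [(ς : ℂ), ((-ς : ℝ) : ℂ)]
          [((-r : ℝ) : ℂ)] z ((c : ℂ) + y * Complex.I) := by
      rw [← hinv, mellinInv, Complex.real_smul]
      push_cast
      congr 1
      -- The Mellin-Barnes variable is minus the Mellin variable, hence the reflection `y ↦ -y`.
      rw [← integral_neg_eq_self]
      refine integral_congr_ae (Filter.Eventually.of_forall fun y => ?_)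
      have h6 := (hM (-y)).2
      push_cast at h6
      simp only [Complex.ofReal_neg]
      rw [h6, meijerIntegrand]
      simp only [List.map_cons, List.map_nil, List.prod_cons, List.prod_nil, mul_one, smul_eq_mul]
      have hre : (r : ℂ) + (c + y * Complex.I) ≠ 0 := by
        intro h
        have := congrArg Complex.re h
        simp at this
        linarith
      have hG : Complex.Gamma ((r : ℂ) + (c + y * Complex.I)) ≠ 0 :=
        Complex.Gamma_ne_zero_of_re_pos (by simp; linarith)
      have h7 := Complex.Gamma_add_one _ hre
      rw [show (1 : ℂ) - (1 - r) + (c + y * Complex.I) = r + (c + y * Complex.I) by ring,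
        show (1 : ℂ) - (-r) + (c + y * Complex.I) = r + (c + y * Complex.I) + 1 by ring, h7,
        show -(-(c : ℂ) + -y * Complex.I) = c + y * Complex.I by ring,
        show -(c : ℂ) + -y * Complex.I + ς = ς - (c + y * Complex.I) by ring,
        show -(c : ℂ) + -y * Complex.I + -ς = -ς - (c + y * Complex.I) by ring,
        show (r : ℂ) - (-(c : ℂ) + -y * Complex.I) = r + (c + y * Complex.I) by ring]
      field_simp
    rw [← h5, Complex.ofReal_re]
  · have := verticalIntegrable_Gamma_mul_Gamma_div (a := ς) (b := -ς) (r := r) (σ := -c)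
      (by linarith [neg_abs_le ς]) (by linarith [le_abs_self ς]) hc3
    unfold Complex.VerticalIntegrable at this ⊢
    refine this.congr (Filter.Eventually.of_forall fun y => ?_)
    exact ((hM y).2).symm
  · exact Complex.continuous_ofReal.continuousAt.comp
      ((continuousOn_incompleteKernel hr).continuousAt (Ioi_mem_nhds hz))

/-! ### Integration over a half-space in height and distance -/

/-- For `u = √(r² + h²)` at fixed `h` one has `u du = r dr`: the height enters only through the
range `u > h`. -/
lemma lintegral_Ioi_mul_comp_sqrt {h : ℝ} (hh : 0 < h) (g : ℝ → ENNReal) :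
    ∫⁻ r in Ioi (0 : ℝ), ENNReal.ofReal r * g (Real.sqrt (r ^ 2 + h ^ 2)) =
      ∫⁻ u in Ioi h, ENNReal.ofReal u * g u := by
  have hpos : ∀ r : ℝ, 0 < r ^ 2 + h ^ 2 := fun r => by positivity
  have himg : (fun r : ℝ => Real.sqrt (r ^ 2 + h ^ 2)) '' Ioi 0 = Ioi h := by
    ext u
    constructor
    · rintro ⟨r, hr, rfl⟩
      have hr : 0 < r := hr
      exact Real.lt_sqrt_of_sq_lt (by nlinarith)
    · intro hu
      have hu : h < u := hu
      have h0 : 0 < u ^ 2 - h ^ 2 := by nlinarith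
      refine ⟨Real.sqrt (u ^ 2 - h ^ 2), Real.sqrt_pos.2 h0, ?_⟩
      simp only
      rw [Real.sq_sqrt h0.le, sub_add_cancel, Real.sqrt_sq (by linarith)]
  rw [← himg, lintegral_image_eq_lintegral_abs_deriv_mul measurableSet_Ioi
    (f' := fun r => r / Real.sqrt (r ^ 2 + h ^ 2))]
  · refine setLIntegral_congr_fun measurableSet_Ioi fun r hr => ?_
    have hr : 0 < r := hr
    have hs := Real.sqrt_pos.2 (hpos r)
    rw [← mul_assoc, ← ENNReal.ofReal_mul (abs_nonneg _), abs_of_pos (by positivity),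
      div_mul_cancel₀ _ hs.ne']
  · intro r _
    have h1 : HasDerivAt (fun r : ℝ => r ^ 2 + h ^ 2) (2 * r) r := by
      simpa using (hasDerivAt_pow 2 r).add_const (h ^ 2)
    refine ((h1.sqrt (hpos r).ne').congr_deriv ?_).hasDerivWithinAt
    field_simp
  · intro r hr t ht hrt
    have hr : 0 < r := hr
    have ht : 0 < t := ht
    simp only at hrt
    rw [Real.sqrt_inj (hpos r).le (hpos t).le] at hrt
    have : r ^ 2 = t ^ 2 := by linarith
    exact (pow_left_inj₀ hr.le ht.le two_ne_zero).1 this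

lemma lintegral_sq_add_sq {g : ℝ → ENNReal} (hg : Measurable g) :
    ∫⁻ p : ℝ × ℝ, g (p.1 ^ 2 + p.2 ^ 2) =
      ENNReal.ofReal (2 * Real.pi) * ∫⁻ r in Ioi (0 : ℝ), ENNReal.ofReal r * g (r ^ 2) := by
  rw [← lintegral_comp_polarCoord_symm]
  have h1 : ∀ p : ℝ × ℝ, ENNReal.ofReal p.1 •
      g ((polarCoord.symm p).1 ^ 2 + (polarCoord.symm p).2 ^ 2) =
      ENNReal.ofReal p.1 * g (p.1 ^ 2) := by
    intro p
    rw [smul_eq_mul]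
    congr 2
    simp only [polarCoord, OpenPartialHomeomorph.coe_mk_symm, PartialEquiv.coe_symm_mk]
    linear_combination p.1 ^ 2 * Real.sin_sq_add_cos_sq p.2
  simp_rw [h1]
  change ∫⁻ p in Ioi (0 : ℝ) ×ˢ Ioo (-Real.pi) Real.pi, _ = _
  rw [Measure.volume_eq_prod, ← Measure.prod_restrict, lintegral_prod _ (by fun_prop)]
  simp only [lintegral_const, MeasurableSet.univ, Measure.restrict_apply, univ_inter,
    Real.volume_Ioo]
  rw [lintegral_mul_const _ (by fun_prop), mul_comm, sub_neg_eq_add, two_mul]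

/-- The point of given height and horizontal coordinates. -/
noncomputable def ofHeight (q : ℝ × ℝ × ℝ) : Space := WithLp.toLp 2 ![q.2.1, q.2.2, q.1]

lemma measurePreserving_ofHeight : MeasurePreserving ofHeight volume volume := by
  have h1 := (volume_preserving_piFinSuccAbove (fun _ : Fin 3 => ℝ) 2).symm
  have h2 := (volume_preserving_finTwoArrow ℝ).symm
  have h3 : MeasurePreserving (Prod.map id (MeasurableEquiv.finTwoArrow (α := ℝ)).symm)
      (volume : Measure (ℝ × ℝ × ℝ)) (volume : Measure (ℝ × (Fin 2 → ℝ))) :=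
    (MeasurePreserving.id volume).prod h2
  have h4 := (PiLp.volume_preserving_toLp (Fin 3)).comp (h1.comp h3)
  have h5 : ofHeight = WithLp.toLp 2 ∘ (MeasurableEquiv.piFinSuccAbove (fun _ : Fin 3 => ℝ) 2).symm ∘
      Prod.map id (MeasurableEquiv.finTwoArrow (α := ℝ)).symm := by
    funext q
    refine PiLp.ext fun i => ?_
    fin_cases i <;> rfl
  rw [h5]
  exact h4

lemma norm_ofHeight (q : ℝ × ℝ × ℝ) :
    ‖ofHeight q‖ = Real.sqrt (q.2.1 ^ 2 + q.2.2 ^ 2 + q.1 ^ 2) := by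
  rw [EuclideanSpace.norm_eq, Fin.sum_univ_three]
  simp [ofHeight]

/-- Cylindrical coordinates with the distance `u` in place of the radius: the volume element is `2π
u du dh` on `0 < h < u`. It serves both for the spherical sector and for the cone. -/
lemma lintegral_halfSpace {F : ℝ → ℝ → ENNReal} (hF : Measurable (Function.uncurry F)) :
    ∫⁻ x in {x : Space | 0 < x 2}, F (x 2) ‖x‖ =
      ENNReal.ofReal (2 * Real.pi) *
        ∫⁻ h in Ioi (0 : ℝ), ∫⁻ u in Ioi h, ENNReal.ofReal u * F h u := by
  have hmeas : MeasurableSet {x : Space | 0 < x 2} :=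
    measurableSet_lt measurable_const (by fun_prop)
  have hcomp : Measurable fun x : Space => F (x 2) ‖x‖ :=
    hF.comp (g := Function.uncurry F) (f := fun x : Space => (x 2, ‖x‖)) (by fun_prop)
  rw [← lintegral_indicator hmeas, ← measurePreserving_ofHeight.lintegral_comp
    (hcomp.indicator hmeas), Measure.volume_eq_prod,
    lintegral_prod (fun q => ({x : Space | 0 < x 2}.indicator fun x => F (x 2) ‖x‖) (ofHeight q))
      ((hcomp.indicator hmeas).comp measurePreserving_ofHeight.measurable).aemeasurable]
  rw [← lintegral_const_mul', ← lintegral_indicator measurableSet_Ioi]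
  · refine lintegral_congr fun h => ?_
    by_cases hh : 0 < h
    · rw [indicator_of_mem (mem_Ioi.2 hh)]
      have hFh : Measurable (F h) := hF.comp (measurable_const.prodMk measurable_id)
      have h1 : ∀ p : ℝ × ℝ, ({x : Space | 0 < x 2}.indicator fun x => F (x 2) ‖x‖)
          (ofHeight (h, p)) = F h (Real.sqrt (p.1 ^ 2 + p.2 ^ 2 + h ^ 2)) := by
        intro p
        rw [indicator_of_mem (show ofHeight (h, p) ∈ {x : Space | 0 < x 2} from hh),
          norm_ofHeight]
        rfl
      simp_rw [h1]
      rw [lintegral_sq_add_sq (g := fun t => F h (Real.sqrt (t + h ^ 2)))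
        (hFh.comp (by fun_prop)), lintegral_Ioi_mul_comp_sqrt hh]
    · rw [indicator_of_notMem (by simpa using hh)]
      have h1 : ∀ p : ℝ × ℝ, ({x : Space | 0 < x 2}.indicator fun x => F (x 2) ‖x‖)
          (ofHeight (h, p)) = 0 := by
        intro p
        exact indicator_of_notMem (show ofHeight (h, p) ∉ {x : Space | 0 < x 2} from hh) _
      simp_rw [h1, lintegral_zero]
  · exact ENNReal.ofReal_ne_top

open scoped Pointwise

/-! ### Spherical caps -/

/-- In the coordinates `(h, u)` the sector is `τ u ≤ h < u < 1` up to a null set, and integrating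
over `h` first gives `u (1 - τ)`. For `τ > 1` both sides vanish; this case is needed to test against
all half-lines. -/
lemma volume_sector {τ : ℝ} (hτ : 0 < τ) :
    volume {x : Space | 0 < ‖x‖ ∧ ‖x‖ < 1 ∧ τ * ‖x‖ ≤ x 2} =
      ENNReal.ofReal (2 * Real.pi * (1 - τ) / 3) := by
  set E : Set (ℝ × ℝ) := {q | q.2 < 1 ∧ τ * q.2 ≤ q.1} with hE
  have hEm : MeasurableSet E := by
    rw [hE, ofPred_and]
    exact (measurableSet_lt (by fun_prop) measurable_const).inter
      (measurableSet_le (by fun_prop) (by fun_prop))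
  set F : ℝ → ℝ → ENNReal := fun h u => E.indicator (fun _ => 1) (h, u) with hF
  have hFm : Measurable (Function.uncurry F) := measurable_const.indicator hEm
  have hsm : MeasurableSet {x : Space | 0 < ‖x‖ ∧ ‖x‖ < 1 ∧ τ * ‖x‖ ≤ x 2} := by
    rw [ofPred_and, ofPred_and]
    exact (measurableSet_lt (by fun_prop) (by fun_prop)).inter
      ((measurableSet_lt (by fun_prop) (by fun_prop)).inter
        (measurableSet_le (by fun_prop) (by fun_prop)))
  have hhm : MeasurableSet {x : Space | 0 < x 2} :=
    measurableSet_lt measurable_const (by fun_prop)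
  have h1 : volume {x : Space | 0 < ‖x‖ ∧ ‖x‖ < 1 ∧ τ * ‖x‖ ≤ x 2} =
      ∫⁻ x in {x : Space | 0 < x 2}, F (x 2) ‖x‖ := by
    rw [← lintegral_indicator_one hsm, ← lintegral_indicator hhm]
    refine lintegral_congr fun x => ?_
    by_cases hx : x ∈ {x : Space | 0 < ‖x‖ ∧ ‖x‖ < 1 ∧ τ * ‖x‖ ≤ x 2}
    · have hx2 : x ∈ {x : Space | 0 < x 2} :=
        lt_of_lt_of_le (mul_pos hτ hx.1) hx.2.2
      rw [indicator_of_mem hx, indicator_of_mem hx2, hF]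
      simp only
      rw [indicator_of_mem (show (x 2, ‖x‖) ∈ E from ⟨hx.2.1, hx.2.2⟩)]
      rfl
    · rw [indicator_of_notMem hx]
      by_cases hx2 : x ∈ {x : Space | 0 < x 2}
      · rw [indicator_of_mem hx2, hF]
        simp only
        rw [indicator_of_notMem]
        intro hxE
        refine hx ⟨norm_pos_iff.2 ?_, hxE.1, hxE.2⟩
        rintro rfl
        have : (0 : ℝ) < (0 : Space) 2 := hx2
        simp at this
      · rw [indicator_of_notMem hx2]
  rw [h1, lintegral_halfSpace hFm]
  set G : ℝ → ℝ → ENNReal := fun h u =>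
    ({q : ℝ × ℝ | 0 < q.1 ∧ q.1 < q.2} ∩ E).indicator (fun q => ENNReal.ofReal q.2) (h, u) with hG
  have hGs : MeasurableSet ({q : ℝ × ℝ | 0 < q.1 ∧ q.1 < q.2} ∩ E) := by
    rw [ofPred_and]
    exact ((measurableSet_lt (by fun_prop) (by fun_prop)).inter
      (measurableSet_lt (by fun_prop) (by fun_prop))).inter hEm
  have hGm : Measurable (Function.uncurry G) :=
    Measurable.indicator (by fun_prop) hGs
  have h2 : ∫⁻ h in Ioi (0 : ℝ), ∫⁻ u in Ioi h, ENNReal.ofReal u * F h u =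
      ∫⁻ h, ∫⁻ u, G h u := by
    rw [← lintegral_indicator measurableSet_Ioi]
    refine lintegral_congr fun h => ?_
    by_cases hh : 0 < h
    · rw [indicator_of_mem (mem_Ioi.2 hh), ← lintegral_indicator measurableSet_Ioi]
      refine lintegral_congr fun u => ?_
      by_cases hu : h < u
      · rw [indicator_of_mem (mem_Ioi.2 hu), hG, hF]
        by_cases hq : (h, u) ∈ E
        · simp [indicator_of_mem hq, indicator_of_mem
            (show (h, u) ∈ {q : ℝ × ℝ | 0 < q.1 ∧ q.1 < q.2} ∩ E from ⟨⟨hh, hu⟩, hq⟩)]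
        · simp [indicator_of_notMem hq, indicator_of_notMem
            (show (h, u) ∉ {q : ℝ × ℝ | 0 < q.1 ∧ q.1 < q.2} ∩ E from fun h => hq h.2)]
      · rw [indicator_of_notMem (by simpa using hu), hG]
        simp [indicator_of_notMem
            (show (h, u) ∉ {q : ℝ × ℝ | 0 < q.1 ∧ q.1 < q.2} ∩ E from fun h => hu h.1.2)]
    · rw [indicator_of_notMem (by simpa using hh)]
      have : ∀ u, G h u = 0 := fun u => indicator_of_notMem (fun h => hh h.1.1) _
      simp [this]
  have h3 : ∀ u, ∫⁻ h, G h u = (Ioo (0 : ℝ) 1).indicator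
      (fun u => ENNReal.ofReal (u * (u * (1 - τ)))) u := by
    intro u
    by_cases hu : u ∈ Ioo (0 : ℝ) 1
    · have : ∀ h, G h u = (Ico (τ * u) u).indicator (fun _ => ENNReal.ofReal u) h := by
        intro h
        by_cases hh : h ∈ Ico (τ * u) u
        · rw [indicator_of_mem hh, hG]
          exact indicator_of_mem (show (h, u) ∈ {q : ℝ × ℝ | 0 < q.1 ∧ q.1 < q.2} ∩ E from
            ⟨⟨(mul_pos hτ hu.1).trans_le hh.1, hh.2⟩, hu.2, hh.1⟩) _
        · rw [indicator_of_notMem hh]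
          exact indicator_of_notMem (fun hq => hh ⟨hq.2.2, hq.1.2⟩) _
      simp_rw [this]
      rw [lintegral_indicator measurableSet_Ico, indicator_of_mem hu, setLIntegral_const,
        Real.volume_Ico, ← ENNReal.ofReal_mul hu.1.le]
      congr 1; ring
    · rw [indicator_of_notMem hu]
      have : ∀ h, G h u = 0 := fun h => indicator_of_notMem
        (fun hq => hu ⟨hq.1.1.trans hq.1.2, hq.2.1⟩) _
      simp [this]
  rw [h2, lintegral_lintegral_swap hGm.aemeasurable]
  simp_rw [h3]
  rw [lintegral_indicator measurableSet_Ioo]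
  rcases le_or_gt τ 1 with h1 | h1
  · rw [← ofReal_integral_eq_lintegral_ofReal, ← ENNReal.ofReal_mul (by positivity),
      ← integral_Ioc_eq_integral_Ioo, ← intervalIntegral.integral_of_le zero_le_one]
    · congr 1
      have : ∀ u : ℝ, u * (u * (1 - τ)) = (1 - τ) * u ^ 2 := fun u => by ring
      simp_rw [this]
      rw [intervalIntegral.integral_const_mul, integral_pow]
      norm_num
      ring
    · exact (Continuous.integrableOn_Icc (by fun_prop)).mono_set Ioo_subset_Icc_self
    · filter_upwards [ae_restrict_mem measurableSet_Ioo] with u hu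
      have := hu.1
      have h4 : 0 ≤ 1 - τ := by linarith
      simp only [Pi.zero_apply]
      positivity
  · rw [ENNReal.ofReal_of_nonpos (p := 2 * Real.pi * (1 - τ) / 3)]
    · rw [setLIntegral_congr_fun (g := fun _ => 0) measurableSet_Ioo]
      · simp
      · intro u hu
        refine ENNReal.ofReal_of_nonpos ?_
        have := hu.1
        have : 0 ≤ u * (u * (τ - 1)) := by
          have : 0 ≤ τ - 1 := by linarith
          positivity
        linarith
    · have : 0 ≤ 2 * Real.pi * (τ - 1) := by
        have : 0 ≤ τ - 1 := by linarith
        positivity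
      linarith

lemma measurableSet_cap (τ : ℝ) :
    MeasurableSet {u : Metric.sphere (0 : Space) 1 | τ ≤ (u : Space) 2} :=
  measurableSet_le measurable_const (by fun_prop)

/-- The surface measure of a set is the dimension `3` times the volume of the solid sector over it.
-/
lemma toSphere_cap {τ : ℝ} (hτ : 0 < τ) :
    (volume : Measure Space).toSphere {u : Metric.sphere (0 : Space) 1 | τ ≤ (u : Space) 2} =
      ENNReal.ofReal (2 * Real.pi * (1 - τ)) := by
  rw [Measure.toSphere_apply' _ (measurableSet_cap τ)]
  have : Ioo (0 : ℝ) 1 • ((↑) '' {u : Metric.sphere (0 : Space) 1 | τ ≤ (u : Space) 2} : Set Space)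
      = {x : Space | 0 < ‖x‖ ∧ ‖x‖ < 1 ∧ τ * ‖x‖ ≤ x 2} := by
    ext x
    rw [Set.mem_smul]
    constructor
    · rintro ⟨r, hr, _, ⟨u, hu, rfl⟩, rfl⟩
      have hu : τ ≤ (u : Space) 2 := hu
      have hn : ‖(u : Space)‖ = 1 := by simp
      have hnr : ‖r • (u : Space)‖ = r := by
        rw [norm_smul, hn, mul_one, Real.norm_of_nonneg hr.1.le]
      refine ⟨by rw [hnr]; exact hr.1, by rw [hnr]; exact hr.2, ?_⟩
      rw [hnr, PiLp.smul_apply, smul_eq_mul, mul_comm]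
      exact mul_le_mul_of_nonneg_left hu hr.1.le
    · rintro ⟨h0, h1, h2⟩
      refine ⟨‖x‖, ⟨h0, h1⟩, ‖x‖⁻¹ • x, ⟨⟨‖x‖⁻¹ • x, ?_⟩, ?_, rfl⟩, ?_⟩
      · rw [mem_sphere_zero_iff_norm, norm_smul, norm_inv, norm_norm, inv_mul_cancel₀ h0.ne']
      · change τ ≤ (‖x‖⁻¹ • x) 2
        rw [PiLp.smul_apply, smul_eq_mul, inv_mul_eq_div, le_div_iff₀ h0]
        exact h2
      · rw [smul_smul, mul_inv_cancel₀ h0.ne', one_smul]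
  rw [this, volume_sector hτ, finrank_euclideanSpace, Fintype.card_fin,
    show ((3 : ℕ) : ENNReal) = ENNReal.ofReal 3 by simp, ← ENNReal.ofReal_mul (by norm_num)]
  congr 1; ring

/-- Archimedes' theorem: the area of a cap is affine in the bounding height, and half-lines `[τ, ∞)`
determine a finite measure. -/
lemma map_height_toSphere_cap {τ₀ : ℝ} (hτ : 0 < τ₀) :
    (((volume : Measure Space).toSphere.restrict
      {u : Metric.sphere (0 : Space) 1 | τ₀ ≤ (u : Space) 2}).map
        fun u : Metric.sphere (0 : Space) 1 => (u : Space) 2) =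
      ENNReal.ofReal (2 * Real.pi) • volume.restrict (Icc τ₀ 1) := by
  have hm : Measurable fun u : Metric.sphere (0 : Space) 1 => (u : Space) 2 := by fun_prop
  refine Measure.ext_of_Ici _ _ fun τ => ?_
  rw [Measure.map_apply hm measurableSet_Ici, Measure.restrict_apply (hm measurableSet_Ici)]
  have h1 : (fun u : Metric.sphere (0 : Space) 1 => (u : Space) 2) ⁻¹' Ici τ ∩
      {u : Metric.sphere (0 : Space) 1 | τ₀ ≤ (u : Space) 2} =
      {u : Metric.sphere (0 : Space) 1 | max τ τ₀ ≤ (u : Space) 2} := by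
    ext u; simp
  have h2 : Ici τ ∩ Icc τ₀ 1 = Icc (max τ τ₀) 1 := by
    ext t; simp [and_assoc]
  rw [h1, toSphere_cap (hτ.trans_le (le_max_right _ _)), Measure.smul_apply,
    Measure.restrict_apply measurableSet_Ici, h2, Real.volume_Icc, smul_eq_mul,
    ENNReal.ofReal_mul (by positivity)]

namespace Params

variable {P : Params}

lemma Valid.wER_pos (hP : P.Valid) : 0 < P.wER := add_pos hP.wE_pos hP.h0_pos

lemma Valid.wMax_sq (hP : P.Valid) : P.wMax ^ 2 = P.wMin ^ 2 + 2 * P.wER * P.wMin := by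
  have := hP.wER_pos
  have := hP.wMin_pos
  exact Real.sq_sqrt (by positivity)

lemma Valid.wMin_lt_wMax (hP : P.Valid) : P.wMin < P.wMax := by
  have := hP.wER_pos
  have := hP.wMin_pos
  exact Real.lt_sqrt_of_sq_lt (by nlinarith [mul_pos hP.wER_pos hP.wMin_pos])

lemma Valid.cos_pos (hP : P.Valid) : 0 < Real.cos P.phi :=
  Real.cos_pos_of_mem_Ioo ⟨by linarith [hP.phi_pos, Real.pi_pos], hP.phi_lt⟩

lemma Valid.tan_pos (hP : P.Valid) : 0 < Real.tan P.phi :=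
  Real.tan_pos_of_pos_of_lt_pi_div_two hP.phi_pos hP.phi_lt

lemma Valid.cos_lt_one (hP : P.Valid) : Real.cos P.phi < 1 := by
  rw [← Real.cos_zero]
  exact Real.cos_lt_cos_of_nonneg_of_le_pi le_rfl
    (by linarith [hP.phi_lt, Real.pi_pos]) hP.phi_pos

lemma Valid.one_add_tan_sq (hP : P.Valid) :
    1 + Real.tan P.phi ^ 2 = (1 / Real.cos P.phi) ^ 2 := by
  rw [one_div, inv_pow, ← Real.inv_one_add_tan_sq hP.cos_pos.ne', inv_inv]

lemma Valid.h2_pos (hP : P.Valid) : 0 < P.h2 := hP.h1_pos.trans hP.h1_lt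

/-! ### The law of the distance to the satellite -/

/-- The law of the distance between the satellite and the transmitter. -/
noncomputable def satelliteDistLaw (P : Params) : Measure ℝ :=
  P.satelliteLaw.map fun x => dist x P.transmitter

/-- The law of cosines; the transmitter lies on the vertical axis, so only the height of the
direction matters. -/
lemma dist_smul_transmitter (u : Metric.sphere (0 : Space) 1) :
    dist ((P.wER + P.wMin) • (u : Space)) P.transmitter =
      Real.sqrt ((P.wER + P.wMin) ^ 2 + P.wER ^ 2 -
        2 * (P.wER + P.wMin) * P.wER * (u : Space) 2) := by
  have hn : ‖(u : Space)‖ = 1 := by simp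
  rw [EuclideanSpace.norm_eq, Fin.sum_univ_three, Real.sqrt_eq_one] at hn
  rw [EuclideanSpace.dist_eq, Fin.sum_univ_three]
  congr 1
  simp only [Real.norm_eq_abs, sq_abs, Real.dist_eq, transmitter, PiLp.smul_apply, smul_eq_mul,
    PiLp.single_apply] at hn ⊢
  rw [if_neg (by decide), if_neg (by decide), if_pos trivial]
  linear_combination (P.wER + P.wMin) ^ 2 * hn

lemma Valid.satelliteDistLaw_eq (hP : P.Valid) :
    P.satelliteDistLaw = (ENNReal.ofReal (P.wMin / (P.wER + P.wMin)))⁻¹ •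
      (volume.restrict (Icc (P.wER / (P.wER + P.wMin)) 1)).map fun τ =>
        Real.sqrt ((P.wER + P.wMin) ^ 2 + P.wER ^ 2 - 2 * (P.wER + P.wMin) * P.wER * τ) := by
  have h1 := hP.wER_pos
  have h2 := hP.wMin_pos
  have hcap : P.capDirections = {u : Metric.sphere (0 : Space) 1 |
      P.wER / (P.wER + P.wMin) ≤ (u : Space) 2} := by
    ext u
    simp only [capDirections, mem_ofPred_eq]
    rw [div_le_iff₀ (by positivity), mul_comm]
  have hτ : 0 < P.wER / (P.wER + P.wMin) := by positivity
  have hsub : 1 - P.wER / (P.wER + P.wMin) = P.wMin / (P.wER + P.wMin) := by field_simp; ring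
  unfold satelliteDistLaw satelliteLaw ProbabilityTheory.cond
  rw [Measure.map_map (by fun_prop) (by fun_prop), Measure.map_smul, hcap, toSphere_cap hτ, hsub]
  have hfun : (fun x : Space => dist x P.transmitter) ∘
      (fun u : Metric.sphere (0 : Space) 1 => (P.wER + P.wMin) • (u : Space)) =
      (fun τ => Real.sqrt ((P.wER + P.wMin) ^ 2 + P.wER ^ 2 -
        2 * (P.wER + P.wMin) * P.wER * τ)) ∘
      (fun u : Metric.sphere (0 : Space) 1 => (u : Space) 2) := by
    ext u
    exact dist_smul_transmitter u
  rw [hfun, ← Measure.map_map (by fun_prop) (by fun_prop), map_height_toSphere_cap hτ,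
    Measure.map_smul, smul_smul, ENNReal.ofReal_mul (by positivity),
    ENNReal.mul_inv (Or.inr ENNReal.ofReal_ne_top) (Or.inl ENNReal.ofReal_ne_top), mul_right_comm,
    ENNReal.inv_mul_cancel (by simp [Real.pi_pos]) ENNReal.ofReal_ne_top, one_mul]

lemma Valid.ae_satelliteDistLaw (hP : P.Valid) :
    ∀ᵐ w ∂P.satelliteDistLaw, w ∈ Icc P.wMin P.wMax := by
  have h1 := hP.wER_pos
  have h2 := hP.wMin_pos
  rw [hP.satelliteDistLaw_eq]
  refine Measure.ae_smul_measure ?_ _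
  refine (ae_map_iff (p := fun w => w ∈ Icc P.wMin P.wMax) (by fun_prop) measurableSet_Icc).2 ?_
  filter_upwards [ae_restrict_mem measurableSet_Icc] with τ hτ
  have hb : 0 < 2 * (P.wER + P.wMin) * P.wER := by positivity
  have h3 := mul_le_mul_of_nonneg_left hτ.1 hb.le
  have h4 := mul_le_mul_of_nonneg_left hτ.2 hb.le
  have h5 : 2 * (P.wER + P.wMin) * P.wER * (P.wER / (P.wER + P.wMin)) = 2 * P.wER ^ 2 := by
    field_simp
  constructor
  · exact Real.le_sqrt_of_sq_le (by nlinarith)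
  · exact Real.sqrt_le_sqrt (by nlinarith)

/-- The distance satisfies `w² = A - B τ` with `τ` uniform, so `2 w dw = -B dτ` and the density of
`w` is proportional to `w`. -/
lemma Valid.integral_satelliteDistLaw (hP : P.Valid) {f : ℝ → ℝ} (hfm : Measurable f)
    (hf : ContinuousOn f (Ioi 0)) :
    ∫ w, f w ∂P.satelliteDistLaw =
      1 / (P.wER * P.wMin) * ∫ w in P.wMin..P.wMax, w * f w := by
  have h1 := hP.wER_pos
  have h2 := hP.wMin_pos
  have hle := hP.wMin_lt_wMax.le
  set A := (P.wER + P.wMin) ^ 2 + P.wER ^ 2 with hA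
  set B := 2 * (P.wER + P.wMin) * P.wER with hB
  have hB0 : 0 < B := by positivity
  -- The pole `τ = 1` of the cap is at distance `w_min` and its rim at distance `w_max`; the
  -- substitution reverses orientation.
  have hA1 : A - P.wMin ^ 2 = B := by rw [hA, hB]; ring
  have hA2 : A - P.wMax ^ 2 = B * (P.wER / (P.wER + P.wMin)) := by
    rw [hP.wMax_sq, hA, hB]; field_simp; ring
  rw [hP.satelliteDistLaw_eq, integral_smul_measure,
    integral_map (by fun_prop) hfm.aestronglyMeasurable]
  have hsub := intervalIntegral.integral_comp_mul_deriv' (a := P.wMin) (b := P.wMax)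
    (f := fun w => (A - w ^ 2) / B) (f' := fun w => -(2 * w) / B)
    (g := fun τ => f (Real.sqrt (A - B * τ))) ?_ (by fun_prop) ?_
  · simp only [hA1, hA2] at hsub
    rw [div_self hB0.ne', mul_div_cancel_left₀ _ hB0.ne', intervalIntegral.integral_symm _ (1 : ℝ),
      intervalIntegral.integral_of_le ((div_le_one (by positivity)).2 (by linarith)),
      ← integral_Icc_eq_integral_Ioc] at hsub
    rw [← neg_eq_iff_eq_neg] at hsub
    rw [← hsub, ← intervalIntegral.integral_neg, ENNReal.toReal_inv,
      ENNReal.toReal_ofReal (by positivity), smul_eq_mul, ← intervalIntegral.integral_const_mul,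
      ← intervalIntegral.integral_const_mul]
    refine intervalIntegral.integral_congr fun w hw => ?_
    rw [uIcc_of_le hle] at hw
    have hw0 : 0 < w := h2.trans_le hw.1
    simp only [Function.comp]
    rw [mul_div_cancel₀ _ hB0.ne', sub_sub_cancel, Real.sqrt_sq hw0.le, hB]
    field_simp
  · intro w _
    have := ((hasDerivAt_pow 2 w).const_sub A).div_const B
    simpa using this
  · rintro _ ⟨w, hw, rfl⟩
    rw [uIcc_of_le hle] at hw
    have hw0 : 0 < w := h2.trans_le hw.1
    refine ContinuousAt.continuousWithinAt ?_
    have hs : Real.sqrt (A - B * ((A - w ^ 2) / B)) = w := by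
      rw [mul_div_cancel₀ _ hB0.ne', sub_sub_cancel, Real.sqrt_sq hw0.le]
    refine ContinuousAt.comp (g := f) ?_ (by fun_prop)
    simp only [hs]
    exact hf.continuousAt (Ioi_mem_nhds hw0)

/-! ### The law of the distance to the receiver -/

/-- The law of the distance between the transmitter and the receiver. -/
noncomputable def receiverDistLaw (P : Params) : Measure ℝ :=
  P.receiverLaw.map fun x => dist P.transmitter x

lemma measurableSet_truncatedCone : MeasurableSet P.truncatedCone := by
  unfold truncatedCone
  rw [ofPred_and, ofPred_and]
  exact (measurableSet_le (by fun_prop) (by fun_prop)).inter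
    ((measurableSet_le (by fun_prop) (by fun_prop)).inter
      (measurableSet_le (by fun_prop) (by fun_prop)))

/-- By `1 + tan² φ = 1/cos² φ` the bound on the horizontal radius is a bound on the length, so the
cone becomes a region in the plane of height and distance. -/
lemma Valid.mem_truncatedCone_iff (hP : P.Valid) (y : Space) :
    P.transmitter - y ∈ P.truncatedCone ↔
      y 2 ∈ Icc P.h1 P.h2 ∧ ‖y‖ ≤ y 2 / Real.cos P.phi := by
  have hc := hP.cos_pos
  have h2 : P.wER - (P.transmitter - y) 2 = y 2 := by
    simp [transmitter]
  have h0 : (P.transmitter - y) 0 = - y 0 := by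
    simp [transmitter]
  have h1 : (P.transmitter - y) 1 = - y 1 := by
    simp [transmitter]
  simp only [truncatedCone, mem_ofPred_eq, h2, h0, h1, mem_Icc, and_assoc]
  refine and_congr_right fun h3 => and_congr_right fun _ => ?_
  have h4 : 0 < y 2 := hP.h1_pos.trans_le h3
  rw [EuclideanSpace.norm_eq, Fin.sum_univ_three, Real.sqrt_le_left (by positivity), div_pow,
    div_eq_mul_one_div, ← one_div_pow, ← hP.one_add_tan_sq]
  simp only [Real.norm_eq_abs, sq_abs, neg_sq, mul_pow]
  constructor <;> intro h <;> linarith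

lemma Valid.lintegral_truncatedCone (hP : P.Valid) {g : ℝ → ENNReal} (hg : Measurable g) :
    ∫⁻ x in P.truncatedCone, g (dist P.transmitter x) =
      ENNReal.ofReal (2 * Real.pi) * ∫⁻ h in Icc P.h1 P.h2,
        ∫⁻ u in Ioc h (h / Real.cos P.phi), ENNReal.ofReal u * g u := by
  have hc := hP.cos_pos
  set E : Set (ℝ × ℝ) := {q | P.h1 ≤ q.1 ∧ q.1 ≤ P.h2 ∧ q.2 ≤ q.1 / Real.cos P.phi} with hE
  have hEm : MeasurableSet E := by
    rw [hE, ofPred_and, ofPred_and]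
    exact (measurableSet_le (by fun_prop) (by fun_prop)).inter
      ((measurableSet_le (by fun_prop) (by fun_prop)).inter
        (measurableSet_le (by fun_prop) (by fun_prop)))
  set F : ℝ → ℝ → ENNReal := fun h u => E.indicator (fun q => g q.2) (h, u) with hF
  have hFm : Measurable (Function.uncurry F) := Measurable.indicator (by fun_prop) hEm
  have hhm : MeasurableSet {x : Space | 0 < x 2} :=
    measurableSet_lt measurable_const (by fun_prop)
  have key := lintegral_halfSpace hFm
  -- The reflection `y ↦ transmitter - y` puts the apex at the origin and turns depth into height.
  have h1 : ∫⁻ x in P.truncatedCone, g (dist P.transmitter x) =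
      ∫⁻ x in {x : Space | 0 < x 2}, F (x 2) ‖x‖ := by
    rw [← lintegral_indicator measurableSet_truncatedCone, ← lintegral_indicator hhm,
      ← lintegral_sub_left_eq_self _ P.transmitter]
    refine lintegral_congr fun y => ?_
    have hy := hP.mem_truncatedCone_iff y
    by_cases hmem : P.transmitter - y ∈ P.truncatedCone
    · have h3 := hy.1 hmem
      have hy2 : y ∈ {x : Space | 0 < x 2} := hP.h1_pos.trans_le h3.1.1
      rw [indicator_of_mem hmem, indicator_of_mem hy2, hF]
      simp only
      rw [indicator_of_mem (show (y 2, ‖y‖) ∈ E from ⟨h3.1.1, h3.1.2, h3.2⟩), dist_eq_norm,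
        sub_sub_cancel]
    · rw [indicator_of_notMem hmem]
      by_cases hy2 : y ∈ {x : Space | 0 < x 2}
      · rw [indicator_of_mem hy2, hF]
        simp only
        rw [indicator_of_notMem]
        intro hq
        exact hmem (hy.2 ⟨⟨hq.1, hq.2.1⟩, hq.2.2⟩)
      · rw [indicator_of_notMem hy2]
  rw [h1, key]
  congr 1
  rw [← lintegral_indicator measurableSet_Ioi, ← lintegral_indicator measurableSet_Icc]
  refine lintegral_congr fun h => ?_
  by_cases hh : h ∈ Icc P.h1 P.h2
  · rw [indicator_of_mem hh, indicator_of_mem (mem_Ioi.2 (hP.h1_pos.trans_le hh.1)),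
      ← lintegral_indicator measurableSet_Ioi, ← lintegral_indicator measurableSet_Ioc]
    refine lintegral_congr fun u => ?_
    by_cases hu : u ∈ Ioc h (h / Real.cos P.phi)
    · rw [indicator_of_mem hu, indicator_of_mem (mem_Ioi.2 hu.1), hF]
      simp only
      rw [indicator_of_mem (show (h, u) ∈ E from ⟨hh.1, hh.2, hu.2⟩)]
    · rw [indicator_of_notMem hu]
      by_cases hu2 : u ∈ Ioi h
      · rw [indicator_of_mem hu2, hF]
        simp only
        rw [indicator_of_notMem, mul_zero]
        exact fun hq => hu ⟨hu2, hq.2.2⟩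
      · rw [indicator_of_notMem hu2]
  · rw [indicator_of_notMem hh]
    have : ∀ u, F h u = 0 := fun u =>
      indicator_of_notMem (fun hq => hh ⟨hq.1, hq.2.1⟩) _
    simp [this]

lemma hasDerivAt_integral_of_continuousOn_Ioi {g : ℝ → ℝ} (hg : ContinuousOn g (Ioi 0))
    {x y : ℝ} (hx : 0 < x) (hy : 0 < y) :
    HasDerivAt (fun t => ∫ u in x..t, g u) (g y) y := by
  have hint : IntervalIntegrable g volume x y :=
    (hg.mono fun u hu => (lt_min hx hy).trans_le hu.1).intervalIntegrable
  exact intervalIntegral.integral_hasDerivAt_right hint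
    (hg.stronglyMeasurableAtFilter isOpen_Ioi y hy) (hg.continuousAt (Ioi_mem_nhds hy))

/-- The part of the density of `receiverDistLaw` that depends on the distance, integrated
against `f`. -/
noncomputable def distBracket (P : Params) (f : ℝ → ℝ) : ℝ :=
  (∫ u in P.h1..P.h2, u ^ 2 * f u) - P.h1 * (∫ u in P.h1..(P.h1 / Real.cos P.phi), u * f u)
    + P.h2 * (∫ u in P.h2..(P.h2 / Real.cos P.phi), u * f u)
    - Real.cos P.phi * ∫ u in (P.h1 / Real.cos P.phi)..(P.h2 / Real.cos P.phi), u ^ 2 * f u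

lemma Valid.continuousOn_integral_Ioc (hP : P.Valid) {f : ℝ → ℝ} (hf : ContinuousOn f (Ioi 0)) :
    ContinuousOn (fun h => ∫ u in h..(h / Real.cos P.phi), u * f u) (Ioi 0) := by
  have hc := hP.cos_pos
  have hg : ContinuousOn (fun u => u * f u) (Ioi 0) := continuousOn_id.mul hf
  have hU : ContinuousOn (fun t => ∫ u in (1 : ℝ)..t, u * f u) (Ioi 0) := fun y hy =>
    (hasDerivAt_integral_of_continuousOn_Ioi hg one_pos hy).continuousAt.continuousWithinAt
  have h1 : ContinuousOn (fun h => (∫ u in (1 : ℝ)..(h / Real.cos P.phi), u * f u) -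
      ∫ u in (1 : ℝ)..h, u * f u) (Ioi 0) := by
    refine ContinuousOn.sub (hU.comp (by fun_prop) fun h hh => ?_) hU
    exact div_pos hh hc
  refine h1.congr fun h hh => ?_
  have hh : 0 < h := hh
  have hi : ∀ y : ℝ, 0 < y → IntervalIntegrable (fun u => u * f u) volume 1 y := fun y hy =>
    (hg.mono fun u hu => (lt_min one_pos hy).trans_le hu.1).intervalIntegrable
  exact (intervalIntegral.integral_interval_sub_left (hi _ (by positivity)) (hi _ hh)).symm

/-- If `U`, `V` are primitives of `u f(u)` and `u² f(u)`, then `V(h) + h (U(h/c) - U(h)) - c V(h/c)`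
is a primitive in `h` of the inner integral: all boundary terms cancel. No distinction between `h₂ <
h₁/c` and `h₂ ≥ h₁/c` is needed. -/
lemma Valid.integral_integral_eq_distBracket (hP : P.Valid) {f : ℝ → ℝ}
    (hf : ContinuousOn f (Ioi 0)) :
    ∫ h in P.h1..P.h2, ∫ u in h..(h / Real.cos P.phi), u * f u = P.distBracket f := by
  have hc := hP.cos_pos
  have h1 := hP.h1_pos
  have h2 := hP.h2_pos
  have hg : ContinuousOn (fun u => u * f u) (Ioi 0) := continuousOn_id.mul hf
  have hg2 : ContinuousOn (fun u => u ^ 2 * f u) (Ioi 0) := (continuousOn_pow 2).mul hf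
  have hi : ∀ x y : ℝ, 0 < x → 0 < y → IntervalIntegrable (fun u => u * f u) volume x y :=
    fun x y hx hy => (hg.mono fun u hu => (lt_min hx hy).trans_le hu.1).intervalIntegrable
  have hi2 : ∀ x y : ℝ, 0 < x → 0 < y → IntervalIntegrable (fun u => u ^ 2 * f u) volume x y :=
    fun x y hx hy => (hg2.mono fun u hu => (lt_min hx hy).trans_le hu.1).intervalIntegrable
  set U : ℝ → ℝ := fun t => ∫ u in P.h1..t, u * f u with hU
  set V : ℝ → ℝ := fun t => ∫ u in P.h1..t, u ^ 2 * f u with hV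
  set c := Real.cos P.phi with hcdef
  have hUV : ∀ x y : ℝ, 0 < x → 0 < y → ∫ u in x..y, u * f u = U y - U x := fun x y hx hy =>
    (intervalIntegral.integral_interval_sub_left (hi _ _ h1 hy) (hi _ _ h1 hx)).symm
  have hVV : ∀ x y : ℝ, 0 < x → 0 < y → ∫ u in x..y, u ^ 2 * f u = V y - V x :=
    fun x y hx hy =>
    (intervalIntegral.integral_interval_sub_left (hi2 _ _ h1 hy) (hi2 _ _ h1 hx)).symm
  have hpos : ∀ h ∈ uIcc P.h1 P.h2, 0 < h := fun h hh => (lt_min h1 h2).trans_le hh.1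
  have hder : ∀ h ∈ uIcc P.h1 P.h2,
      HasDerivAt (fun h => V h + h * (U (h / c) - U h) - c * V (h / c))
        (∫ u in h..(h / c), u * f u) h := by
    intro h hh
    have hh := hpos h hh
    have hhc : 0 < h / c := div_pos hh hc
    have dV := hasDerivAt_integral_of_continuousOn_Ioi hg2 h1 hh
    have dU := hasDerivAt_integral_of_continuousOn_Ioi hg h1 hh
    have dd : HasDerivAt (fun h : ℝ => h / c) (1 / c) h := (hasDerivAt_id h).div_const c
    have dVc := (hasDerivAt_integral_of_continuousOn_Ioi hg2 h1 hhc).comp h dd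
    have dUc := (hasDerivAt_integral_of_continuousOn_Ioi hg h1 hhc).comp h dd
    refine ((dV.add ((hasDerivAt_id h).mul (dUc.sub dU))).sub (dVc.const_mul c)).congr_deriv ?_
    rw [hUV h (h / c) hh hhc]
    simp only [Function.comp, Pi.sub_apply, id]
    rw [hU]
    field_simp
    ring
  have hcont : ContinuousOn (fun h => ∫ u in h..(h / c), u * f u) (uIcc P.h1 P.h2) :=
    (hP.continuousOn_integral_Ioc hf).mono hpos
  rw [intervalIntegral.integral_eq_sub_of_hasDerivAt hder hcont.intervalIntegrable, distBracket,
    hUV _ _ h1 (div_pos h1 hc), hUV _ _ h2 (div_pos h2 hc), hVV _ _ h1 h2,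
    hVV _ _ (div_pos h1 hc) (div_pos h2 hc)]
  ring

lemma Valid.lintegral_truncatedCone_ofReal (hP : P.Valid) {f : ℝ → ℝ} (hfm : Measurable f)
    (hf : ContinuousOn f (Ioi 0)) (hf0 : ∀ u, 0 < u → 0 ≤ f u) :
    ∫⁻ x in P.truncatedCone, ENNReal.ofReal (f (dist P.transmitter x)) =
      ENNReal.ofReal (2 * Real.pi * P.distBracket f) := by
  have hc := hP.cos_pos
  have hdiv : ∀ h, 0 < h → h ≤ h / Real.cos P.phi := fun h hh =>
    le_div_self hh.le hc hP.cos_lt_one.le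
  have hg : ContinuousOn (fun u => u * f u) (Ioi 0) := continuousOn_id.mul hf
  rw [hP.lintegral_truncatedCone (g := fun u => ENNReal.ofReal (f u)) (by fun_prop),
    ENNReal.ofReal_mul (p := 2 * Real.pi) (by positivity), ← hP.integral_integral_eq_distBracket hf,
    intervalIntegral.integral_of_le hP.h1_lt.le, ← integral_Icc_eq_integral_Ioc]
  congr 1
  have hin : ∀ h ∈ Icc P.h1 P.h2,
      ∫⁻ u in Ioc h (h / Real.cos P.phi), ENNReal.ofReal u * ENNReal.ofReal (f u) =
        ENNReal.ofReal (∫ u in h..(h / Real.cos P.phi), u * f u) := by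
    intro h hh
    have h0 : 0 < h := hP.h1_pos.trans_le hh.1
    rw [intervalIntegral.integral_of_le (hdiv h h0), ofReal_integral_eq_lintegral_ofReal]
    · refine setLIntegral_congr_fun measurableSet_Ioc fun u hu => ?_
      exact (ENNReal.ofReal_mul (h0.trans hu.1).le).symm
    · exact (hg.mono fun u hu => h0.trans_le hu.1).integrableOn_Icc.mono_set Ioc_subset_Icc_self
    · filter_upwards [ae_restrict_mem measurableSet_Ioc] with u hu
      have hu0 : 0 < u := h0.trans hu.1
      exact mul_nonneg hu0.le (hf0 u hu0)
  rw [setLIntegral_congr_fun measurableSet_Icc hin, ofReal_integral_eq_lintegral_ofReal]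
  · exact ((hP.continuousOn_integral_Ioc hf).mono
      fun h hh => hP.h1_pos.trans_le hh.1).integrableOn_Icc
  · filter_upwards [ae_restrict_mem measurableSet_Icc] with h hh
    have h0 : 0 < h := hP.h1_pos.trans_le hh.1
    exact intervalIntegral.integral_nonneg (hdiv h h0) fun u hu =>
      mul_nonneg (h0.trans_le hu.1).le (hf0 u (h0.trans_le hu.1))

lemma Valid.distBracket_one (hP : P.Valid) :
    P.distBracket (fun _ => 1) = Real.tan P.phi ^ 2 * (P.h2 ^ 3 - P.h1 ^ 3) / 6 := by
  have hc := hP.cos_pos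
  rw [eq_sub_of_add_eq' hP.one_add_tan_sq, distBracket]
  simp only [mul_one, integral_pow, integral_id]
  push_cast
  field_simp
  ring

lemma Valid.volume_truncatedCone (hP : P.Valid) :
    volume P.truncatedCone =
      ENNReal.ofReal (2 * Real.pi * (Real.tan P.phi ^ 2 * (P.h2 ^ 3 - P.h1 ^ 3) / 6)) := by
  rw [← hP.distBracket_one, ← hP.lintegral_truncatedCone_ofReal (f := fun _ => 1) (by fun_prop)
    (by fun_prop) (fun _ _ => zero_le_one)]
  simp

lemma Valid.cube_sub_pos (hP : P.Valid) : 0 < P.h2 ^ 3 - P.h1 ^ 3 :=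
  sub_pos.2 (pow_lt_pow_left₀ hP.h1_lt hP.h1_pos.le (by norm_num))

/-- The truncation depth `h₁ > 0` keeps the cone away from its apex, so `f` matters only on the
positive half-line. The factor `6 / (tan² φ (h₂³ - h₁³))` is `2π` over the volume of the cone. -/
lemma Valid.integral_receiverDistLaw (hP : P.Valid) {f : ℝ → ℝ} (hfm : Measurable f)
    (hf : ContinuousOn f (Ioi 0)) (hf0 : ∀ u, 0 < u → 0 ≤ f u) :
    ∫ u, f u ∂P.receiverDistLaw =
      6 / (Real.tan P.phi ^ 2 * (P.h2 ^ 3 - P.h1 ^ 3)) * P.distBracket f := by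
  have hc := hP.cos_pos
  have ht := hP.tan_pos
  have h3 := hP.cube_sub_pos
  have hpos : ∀ᵐ x ∂(volume.restrict P.truncatedCone), 0 < dist P.transmitter x := by
    filter_upwards [ae_restrict_mem measurableSet_truncatedCone] with x hx
    have hx' : P.transmitter - (P.transmitter - x) ∈ P.truncatedCone := by rwa [sub_sub_cancel]
    have := ((hP.mem_truncatedCone_iff _).1 hx').1
    rw [dist_eq_norm, norm_pos_iff]
    intro h
    rw [h] at this
    exact absurd this.1 (by simp [hP.h1_pos])
  have hB : 0 ≤ P.distBracket f := by
    rw [← hP.integral_integral_eq_distBracket hf]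
    refine intervalIntegral.integral_nonneg hP.h1_lt.le fun h hh => ?_
    have h0 : 0 < h := hP.h1_pos.trans_le hh.1
    exact intervalIntegral.integral_nonneg (le_div_self h0.le hc hP.cos_lt_one.le) fun u hu =>
      mul_nonneg (h0.trans_le hu.1).le (hf0 u (h0.trans_le hu.1))
  unfold receiverDistLaw receiverLaw ProbabilityTheory.cond
  rw [integral_map (by fun_prop) hfm.aestronglyMeasurable, integral_smul_measure,
    integral_eq_lintegral_of_nonneg_ae (hpos.mono fun x hx => hf0 _ hx)
      (Measurable.aestronglyMeasurable (by fun_prop)),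
    hP.lintegral_truncatedCone_ofReal hfm hf hf0, hP.volume_truncatedCone, ENNReal.toReal_inv,
    ENNReal.toReal_ofReal (by positivity), ENNReal.toReal_ofReal (by positivity), smul_eq_mul]
  field_simp

lemma Valid.ae_receiverDistLaw (hP : P.Valid) :
    ∀ᵐ u ∂P.receiverDistLaw, u ∈ Icc P.h1 (P.h2 / Real.cos P.phi) := by
  have hc := hP.cos_pos
  refine (ae_map_iff (p := fun u => u ∈ Icc P.h1 (P.h2 / Real.cos P.phi)) (by fun_prop)
    measurableSet_Icc).2 ?_
  unfold receiverLaw ProbabilityTheory.cond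
  refine Measure.ae_smul_measure ?_ _
  filter_upwards [ae_restrict_mem measurableSet_truncatedCone] with x hx
  have hx' : P.transmitter - (P.transmitter - x) ∈ P.truncatedCone := by rwa [sub_sub_cancel]
  obtain ⟨h1, h2⟩ := (hP.mem_truncatedCone_iff _).1 hx'
  rw [dist_eq_norm]
  constructor
  · refine h1.1.trans ((le_abs_self _).trans ?_)
    exact PiLp.norm_apply_le (P.transmitter - x) (2 : Fin 3)
  · exact h2.trans (by gcongr; exact h1.2)

end Params

/-! ### Series expansions under the integral sign -/

/-- Dominated convergence with the majorants `|g| B^j / j!`, of sum `|g| e^B`. Both series over `k₂`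
come from here; the need for a bounded `t` forces a different expansion in each regime. -/
lemma hasSum_integral_mul_exp_neg {α : Type*} [MeasurableSpace α] {μ : Measure α} {g t : α → ℝ}
    (hg : Integrable g μ) (ht : AEStronglyMeasurable t μ) {B : ℝ}
    (hB : ∀ᵐ x ∂μ, 0 ≤ t x ∧ t x ≤ B) :
    HasSum (fun j : ℕ => (-1) ^ j / (j.factorial : ℝ) * ∫ x, g x * t x ^ j ∂μ)
      (∫ x, g x * Real.exp (-t x) ∂μ) := by
  simp_rw [← integral_const_mul]
  have hexp : ∀ y : ℝ, HasSum (fun j : ℕ => y ^ j / (j.factorial : ℝ)) (Real.exp y) := fun y => by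
    rw [Real.exp_eq_exp_ℝ]
    exact NormedSpace.expSeries_div_hasSum_exp y
  refine hasSum_integral_of_dominated_convergence
    (fun j x => ‖g x‖ * (B ^ j / (j.factorial : ℝ))) (fun j => ?_) (fun j => ?_) ?_ ?_ ?_
  · exact (hg.aestronglyMeasurable.mul (ht.pow j)).const_mul _
  · filter_upwards [hB] with x hx
    have : t x ^ j ≤ B ^ j := pow_le_pow_left₀ hx.1 hx.2 j
    rw [norm_mul, norm_mul, norm_div, norm_pow, norm_neg, norm_one, one_pow, norm_pow,
      Real.norm_of_nonneg hx.1, Real.norm_of_nonneg (by positivity : (0 : ℝ) ≤ j.factorial)]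
    calc 1 / (j.factorial : ℝ) * (‖g x‖ * t x ^ j)
        ≤ 1 / (j.factorial : ℝ) * (‖g x‖ * B ^ j) := by gcongr
      _ = _ := by ring
  · filter_upwards with x
    exact (hexp B).summable.mul_left _
  · simp_rw [tsum_mul_left]
    exact hg.norm.mul_const _
  · filter_upwards with x
    refine ((hexp (-t x)).mul_left (g x)).congr_fun fun j => ?_
    rw [neg_pow]; ring

lemma pow_mul_exp_neg_le_factorial (n : ℕ) {t : ℝ} (ht : 0 ≤ t) :
    t ^ n * Real.exp (-t) ≤ n.factorial := by
  have := Real.pow_div_factorial_le_exp t ht n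
  rw [div_le_iff₀ (by positivity)] at this
  rw [Real.exp_neg, ← div_eq_mul_inv, div_le_iff₀ (Real.exp_pos _), mul_comm]
  exact this

/-- Half of the exponential absorbs the power and the other half is kept for integrability. -/
lemma pow_mul_exp_neg_le (n : ℕ) {b t : ℝ} (hb : 0 < b) (ht : 0 ≤ t) :
    t ^ n * Real.exp (-(b * t)) ≤ n.factorial * (2 / b) ^ n * Real.exp (-(b / 2 * t)) := by
  have h := pow_mul_exp_neg_le_factorial n (t := b / 2 * t) (by positivity)
  have h1 : Real.exp (-(b * t)) = Real.exp (-(b / 2 * t)) * Real.exp (-(b / 2 * t)) := by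
    rw [← Real.exp_add]; congr 1; ring
  have h2 : t ^ n = (2 / b) ^ n * (b / 2 * t) ^ n := by
    rw [← mul_pow]; congr 1; field_simp
  rw [h1, h2]
  calc _ = ((b / 2 * t) ^ n * Real.exp (-(b / 2 * t))) *
        ((2 / b) ^ n * Real.exp (-(b / 2 * t))) := by ring
    _ ≤ n.factorial * ((2 / b) ^ n * Real.exp (-(b / 2 * t))) := by gcongr
    _ = _ := by ring

/-! ### Positivity of the derived constants, and normalisation of the distance laws -/

namespace Params

variable {P : Params}

lemma Valid.chiRE_pos (hP : P.Valid) : 0 < P.chiRE := by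
  have h1 : 0 < 1 - P.rho := by linarith [hP.rho_lt]
  refine mul_pos hP.chi_pos ?_
  rcases hP.rho_nonneg.eq_or_lt with h | h
  · have := hP.harvest
    rw [← h] at this ⊢
    simpa using this
  · have := hP.eps_nonneg
    positivity

lemma Valid.muEps_pos (hP : P.Valid) : 0 < P.muEps := by
  have h1 : 0 < 1 - P.eps := by linarith [hP.eps_lt]
  have := hP.mu_pos
  have := hP.sigmaR_pos
  have := hP.sigmaRB_pos
  unfold muEps
  positivity

lemma Valid.D_pos (hP : P.Valid) {γ : ℝ} (hγ : 0 < γ) : 0 < P.D γ :=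
  mul_pos (mul_pos hP.muEps_pos hP.chiRE_pos) hγ

lemma Valid.a_pos (hP : P.Valid) {γ : ℝ} (hγ : 0 < γ) : 0 < P.a γ := by
  have := hP.K_nonneg
  have := hP.sigmaT_pos
  have := hP.eta_pos
  have := hP.Pth_pos
  unfold a Theta
  positivity

lemma Valid.mSR_cast_pos (hP : P.Valid) : (0 : ℝ) < P.mSR := Nat.cast_pos.2 hP.mSR_pos

lemma Valid.betaBar_pos (hP : P.Valid) : 0 < P.betaBar := by
  have h1 := hP.mSR_cast_pos
  have h2 := hP.bSR_pos
  have h3 := hP.OmegaSR_nonneg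
  have : P.betaBar = P.mSR / (2 * P.bSR * P.mSR + P.OmegaSR) := by
    unfold betaBar betaSR deltaSR
    field_simp
    ring
  rw [this]
  positivity

lemma Valid.alphaSR_pos (hP : P.Valid) : 0 < P.alphaSR := by
  have h1 := hP.mSR_cast_pos
  have h2 := hP.bSR_pos
  have h3 := hP.OmegaSR_nonneg
  unfold alphaSR
  positivity

lemma Valid.isProbabilityMeasure_satelliteDistLaw (hP : P.Valid) :
    IsProbabilityMeasure P.satelliteDistLaw := by
  have h1 := hP.wER_pos
  have h2 := hP.wMin_pos
  refine ⟨?_⟩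
  rw [hP.satelliteDistLaw_eq, Measure.smul_apply, Measure.map_apply (by fun_prop) .univ,
    preimage_univ, Measure.restrict_apply_univ, Real.volume_Icc, smul_eq_mul]
  rw [show 1 - P.wER / (P.wER + P.wMin) = P.wMin / (P.wER + P.wMin) by field_simp; ring]
  refine ENNReal.inv_mul_cancel ?_ ENNReal.ofReal_ne_top
  simp only [ne_eq, ENNReal.ofReal_eq_zero, not_le]
  positivity

lemma Valid.isProbabilityMeasure_receiverDistLaw (hP : P.Valid) :
    IsProbabilityMeasure P.receiverDistLaw := by
  have h1 := hP.tan_pos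
  have h2 := hP.cube_sub_pos
  have : IsProbabilityMeasure P.receiverLaw := by
    refine cond_isProbabilityMeasure_of_finite ?_ ?_
    · rw [hP.volume_truncatedCone]
      simp only [ne_eq, ENNReal.ofReal_eq_zero, not_le]
      positivity
    · rw [hP.volume_truncatedCone]
      exact ENNReal.ofReal_ne_top
  exact Measure.isProbabilityMeasure_map (by fun_prop)

/-! ### The reduced integration domain -/

/-- The joint law of the two distances, times Lebesgue measure on a half-line. -/
noncomputable def baseMeasure (P : Params) (y₀ : ℝ) : Measure ((ℝ × ℝ) × ℝ) :=
  (P.satelliteDistLaw.prod P.receiverDistLaw).prod (volume.restrict (Ioi y₀))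

lemma Valid.ae_baseMeasure (hP : P.Valid) (y₀ : ℝ) :
    ∀ᵐ q ∂P.baseMeasure y₀, q.1.1 ∈ Icc P.wMin P.wMax ∧
      q.1.2 ∈ Icc P.h1 (P.h2 / Real.cos P.phi) ∧ y₀ < q.2 := by
  have := hP.isProbabilityMeasure_satelliteDistLaw
  have := hP.isProbabilityMeasure_receiverDistLaw
  have h1 : ∀ᵐ r ∂(P.satelliteDistLaw.prod P.receiverDistLaw), r.1 ∈ Icc P.wMin P.wMax :=
    Measure.quasiMeasurePreserving_fst.ae hP.ae_satelliteDistLaw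
  have h2 : ∀ᵐ r ∂(P.satelliteDistLaw.prod P.receiverDistLaw),
      r.2 ∈ Icc P.h1 (P.h2 / Real.cos P.phi) :=
    Measure.quasiMeasurePreserving_snd.ae hP.ae_receiverDistLaw
  have h3 : ∀ᵐ y ∂(volume.restrict (Ioi y₀)), y₀ < y := ae_restrict_mem measurableSet_Ioi
  have h4 := (Measure.quasiMeasurePreserving_fst (μ := P.satelliteDistLaw.prod P.receiverDistLaw)
    (ν := volume.restrict (Ioi y₀))).ae (h1.and h2)
  have h5 := (Measure.quasiMeasurePreserving_snd (μ := P.satelliteDistLaw.prod P.receiverDistLaw)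
    (ν := volume.restrict (Ioi y₀))).ae h3
  unfold baseMeasure
  filter_upwards [h4, h5] with q hq1 hq2
  exact ⟨hq1.1, hq1.2, hq2⟩

/-- The distances have probability laws on compact intervals, so exponential decay in `y`, uniform
in `(w, u)`, is enough. -/
lemma Valid.integrable_baseMeasure_of_le (hP : P.Valid) {y₀ : ℝ} {f : (ℝ × ℝ) × ℝ → ℝ}
    (hfm : Measurable f) {M b : ℝ} (hb : 0 < b)
    (hf : ∀ w ∈ Icc P.wMin P.wMax, ∀ u ∈ Icc P.h1 (P.h2 / Real.cos P.phi), ∀ y, y₀ < y →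
      |f ((w, u), y)| ≤ M * Real.exp (-(b * y))) :
    Integrable f (P.baseMeasure y₀) := by
  have := hP.isProbabilityMeasure_satelliteDistLaw
  have := hP.isProbabilityMeasure_receiverDistLaw
  have h1 : Integrable (fun y => M * Real.exp (-(b * y))) (volume.restrict (Ioi y₀)) := by
    refine Integrable.const_mul ?_ M
    have := integrableOn_exp_mul_Ioi (a := -b) (by linarith) y₀
    simpa [IntegrableOn] using this
  refine Integrable.mono' (h1.comp_snd (P.satelliteDistLaw.prod P.receiverDistLaw))
    hfm.aestronglyMeasurable ?_
  filter_upwards [hP.ae_baseMeasure y₀] with q hq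
  exact hf q.1.1 hq.1 q.1.2 hq.2.1 q.2 hq.2.2

/-- The shadowed-Rician density of index `k` after the substitution `x = w² (y + 𝒟) / 𝒞`. -/
noncomputable def fadingKernel (P : Params) (γ : ℝ) (k : ℕ) (q : (ℝ × ℝ) × ℝ) : ℝ :=
  q.1.1 ^ 2 / P.C γ * (q.1.1 ^ 2 * (q.2 + P.D γ) / P.C γ) ^ k *
    Real.exp (-(P.betaBar * (q.1.1 ^ 2 * (q.2 + P.D γ) / P.C γ)))

/-- The threshold of `(1 + K) |g_rt|²` after the substitution `x = w² (y + 𝒟) / 𝒞`. -/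
noncomputable def threshold (P : Params) (γ : ℝ) (q : (ℝ × ℝ) × ℝ) : ℝ :=
  P.a γ * q.1.2 ^ P.nu * (q.2 + P.D γ) / (P.C γ * q.2)

/-- The part `a u^ν / 𝒞` of the threshold that does not depend on `y`. -/
noncomputable def constPart (P : Params) (γ : ℝ) (q : (ℝ × ℝ) × ℝ) : ℝ :=
  P.a γ * q.1.2 ^ P.nu / P.C γ

/-- The part `a u^ν 𝒟 / (𝒞 y)` of the threshold. -/
noncomputable def invPart (P : Params) (γ : ℝ) (q : (ℝ × ℝ) × ℝ) : ℝ :=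
  P.a γ * q.1.2 ^ P.nu * P.D γ / (P.C γ * q.2)

/-- The binomial components of `fadingKernel * threshold ^ n`. -/
noncomputable def binomKernel (P : Params) (γ : ℝ) (k n k1 : ℕ) (q : (ℝ × ℝ) × ℝ) : ℝ :=
  q.1.1 ^ (2 * k + 2) / P.C γ ^ (k + 1) *
    Real.exp (-(P.betaBar * (q.1.1 ^ 2 * (q.2 + P.D γ) / P.C γ))) *
    P.constPart γ q ^ n * P.D γ ^ (k + n - k1) * (q.2 ^ k1 / q.2 ^ n)

lemma measurable_fadingKernel (γ : ℝ) (k : ℕ) : Measurable (P.fadingKernel γ k) := by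
  unfold fadingKernel; fun_prop

lemma measurable_threshold (γ : ℝ) : Measurable (P.threshold γ) := by
  unfold threshold; fun_prop

lemma measurable_constPart (γ : ℝ) : Measurable (P.constPart γ) := by
  unfold constPart; fun_prop

lemma measurable_invPart (γ : ℝ) : Measurable (P.invPart γ) := by
  unfold invPart; fun_prop

lemma measurable_binomKernel (γ : ℝ) (k n k1 : ℕ) : Measurable (P.binomKernel γ k n k1) := by
  unfold binomKernel constPart; fun_prop

lemma threshold_eq {γ : ℝ} {q : (ℝ × ℝ) × ℝ} (hq : q.2 ≠ 0) :
    P.threshold γ q = P.constPart γ q + P.invPart γ q := by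
  unfold threshold constPart invPart
  field_simp

/-- The density contributes `(y + 𝒟)^k` and the threshold `(y + 𝒟)^n`; one binomial expansion of the
product yields the index `k₁`. -/
lemma fadingKernel_mul_threshold_pow (γ : ℝ) (k n : ℕ) {q : (ℝ × ℝ) × ℝ} :
    P.fadingKernel γ k q * P.threshold γ q ^ n =
      ∑ k1 ∈ Finset.range (k + n + 1), ((k + n).choose k1 : ℝ) * P.binomKernel γ k n k1 q := by
  have h : (q.2 + P.D γ) ^ k * (q.2 + P.D γ) ^ n = ∑ k1 ∈ Finset.range (k + n + 1),
      q.2 ^ k1 * P.D γ ^ (k + n - k1) * ((k + n).choose k1 : ℝ) := by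
    rw [← pow_add, add_pow]
  have h2 : P.fadingKernel γ k q * P.threshold γ q ^ n =
      q.1.1 ^ (2 * k + 2) / P.C γ ^ (k + 1) *
      Real.exp (-(P.betaBar * (q.1.1 ^ 2 * (q.2 + P.D γ) / P.C γ))) *
      P.constPart γ q ^ n / q.2 ^ n * ((q.2 + P.D γ) ^ k * (q.2 + P.D γ) ^ n) := by
    unfold fadingKernel threshold constPart
    simp only [div_pow, mul_pow, ← pow_mul]
    rw [pow_add q.1.1, pow_succ (P.C γ)]
    ring
  rw [h2, h, Finset.mul_sum]
  refine Finset.sum_congr rfl fun k1 _ => ?_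
  unfold binomKernel
  ring

section Estimates

variable {γ : ℝ}

lemma Valid.exp_le (hP : P.Valid) (hγ : 0 < γ) (hC : 0 < P.C γ) {w y : ℝ} (hw : P.wMin ≤ w)
    (hy : 0 < y) :
    Real.exp (-(P.betaBar * (w ^ 2 * (y + P.D γ) / P.C γ))) ≤
      Real.exp (-(P.betaBar * P.wMin ^ 2 / P.C γ * (y + P.D γ))) := by
  have h1 := hP.betaBar_pos
  have h2 := hP.wMin_pos
  have h3 := hP.D_pos hγ
  have h4 : P.wMin ^ 2 ≤ w ^ 2 := pow_le_pow_left₀ h2.le hw 2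
  refine Real.exp_le_exp.2 (neg_le_neg ?_)
  calc P.betaBar * P.wMin ^ 2 / P.C γ * (y + P.D γ)
      = P.betaBar * (P.wMin ^ 2 * (y + P.D γ) / P.C γ) := by ring
    _ ≤ _ := by gcongr

lemma Valid.fadingKernel_nonneg (hP : P.Valid) (hγ : 0 < γ) (hC : 0 < P.C γ) (k : ℕ)
    {q : (ℝ × ℝ) × ℝ} (hy : 0 < q.2) : 0 ≤ P.fadingKernel γ k q := by
  have h3 := hP.D_pos hγ
  unfold fadingKernel
  positivity

lemma Valid.integrable_fadingKernel (hP : P.Valid) (hγ : 0 < γ) (hC : 0 < P.C γ) {y₀ : ℝ}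
    (hy₀ : 0 ≤ y₀) (k : ℕ) : Integrable (P.fadingKernel γ k) (P.baseMeasure y₀) := by
  have h1 := hP.betaBar_pos
  have h2 := hP.wMin_pos
  have h3 := hP.D_pos hγ
  set b := P.betaBar * P.wMin ^ 2 / P.C γ with hb
  have hb0 : 0 < b := by positivity
  refine hP.integrable_baseMeasure_of_le (measurable_fadingKernel γ k)
    (M := P.wMax ^ 2 / P.C γ * (P.wMax ^ 2 / P.C γ) ^ k * (k.factorial * (2 / b) ^ k))
    (b := b / 2) (by positivity) fun w hw u _ y hy => ?_
  have hy0 : 0 < y := hy₀.trans_lt hy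
  rw [abs_of_nonneg (hP.fadingKernel_nonneg hγ hC k hy0)]
  have hw0 : 0 < w := h2.trans_le hw.1
  have hw2 : w ^ 2 ≤ P.wMax ^ 2 := pow_le_pow_left₀ hw0.le hw.2 2
  have h4 := pow_mul_exp_neg_le k hb0 (t := y + P.D γ) (by positivity)
  have h5 : Real.exp (-(b / 2 * (y + P.D γ))) ≤ Real.exp (-(b / 2 * y)) := by
    refine Real.exp_le_exp.2 (neg_le_neg ?_)
    gcongr
    linarith
  unfold fadingKernel
  calc _ ≤ P.wMax ^ 2 / P.C γ * (P.wMax ^ 2 * (y + P.D γ) / P.C γ) ^ k *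
        Real.exp (-(b * (y + P.D γ))) := by
        refine mul_le_mul ?_ (hP.exp_le hγ hC hw.1 hy0) (Real.exp_pos _).le (by positivity)
        gcongr
    _ = P.wMax ^ 2 / P.C γ * (P.wMax ^ 2 / P.C γ) ^ k *
        ((y + P.D γ) ^ k * Real.exp (-(b * (y + P.D γ)))) := by
        rw [mul_div_right_comm, mul_pow]; ring
    _ ≤ P.wMax ^ 2 / P.C γ * (P.wMax ^ 2 / P.C γ) ^ k *
        (k.factorial * (2 / b) ^ k * Real.exp (-(b / 2 * y))) := by
        exact mul_le_mul_of_nonneg_left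
          (h4.trans (mul_le_mul_of_nonneg_left h5 (by positivity))) (by positivity)
    _ = _ := by ring

lemma Valid.constPart_mem (hP : P.Valid) (hγ : 0 < γ) (hC : 0 < P.C γ) {q : (ℝ × ℝ) × ℝ}
    (hu : q.1.2 ∈ Icc P.h1 (P.h2 / Real.cos P.phi)) :
    0 ≤ P.constPart γ q ∧
      P.constPart γ q ≤ P.a γ * (P.h2 / Real.cos P.phi) ^ P.nu / P.C γ := by
  have h1 := hP.a_pos hγ
  have h2 : 0 < q.1.2 := hP.h1_pos.trans_le hu.1
  have h3 := hP.nu_pos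
  unfold constPart
  refine ⟨by positivity, ?_⟩
  gcongr
  exact hu.2

/-- The dangerous factor is `c^n y^(-n)`, with `c` the constant part; since `(c𝒟/y)^n e^(-c𝒟/y) ≤
n!`, the exponential of the inverse part controls it uniformly in `u`. Hence the lower limit `y₀ =
0` is allowed. -/
lemma Valid.integrable_binomKernel_mul_exp (hP : P.Valid) (hγ : 0 < γ) (hC : 0 < P.C γ) {y₀ : ℝ}
    (hy₀ : 0 ≤ y₀) (k n k1 : ℕ) :
    Integrable (fun q => P.binomKernel γ k n k1 q * Real.exp (-P.invPart γ q))
      (P.baseMeasure y₀) := by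
  have h1 := hP.betaBar_pos
  have h2 := hP.wMin_pos
  have h3 := hP.D_pos hγ
  set b := P.betaBar * P.wMin ^ 2 / P.C γ with hb
  have hb0 : 0 < b := by positivity
  refine hP.integrable_baseMeasure_of_le
    ((measurable_binomKernel γ k n k1).mul (measurable_invPart γ).neg.exp)
    (M := P.wMax ^ (2 * k + 2) / P.C γ ^ (k + 1) * (n.factorial / P.D γ ^ n) *
      P.D γ ^ (k + n - k1) * (k1.factorial * (2 / b) ^ k1))
    (b := b / 2) (by positivity) fun w hw u hu y hy => ?_
  have hy0 : 0 < y := hy₀.trans_lt hy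
  have hw0 : 0 < w := h2.trans_le hw.1
  have hs := (hP.constPart_mem hγ hC (q := ((w, u), y)) hu).1
  have hT : P.invPart γ ((w, u), y) = P.constPart γ ((w, u), y) * P.D γ / y := by
    unfold invPart constPart
    field_simp
  have hfac := pow_mul_exp_neg_le_factorial n
    (t := P.constPart γ ((w, u), y) * P.D γ / y) (by positivity)
  have h4 := pow_mul_exp_neg_le k1 hb0 hy0.le
  have h5 : Real.exp (-(b * (y + P.D γ))) ≤ Real.exp (-(b * y)) := by
    refine Real.exp_le_exp.2 (neg_le_neg ?_)
    gcongr
    linarith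
  have hw2 : w ^ (2 * k + 2) ≤ P.wMax ^ (2 * k + 2) := pow_le_pow_left₀ hw0.le hw.2 _
  rw [hT]
  generalize hcdef : P.constPart γ ((w, u), y) = c at *
  have hsplit : P.binomKernel γ k n k1 ((w, u), y) * Real.exp (-(c * P.D γ / y)) =
      w ^ (2 * k + 2) / P.C γ ^ (k + 1) *
      ((c * P.D γ / y) ^ n * Real.exp (-(c * P.D γ / y)) / P.D γ ^ n) * P.D γ ^ (k + n - k1) *
      (y ^ k1 * Real.exp (-(P.betaBar * (w ^ 2 * (y + P.D γ) / P.C γ)))) := by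
    unfold binomKernel
    simp only [hcdef, div_pow, mul_pow]
    field_simp
  have hwM : 0 < P.wMax := hw0.trans_le hw.2
  rw [hsplit, abs_of_nonneg (by positivity)]
  calc _ ≤ P.wMax ^ (2 * k + 2) / P.C γ ^ (k + 1) * (n.factorial / P.D γ ^ n) *
      P.D γ ^ (k + n - k1) * (k1.factorial * (2 / b) ^ k1 * Real.exp (-(b / 2 * y))) := by
        refine mul_le_mul ?_ (le_trans (mul_le_mul_of_nonneg_left
          ((hP.exp_le hγ hC hw.1 hy0).trans h5) (by positivity)) h4) (by positivity)
          (by positivity)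
        gcongr
    _ = _ := by ring

end Estimates

end Params

/-! ### The tail of the Rician power law -/

/-- The term of index `m` of the tail of the Rician power law, at the normalised level `s`. -/
noncomputable def ricianTerm (K : ℝ) (m : ℕ) (s : ℝ) : ℝ :=
  K ^ m * Real.exp (-K) / m.factorial *
    ∑ n ∈ Finset.range (m + 1), s ^ n / n.factorial * Real.exp (-s)

/-- The tail of the Rician power law, at the normalised level `s`. -/
noncomputable def ricianTail (K s : ℝ) : ℝ := ∑' m, ricianTerm K m s

lemma ricianTerm_nonneg {K s : ℝ} (hK : 0 ≤ K) (hs : 0 ≤ s) (m : ℕ) : 0 ≤ ricianTerm K m s := by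
  unfold ricianTerm
  have : 0 ≤ ∑ n ∈ Finset.range (m + 1), s ^ n / (n.factorial : ℝ) * Real.exp (-s) :=
    Finset.sum_nonneg fun n _ => by positivity
  positivity

/-- The inner sum is a Poisson distribution function, so at most `1`. The Poisson weights therefore
dominate the series over `m` uniformly in `s`. -/
lemma ricianTerm_le {K s : ℝ} (hK : 0 ≤ K) (hs : 0 ≤ s) (m : ℕ) :
    ricianTerm K m s ≤ K ^ m * Real.exp (-K) / m.factorial := by
  unfold ricianTerm
  refine mul_le_of_le_one_right (by positivity) ?_
  rw [← Finset.sum_mul, Real.exp_neg, ← div_eq_mul_inv, div_le_one (Real.exp_pos _)]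
  exact Real.sum_le_exp_of_nonneg hs _

lemma summable_poisson (K : ℝ) :
    Summable fun m : ℕ => K ^ m * Real.exp (-K) / (m.factorial : ℝ) := by
  refine ((Real.summable_pow_div_factorial K).mul_right (Real.exp (-K))).congr fun m => ?_
  ring

lemma hasSum_ricianTail {K s : ℝ} (hK : 0 ≤ K) (hs : 0 ≤ s) :
    HasSum (fun m => ricianTerm K m s) (ricianTail K s) :=
  (Summable.of_nonneg_of_le (ricianTerm_nonneg hK hs) (ricianTerm_le hK hs)
    (summable_poisson K)).hasSum

lemma ricianTail_nonneg {K s : ℝ} (hK : 0 ≤ K) (hs : 0 ≤ s) : 0 ≤ ricianTail K s :=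
  tsum_nonneg (ricianTerm_nonneg hK hs)

lemma measurable_ricianTerm (K : ℝ) (m : ℕ) : Measurable (ricianTerm K m) := by
  unfold ricianTerm; fun_prop

lemma measurable_ricianTail (K : ℝ) : Measurable (ricianTail K) :=
  Measurable.tsum (measurable_ricianTerm K)

namespace Params

variable {P : Params} {γ : ℝ}

lemma Valid.threshold_nonneg (hP : P.Valid) (hγ : 0 < γ) (hC : 0 < P.C γ) {q : (ℝ × ℝ) × ℝ}
    (hu : q.1.2 ∈ Icc P.h1 (P.h2 / Real.cos P.phi)) (hy : 0 < q.2) : 0 ≤ P.threshold γ q := by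
  have h1 := hP.a_pos hγ
  have h2 : 0 < q.1.2 := hP.h1_pos.trans_le hu.1
  have h3 := hP.D_pos hγ
  unfold threshold
  positivity

/-- The contribution of the index `k` of the shadowed-Rician density to the probability. -/
noncomputable def fadingIntegral (P : Params) (γ y₀ : ℝ) (k : ℕ) : ℝ :=
  ∫ q, P.fadingKernel γ k q * ricianTail P.K (P.threshold γ q) ∂P.baseMeasure y₀

/-- The contribution of a binomial component. -/
noncomputable def binomIntegral (P : Params) (γ y₀ : ℝ) (k n k1 : ℕ) : ℝ :=
  ∫ q, P.binomKernel γ k n k1 q * Real.exp (-P.threshold γ q) ∂P.baseMeasure y₀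

lemma Valid.binomKernel_mul_exp_threshold (hP : P.Valid) {y₀ : ℝ} (hy₀ : 0 ≤ y₀) (k n k1 : ℕ) :
    ∀ᵐ q ∂P.baseMeasure y₀, P.binomKernel γ k n k1 q * Real.exp (-P.threshold γ q) =
      P.binomKernel γ k n k1 q * Real.exp (-P.invPart γ q) * Real.exp (-P.constPart γ q) := by
  filter_upwards [hP.ae_baseMeasure y₀] with q hq
  rw [threshold_eq (hy₀.trans_lt hq.2.2).ne', neg_add, Real.exp_add]
  ring

lemma Valid.integrable_binomKernel_mul_exp_threshold (hP : P.Valid) (hγ : 0 < γ) (hC : 0 < P.C γ)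
    {y₀ : ℝ} (hy₀ : 0 ≤ y₀) (k n k1 : ℕ) :
    Integrable (fun q => P.binomKernel γ k n k1 q * Real.exp (-P.threshold γ q))
      (P.baseMeasure y₀) := by
  have h := (hP.integrable_binomKernel_mul_exp hγ hC hy₀ k n k1).mul_bdd (c := 1)
    (g := fun q => Real.exp (-P.constPart γ q))
    (measurable_constPart γ).neg.exp.aestronglyMeasurable ?_
  · refine h.congr ?_
    filter_upwards [hP.binomKernel_mul_exp_threshold (γ := γ) hy₀ k n k1] with q hq
    exact hq.symm
  · filter_upwards [hP.ae_baseMeasure y₀] with q hq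
    rw [Real.norm_of_nonneg (Real.exp_pos _).le, Real.exp_le_one_iff]
    linarith [(hP.constPart_mem hγ hC hq.2.1).1]

lemma Valid.integral_fadingKernel_mul_pow (hP : P.Valid) (hγ : 0 < γ) (hC : 0 < P.C γ)
    {y₀ : ℝ} (hy₀ : 0 ≤ y₀) (k n : ℕ) :
    Integrable (fun q => P.fadingKernel γ k q *
      (P.threshold γ q ^ n * Real.exp (-P.threshold γ q))) (P.baseMeasure y₀) ∧
    ∫ q, P.fadingKernel γ k q * (P.threshold γ q ^ n * Real.exp (-P.threshold γ q))
      ∂P.baseMeasure y₀ = ∑ k1 ∈ Finset.range (k + n + 1),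
        ((k + n).choose k1 : ℝ) * P.binomIntegral γ y₀ k n k1 := by
  have h : ∀ q, P.fadingKernel γ k q * (P.threshold γ q ^ n * Real.exp (-P.threshold γ q)) =
      ∑ k1 ∈ Finset.range (k + n + 1), ((k + n).choose k1 : ℝ) *
        (P.binomKernel γ k n k1 q * Real.exp (-P.threshold γ q)) := by
    intro q
    rw [← mul_assoc, fadingKernel_mul_threshold_pow, Finset.sum_mul]
    simp_rw [mul_assoc]
  have hint := fun k1 => hP.integrable_binomKernel_mul_exp_threshold hγ hC hy₀ k n k1
  simp_rw [h]
  refine ⟨integrable_finsetSum _ fun k1 _ => (hint k1).const_mul _, ?_⟩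
  rw [integral_finsetSum _ fun k1 _ => (hint k1).const_mul _]
  simp_rw [integral_const_mul]
  rfl

lemma Valid.integrable_fadingKernel_mul_ricianTail (hP : P.Valid) (hγ : 0 < γ) (hC : 0 < P.C γ)
    {y₀ : ℝ} (hy₀ : 0 ≤ y₀) (k : ℕ) :
    Integrable (fun q => P.fadingKernel γ k q * ricianTail P.K (P.threshold γ q))
      (P.baseMeasure y₀) := by
  refine (hP.integrable_fadingKernel hγ hC hy₀ k).mul_bdd
    (c := ∑' m : ℕ, P.K ^ m * Real.exp (-P.K) / (m.factorial : ℝ))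
    ((measurable_ricianTail _).comp (measurable_threshold γ)).aestronglyMeasurable ?_
  filter_upwards [hP.ae_baseMeasure y₀] with q hq
  have hS := hP.threshold_nonneg hγ hC hq.2.1 (hy₀.trans_lt hq.2.2)
  rw [Real.norm_of_nonneg (ricianTail_nonneg hP.K_nonneg hS)]
  exact (hasSum_ricianTail hP.K_nonneg hS).summable.tsum_le_tsum
    (ricianTerm_le hP.K_nonneg hS) (summable_poisson _)

/-- Termwise integration over `m`, dominated by the Poisson weights. It is done before any
exponential is expanded, so only iterated summability is obtained, and no bound uniform in `m` on
the series over `k₂` is needed. -/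
lemma Valid.hasSum_fadingIntegral (hP : P.Valid) (hγ : 0 < γ) (hC : 0 < P.C γ)
    {y₀ : ℝ} (hy₀ : 0 ≤ y₀) (k : ℕ) :
    HasSum (fun m : ℕ => P.K ^ m * Real.exp (-P.K) / m.factorial *
      ∑ n ∈ Finset.range (m + 1), 1 / (n.factorial : ℝ) * ∑ k1 ∈ Finset.range (k + n + 1),
        ((k + n).choose k1 : ℝ) * P.binomIntegral γ y₀ k n k1) (P.fadingIntegral γ y₀ k) := by
  have hterm : ∀ m : ℕ, P.K ^ m * Real.exp (-P.K) / m.factorial *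
      ∑ n ∈ Finset.range (m + 1), 1 / (n.factorial : ℝ) * ∑ k1 ∈ Finset.range (k + n + 1),
        ((k + n).choose k1 : ℝ) * P.binomIntegral γ y₀ k n k1 =
      ∫ q, P.fadingKernel γ k q * ricianTerm P.K m (P.threshold γ q) ∂P.baseMeasure y₀ := by
    intro m
    have h : ∀ q, P.fadingKernel γ k q * ricianTerm P.K m (P.threshold γ q) =
        P.K ^ m * Real.exp (-P.K) / m.factorial * ∑ n ∈ Finset.range (m + 1),
          1 / (n.factorial : ℝ) * (P.fadingKernel γ k q *
            (P.threshold γ q ^ n * Real.exp (-P.threshold γ q))) := by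
      intro q
      unfold ricianTerm
      rw [mul_left_comm, Finset.mul_sum]
      congr 1
      refine Finset.sum_congr rfl fun n _ => ?_
      ring
    simp_rw [h]
    have hI := fun n => hP.integral_fadingKernel_mul_pow hγ hC hy₀ k n
    rw [integral_const_mul, integral_finsetSum _ fun n _ => (hI n).1.const_mul _]
    simp_rw [integral_const_mul, (hI _).2]
  simp_rw [hterm]
  refine hasSum_integral_of_dominated_convergence
    (fun m q => ‖P.fadingKernel γ k q‖ * (P.K ^ m * Real.exp (-P.K) / (m.factorial : ℝ)))
    (fun m => ?_) (fun m => ?_) ?_ ?_ ?_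
  · exact ((measurable_fadingKernel γ k).mul
      ((measurable_ricianTerm _ m).comp (measurable_threshold γ))).aestronglyMeasurable
  · filter_upwards [hP.ae_baseMeasure y₀] with q hq
    have hS := hP.threshold_nonneg hγ hC hq.2.1 (hy₀.trans_lt hq.2.2)
    rw [norm_mul, Real.norm_of_nonneg (ricianTerm_nonneg hP.K_nonneg hS m)]
    gcongr
    exact ricianTerm_le hP.K_nonneg hS m
  · filter_upwards with q
    exact (summable_poisson _).mul_left _
  · simp_rw [tsum_mul_left]
    exact (hP.integrable_fadingKernel hγ hC hy₀ k).norm.mul_const _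
  · filter_upwards [hP.ae_baseMeasure y₀] with q hq
    exact (hasSum_ricianTail hP.K_nonneg
      (hP.threshold_nonneg hγ hC hq.2.1 (hy₀.trans_lt hq.2.2))).mul_left _

lemma Valid.prefactor_pos (hP : P.Valid) : 0 < P.prefactor := by
  have h1 := hP.alphaSR_pos
  have h2 := hP.wER_pos
  have h3 := hP.wMin_pos
  have h4 := hP.nu_pos
  have h5 := hP.tan_pos
  have h6 := hP.cube_sub_pos
  unfold prefactor
  positivity

/-- Common to both regimes: `X` holds the integrals left after expanding an exponential and `t` the
closed-form terms. A regime only has to supply the expansion `hX` and the termwise identity `ht`. -/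
lemma Valid.seriesConverge_and_sum_eq (hP : P.Valid) (hγ : 0 < γ) (hC : 0 < P.C γ)
    {y₀ : ℝ} (hy₀ : 0 ≤ y₀) {t : ℕ → ℕ → ℕ → ℕ → ℕ → ℝ} {X : ℕ → ℕ → ℕ → ℕ → ℝ}
    (hX : ∀ k n k1, k1 ≤ k + n →
      HasSum (fun j : ℕ => (-1) ^ j / (j.factorial : ℝ) * X k n k1 j)
        (P.binomIntegral γ y₀ k n k1))
    (ht : ∀ k m n k1 j, k1 ≤ k + n → P.prefactor * t k m n k1 j =
      P.alphaSR * (P.zeta k * (P.K ^ m * Real.exp (-P.K) / (m.factorial * n.factorial)) *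
        ((k + n).choose k1 : ℝ) * ((-1) ^ j / (j.factorial : ℝ) * X k n k1 j))) :
    P.SeriesConverge t ∧
    P.prefactor * ∑ k ∈ Finset.range P.mSR, ∑' m : ℕ, ∑ n ∈ Finset.range (m + 1),
      ∑ k1 ∈ Finset.range (k + n + 1), ∑' j : ℕ, t k m n k1 j =
      P.alphaSR * ∑ k ∈ Finset.range P.mSR, P.zeta k * P.fadingIntegral γ y₀ k := by
  have hp := hP.prefactor_pos
  have hinner : ∀ k m n k1, k1 ≤ k + n → HasSum (fun j => t k m n k1 j)
      (P.alphaSR / P.prefactor * (P.zeta k *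
        (P.K ^ m * Real.exp (-P.K) / (m.factorial * n.factorial)) *
        ((k + n).choose k1 : ℝ) * P.binomIntegral γ y₀ k n k1)) := by
    intro k m n k1 h
    refine (((hX k n k1 h).mul_left _).mul_left (P.alphaSR / P.prefactor)).congr_fun
      fun j => ?_
    have := ht k m n k1 j h
    rw [div_mul_eq_mul_div, eq_div_iff hp.ne', mul_comm]
    exact this
  have hmid : ∀ k m, ∑ n ∈ Finset.range (m + 1), ∑ k1 ∈ Finset.range (k + n + 1),
      ∑' j : ℕ, t k m n k1 j = P.alphaSR / P.prefactor * P.zeta k *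
        (P.K ^ m * Real.exp (-P.K) / m.factorial *
      ∑ n ∈ Finset.range (m + 1), 1 / (n.factorial : ℝ) * ∑ k1 ∈ Finset.range (k + n + 1),
        ((k + n).choose k1 : ℝ) * P.binomIntegral γ y₀ k n k1) := by
    intro k m
    simp_rw [Finset.mul_sum]
    refine Finset.sum_congr rfl fun n _ => Finset.sum_congr rfl fun k1 hk1 => ?_
    rw [(hinner k m n k1 (by simpa [Nat.lt_succ_iff] using hk1)).tsum_eq]
    ring
  have houter : ∀ k, HasSum (fun m => ∑ n ∈ Finset.range (m + 1),
      ∑ k1 ∈ Finset.range (k + n + 1), ∑' j : ℕ, t k m n k1 j)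
      (P.alphaSR / P.prefactor * P.zeta k * P.fadingIntegral γ y₀ k) := by
    intro k
    simp_rw [hmid]
    exact (hP.hasSum_fadingIntegral hγ hC hy₀ k).mul_left _
  refine ⟨fun k _ => ⟨fun m n _ k1 h => (hinner k m n k1 h).summable, (houter k).summable⟩, ?_⟩
  simp_rw [(houter _).tsum_eq]
  rw [Finset.mul_sum, Finset.mul_sum]
  refine Finset.sum_congr rfl fun k _ => ?_
  field_simp

/-! ### Evaluation of the expanded integrals: positive lower limit -/

/-- The order `k₁ - n - k₂ + 1` of the incomplete Gamma function. -/
noncomputable def gammaOrder (n k1 k2 : ℕ) : ℝ := (k1 : ℝ) - n - k2 + 1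

lemma whittakerW_gammaOrder (n k1 k2 : ℕ) {z : ℝ} (hz : 0 < z) :
    whittakerW ((-(n : ℝ) + k1 - k2) / 2) (((n : ℝ) - k1 + k2 - 1) / 2) z =
      Real.exp (z / 2) * z ^ ((1 - gammaOrder n k1 k2) / 2) * upperGamma (gammaOrder n k1 k2) z := by
  rw [← whittakerW_eq_upperGamma _ hz]
  unfold gammaOrder
  congr 1 <;> ring

lemma continuousOn_I1Integrand (hP : P.Valid) (hC : 0 < P.C γ) (hPCD : 0 < P.PCD γ)
    (k n k1 k2 : ℕ) : ContinuousOn (P.I1Integrand γ k n k1 k2) (Ioi 0) := by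
  have hβ := hP.betaBar_pos
  have hz : ∀ w : ℝ, 0 < w → 0 < P.betaBar * w ^ 2 * P.PCD γ / P.C γ := fun w hw => by positivity
  have hcz : ContinuousOn (fun w : ℝ => P.betaBar * w ^ 2 * P.PCD γ / P.C γ) (Ioi 0) := by
    fun_prop
  have h : ContinuousOn (fun w : ℝ => w ^ (2 * (k : ℝ) + n - k1 + k2 + 1) *
      Real.exp (-(P.betaBar * w ^ 2 / P.C γ * (P.D γ + P.PCD γ / 2))) *
      (Real.exp (P.betaBar * w ^ 2 * P.PCD γ / P.C γ / 2) *
        (P.betaBar * w ^ 2 * P.PCD γ / P.C γ) ^ ((1 - gammaOrder n k1 k2) / 2) *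
        upperGamma (gammaOrder n k1 k2) (P.betaBar * w ^ 2 * P.PCD γ / P.C γ))) (Ioi 0) := by
    refine ContinuousOn.mul (ContinuousOn.mul ?_ (by fun_prop))
      (ContinuousOn.mul (ContinuousOn.mul (by fun_prop) ?_) ?_)
    · exact continuousOn_id.rpow_const fun w hw => Or.inl (ne_of_gt hw)
    · exact hcz.rpow_const fun w hw => Or.inl (hz w hw).ne'
    · exact (continuousOn_upperGamma _).comp hcz fun w hw => hz w hw
  refine h.congr fun w hw => ?_
  rw [I1Integrand, whittakerW_gammaOrder _ _ _ (hz w hw)]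

lemma Valid.intervalIntegrable_I1Integrand (hP : P.Valid) (hC : 0 < P.C γ) (hPCD : 0 < P.PCD γ)
    (k n k1 k2 : ℕ) :
    IntervalIntegrable (P.I1Integrand γ k n k1 k2) volume P.wMin P.wMax := by
  refine ((continuousOn_I1Integrand hP hC hPCD k n k1 k2).mono fun w hw => ?_).intervalIntegrable
  rw [uIcc_of_le hP.wMin_lt_wMax.le] at hw
  exact hP.wMin_pos.trans_le hw.1

/-- Under `t = (a/𝒞) u^ν` the element `u^q du` contributes `(q + 1)/ν` to the order: the weights
`u²` and `u` of `distBracket` give the shifts `3/ν` and `2/ν`. -/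
lemma Valid.intervalIntegral_pow_mul_exp (hP : P.Valid) (hγ : 0 < γ) (hC : 0 < P.C γ)
    (N q : ℕ) {x y : ℝ} (hx : 0 < x) (hy : 0 < y) :
    ∫ u in x..y, u ^ q * ((P.a γ * u ^ P.nu / P.C γ) ^ N *
      Real.exp (-(P.a γ * u ^ P.nu / P.C γ))) =
      1 / P.nu * (P.a γ / P.C γ) ^ (-((q : ℝ) + 1) / P.nu) *
        P.deltaGammaAt γ (N + (q + 1) / P.nu) x y := by
  have ha := hP.a_pos hγ
  have hν := hP.nu_pos
  set A := P.a γ / P.C γ with hA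
  have hA0 : 0 < A := by positivity
  have hmul : ∀ u : ℝ, P.a γ * u ^ P.nu / P.C γ = A * u ^ P.nu := fun u => by rw [hA]; ring
  have h := intervalIntegral_comp_rpow (φ := fun t => Real.exp (-t)) (by fun_prop) (ν := P.nu)
    hA0 hx hy ((N : ℝ) + (q + 1) / P.nu)
  rw [deltaGammaAt, hmul, hmul, deltaGamma_eq_intervalIntegral _ (by positivity) (by positivity), h,
    ← intervalIntegral.integral_const_mul, ← intervalIntegral.integral_const_mul]
  refine intervalIntegral.integral_congr fun u hu => ?_
  have hu0 : 0 < u := (lt_min hx hy).trans_le hu.1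
  simp only [hmul]
  have h1 : u ^ (P.nu * ((N : ℝ) + (q + 1) / P.nu) - 1) = u ^ q * (u ^ P.nu) ^ N := by
    rw [← Real.rpow_natCast, ← Real.rpow_natCast, ← Real.rpow_mul hu0.le, ← Real.rpow_add hu0]
    congr 1
    field_simp
    ring
  have h2 : A ^ (-((q : ℝ) + 1) / P.nu) * A ^ ((N : ℝ) + (q + 1) / P.nu) = A ^ N := by
    rw [← Real.rpow_natCast, ← Real.rpow_add hA0]
    congr 1
    ring
  rw [h1, mul_pow, ← h2]
  field_simp

lemma Valid.distBracket_pow_mul_exp (hP : P.Valid) (hγ : 0 < γ) (hC : 0 < P.C γ) (n k2 : ℕ) :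
    P.distBracket (fun u => (P.a γ * u ^ P.nu / P.C γ) ^ (n + k2) *
      Real.exp (-(P.a γ * u ^ P.nu / P.C γ))) =
      1 / P.nu * (P.a γ / P.C γ) ^ (-2 / P.nu) * P.gammaBracket γ n k2 := by
  have ha := hP.a_pos hγ
  have hν := hP.nu_pos
  have hc := hP.cos_pos
  have h1 := hP.h1_pos
  have h2 := hP.h2_pos
  have hA0 : 0 < P.a γ / P.C γ := by positivity
  have e2 := fun x y hx hy =>
    hP.intervalIntegral_pow_mul_exp hγ hC (n + k2) 2 (x := x) (y := y) hx hy
  have e1 := fun x y hx hy =>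
    hP.intervalIntegral_pow_mul_exp hγ hC (n + k2) 1 (x := x) (y := y) hx hy
  simp only [pow_one] at e1
  push_cast at e1 e2
  unfold distBracket
  rw [e2 _ _ h1 h2, e1 _ _ h1 (div_pos h1 hc), e1 _ _ h2 (div_pos h2 hc),
    e2 _ _ (div_pos h1 hc) (div_pos h2 hc), gammaBracket]
  have h3 : (P.a γ / P.C γ) ^ (-(2 + 1) / P.nu : ℝ) =
      (P.a γ / P.C γ) ^ (-2 / P.nu) * (P.a γ / P.C γ) ^ (-1 / P.nu) := by
    rw [← Real.rpow_add hA0]; congr 1; ring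
  rw [h3, show (-(1 + 1) / P.nu : ℝ) = -2 / P.nu by ring,
    show ((1 : ℝ) + 1) / P.nu = 2 / P.nu by ring, show ((2 : ℝ) + 1) / P.nu = 3 / P.nu by ring]
  ring

/-- The factor that depends on `w` and `y`, in the expansion for a positive lower limit. -/
noncomputable def heightFactor (P : Params) (γ : ℝ) (k n k1 k2 : ℕ) (w y : ℝ) : ℝ :=
  w ^ (2 * k + 2) / P.C γ ^ (k + 1) * Real.exp (-(P.betaBar * (w ^ 2 * (y + P.D γ) / P.C γ))) *
    P.D γ ^ (k + n - k1) * (y ^ k1 / y ^ n) * (P.D γ / y) ^ k2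

/-- In `y` the integrand is a multiple of `y^(s-1) e^(-by)` with `s = k₁ - n - k₂ + 1` and `b = β̄
w² / 𝒞`, whence `b^(-s) Γ(s, b 𝒫)`. The order `s` may be negative; this is harmless because the
lower limit is positive. -/
lemma Valid.integral_heightFactor (hP : P.Valid) (hC : 0 < P.C γ)
    (hPCD : 0 < P.PCD γ) (k n k1 k2 : ℕ) {w : ℝ} (hw : 0 < w) :
    ∫ y in Ioi (P.PCD γ), P.heightFactor γ k n k1 k2 w y =
      P.D γ ^ (k + n - k1) * P.D γ ^ k2 / P.C γ ^ (k + 1) *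
        (P.betaBar / P.C γ) ^ (-gammaOrder n k1 k2) *
        (P.betaBar * P.PCD γ / P.C γ) ^ ((gammaOrder n k1 k2 - 1) / 2) *
        (w⁻¹ * P.I1Integrand γ k n k1 k2 w) := by
  have hβ := hP.betaBar_pos
  set s := gammaOrder n k1 k2 with hs
  set b := P.betaBar * w ^ 2 / P.C γ with hb
  have hb0 : 0 < b := by positivity
  have h1 : ∀ y ∈ Ioi (P.PCD γ), P.heightFactor γ k n k1 k2 w y =
      w ^ (2 * k + 2) / P.C γ ^ (k + 1) * P.D γ ^ (k + n - k1) * P.D γ ^ k2 *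
        Real.exp (-(b * P.D γ)) * (y ^ (s - 1) * Real.exp (-(b * y))) := by
    intro y hy
    have hy0 : 0 < y := hPCD.trans hy
    have he : Real.exp (-(P.betaBar * (w ^ 2 * (y + P.D γ) / P.C γ))) =
        Real.exp (-(b * P.D γ)) * Real.exp (-(b * y)) := by
      rw [← Real.exp_add, hb]; congr 1; ring
    have hp : y ^ (s - 1) = y ^ k1 / y ^ n / y ^ k2 := by
      rw [hs, gammaOrder, add_sub_cancel_right, Real.rpow_sub hy0, Real.rpow_sub hy0,
        Real.rpow_natCast, Real.rpow_natCast, Real.rpow_natCast]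
    rw [heightFactor, he, hp, div_pow]
    field_simp
  rw [setIntegral_congr_fun measurableSet_Ioi h1, integral_const_mul,
    integral_Ioi_rpow_mul_exp_neg_mul s hb0 hPCD.le, I1Integrand,
    show P.betaBar * w ^ 2 * P.PCD γ / P.C γ = b * P.PCD γ by rw [hb]; ring,
    whittakerW_gammaOrder _ _ _ (by positivity), ← hs]
  have e1 : Real.exp (-(b * (P.D γ + P.PCD γ / 2))) * Real.exp (b * P.PCD γ / 2) =
      Real.exp (-(b * P.D γ)) := by
    rw [← Real.exp_add]; congr 1; ring
  -- Both `b` and `b 𝒫` are constants times `w²`, so the identity reduces to the exponents of `w`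
  -- and the cancellation of one constant factor.
  have e2 : w ^ (2 * k + 2) * b ^ (-s) = (P.betaBar / P.C γ) ^ (-s) *
      (P.betaBar * P.PCD γ / P.C γ) ^ ((s - 1) / 2) *
      (w⁻¹ * w ^ (2 * (k : ℝ) + n - k1 + k2 + 1)) * (b * P.PCD γ) ^ ((1 - s) / 2) := by
    have hw1 : w ^ (2 * k + 2) = w ^ (2 * (k : ℝ) + 2) := by
      rw [← Real.rpow_natCast]; push_cast; rfl
    have hw2 : w⁻¹ * w ^ (2 * (k : ℝ) + n - k1 + k2 + 1) = w ^ (2 * (k : ℝ) + 1 - s) := by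
      rw [← Real.rpow_neg_one, ← Real.rpow_add hw, hs, gammaOrder]
      congr 1; ring
    have hb1 : b = P.betaBar / P.C γ * w ^ (2 : ℝ) := by
      rw [hb, ← Real.rpow_natCast]; push_cast; ring
    have hb2 : b * P.PCD γ = P.betaBar * P.PCD γ / P.C γ * w ^ (2 : ℝ) := by rw [hb1]; ring
    rw [hw1, hw2, hb2, hb1, Real.mul_rpow (by positivity) (by positivity),
      Real.mul_rpow (x := P.betaBar * P.PCD γ / P.C γ) (by positivity) (by positivity),
      ← Real.rpow_mul hw.le, ← Real.rpow_mul hw.le]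
    have h2 : (P.betaBar * P.PCD γ / P.C γ) ^ ((s - 1) / 2) *
        (P.betaBar * P.PCD γ / P.C γ) ^ ((1 - s) / 2) = 1 := by
      rw [← Real.rpow_add (by positivity)]
      rw [show (s - 1) / 2 + (1 - s) / 2 = 0 by ring, Real.rpow_zero]
    have h3 : w ^ (2 * (k : ℝ) + 2) * w ^ (2 * -s) =
        w ^ (2 * (k : ℝ) + 1 - s) * w ^ (2 * ((1 - s) / 2)) := by
      rw [← Real.rpow_add hw, ← Real.rpow_add hw]; congr 1; ring
    linear_combination (P.betaBar / P.C γ) ^ (-s) * h3 -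
      (P.betaBar / P.C γ) ^ (-s) * w ^ (2 * (k : ℝ) + 1 - s) * w ^ (2 * ((1 - s) / 2)) * h2
  rw [← e1]
  linear_combination P.D γ ^ (k + n - k1) * P.D γ ^ k2 / P.C γ ^ (k + 1) *
    Real.exp (-(b * (P.D γ + P.PCD γ / 2))) * Real.exp (b * P.PCD γ / 2) *
    upperGamma s (b * P.PCD γ) * e2

lemma measurable_heightFactor (k n k1 k2 : ℕ) :
    Measurable (Function.uncurry (P.heightFactor γ k n k1 k2)) := by
  unfold heightFactor Function.uncurry; fun_prop

lemma Valid.integral_integral_heightFactor (hP : P.Valid) (hC : 0 < P.C γ)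
    (hPCD : 0 < P.PCD γ) (k n k1 k2 : ℕ) :
    ∫ w, (∫ y in Ioi (P.PCD γ), P.heightFactor γ k n k1 k2 w y) ∂P.satelliteDistLaw =
      1 / (P.wER * P.wMin) * (P.D γ ^ (k + n - k1) * P.D γ ^ k2 / P.C γ ^ (k + 1) *
        (P.betaBar / P.C γ) ^ (-gammaOrder n k1 k2) *
        (P.betaBar * P.PCD γ / P.C γ) ^ ((gammaOrder n k1 k2 - 1) / 2) * P.I1 γ k n k1 k2) := by
  rw [hP.integral_satelliteDistLaw, I1]
  · congr 1
    rw [← intervalIntegral.integral_const_mul]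
    refine intervalIntegral.integral_congr fun w hw => ?_
    rw [uIcc_of_le hP.wMin_lt_wMax.le] at hw
    have hw0 : 0 < w := hP.wMin_pos.trans_le hw.1
    rw [hP.integral_heightFactor hC hPCD k n k1 k2 hw0]
    field_simp
  · exact ((measurable_heightFactor k n k1 k2).stronglyMeasurable.integral_prod_right
      (f := P.heightFactor γ k n k1 k2)).measurable
  · refine ContinuousOn.congr (f := fun w =>
      P.D γ ^ (k + n - k1) * P.D γ ^ k2 / P.C γ ^ (k + 1) *
        (P.betaBar / P.C γ) ^ (-gammaOrder n k1 k2) *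
        (P.betaBar * P.PCD γ / P.C γ) ^ ((gammaOrder n k1 k2 - 1) / 2) *
        (w⁻¹ * P.I1Integrand γ k n k1 k2 w)) ?_
      fun w hw => hP.integral_heightFactor hC hPCD k n k1 k2 hw
    exact continuousOn_const.mul ((continuousOn_inv₀.mono fun w hw => ne_of_gt hw).mul
      (continuousOn_I1Integrand hP hC hPCD k n k1 k2))

/-- The expanded integral, for a positive lower limit. -/
noncomputable def invPartIntegral (P : Params) (γ : ℝ) (k n k1 k2 : ℕ) : ℝ :=
  ∫ q, P.binomKernel γ k n k1 q * Real.exp (-P.constPart γ q) * P.invPart γ q ^ k2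
    ∂P.baseMeasure (P.PCD γ)

lemma Valid.invPart_mem (hP : P.Valid) (hγ : 0 < γ) (hC : 0 < P.C γ) {y₀ : ℝ} (hy₀ : 0 < y₀)
    {q : (ℝ × ℝ) × ℝ} (hu : q.1.2 ∈ Icc P.h1 (P.h2 / Real.cos P.phi)) (hy : y₀ < q.2) :
    0 ≤ P.invPart γ q ∧
      P.invPart γ q ≤ P.a γ * (P.h2 / Real.cos P.phi) ^ P.nu * P.D γ / (P.C γ * y₀) := by
  have h1 := hP.a_pos hγ
  have h2 : 0 < q.1.2 := hP.h1_pos.trans_le hu.1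
  have h3 := hP.nu_pos
  have h4 := hP.D_pos hγ
  have h5 : 0 < q.2 := hy₀.trans hy
  have h6 := hP.h2_pos
  have h7 := hP.cos_pos
  unfold invPart
  refine ⟨by positivity, ?_⟩
  gcongr
  exact hu.2

/-- For `y > y₀ > 0` the inverse part is bounded, so removing its exponential costs a bounded factor
only. -/
lemma Valid.integrable_binomKernel_mul_exp_constPart (hP : P.Valid) (hγ : 0 < γ) (hC : 0 < P.C γ)
    {y₀ : ℝ} (hy₀ : 0 < y₀) (k n k1 : ℕ) :
    Integrable (fun q => P.binomKernel γ k n k1 q * Real.exp (-P.constPart γ q))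
      (P.baseMeasure y₀) := by
  have h := (hP.integrable_binomKernel_mul_exp_threshold hγ hC hy₀.le k n k1).mul_bdd
    (c := Real.exp (P.a γ * (P.h2 / Real.cos P.phi) ^ P.nu * P.D γ / (P.C γ * y₀)))
    (g := fun q => Real.exp (P.invPart γ q)) (measurable_invPart γ).exp.aestronglyMeasurable ?_
  · refine h.congr ?_
    filter_upwards [hP.ae_baseMeasure y₀] with q hq
    rw [threshold_eq (hy₀.trans hq.2.2).ne', mul_assoc, ← Real.exp_add]
    congr 2
    ring
  · filter_upwards [hP.ae_baseMeasure y₀] with q hq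
    rw [Real.norm_of_nonneg (Real.exp_pos _).le]
    exact Real.exp_le_exp.2 (hP.invPart_mem hγ hC hy₀ hq.2.1 hq.2.2).2

lemma Valid.hasSum_invPartIntegral (hP : P.Valid) (hγ : 0 < γ) (hC : 0 < P.C γ)
    (hPCD : 0 < P.PCD γ) (k n k1 : ℕ) :
    HasSum (fun j : ℕ => (-1) ^ j / (j.factorial : ℝ) * P.invPartIntegral γ k n k1 j)
      (P.binomIntegral γ (P.PCD γ) k n k1) := by
  have h := hasSum_integral_mul_exp_neg
    (hP.integrable_binomKernel_mul_exp_constPart hγ hC hPCD k n k1)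
    (measurable_invPart (P := P) γ).aestronglyMeasurable
    (B := P.a γ * (P.h2 / Real.cos P.phi) ^ P.nu * P.D γ / (P.C γ * P.PCD γ)) ?_
  · have h1 : ∫ q, P.binomKernel γ k n k1 q * Real.exp (-P.constPart γ q) *
        Real.exp (-P.invPart γ q) ∂P.baseMeasure (P.PCD γ) =
        P.binomIntegral γ (P.PCD γ) k n k1 := by
      refine integral_congr_ae ?_
      filter_upwards [hP.binomKernel_mul_exp_threshold (γ := γ) hPCD.le k n k1] with q hq
      rw [hq, mul_right_comm]
    rw [h1] at h
    exact h
  · filter_upwards [hP.ae_baseMeasure (P.PCD γ)] with q hq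
    exact hP.invPart_mem hγ hC hPCD hq.2.1 hq.2.2

/-- Once `e^(-c𝒟/y)` is replaced by a power, the integrand is a function of `(w, y)` times a
function of `u`, and the integral factors. -/
lemma Valid.invPartIntegral_eq (hP : P.Valid) (hγ : 0 < γ) (hC : 0 < P.C γ)
    (hPCD : 0 < P.PCD γ) (k n k1 k2 : ℕ) :
    P.invPartIntegral γ k n k1 k2 =
      1 / (P.wER * P.wMin) * (P.D γ ^ (k + n - k1) * P.D γ ^ k2 / P.C γ ^ (k + 1) *
        (P.betaBar / P.C γ) ^ (-gammaOrder n k1 k2) *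
        (P.betaBar * P.PCD γ / P.C γ) ^ ((gammaOrder n k1 k2 - 1) / 2) * P.I1 γ k n k1 k2) *
      (6 / (Real.tan P.phi ^ 2 * (P.h2 ^ 3 - P.h1 ^ 3)) *
        (1 / P.nu * (P.a γ / P.C γ) ^ (-2 / P.nu) * P.gammaBracket γ n k2)) := by
  have := hP.isProbabilityMeasure_satelliteDistLaw
  have := hP.isProbabilityMeasure_receiverDistLaw
  have ha := hP.a_pos hγ
  have hint : Integrable (fun q => P.binomKernel γ k n k1 q * Real.exp (-P.constPart γ q) *
      P.invPart γ q ^ k2) (P.baseMeasure (P.PCD γ)) := by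
    refine (hP.integrable_binomKernel_mul_exp_constPart hγ hC hPCD k n k1).mul_bdd
      (c := (P.a γ * (P.h2 / Real.cos P.phi) ^ P.nu * P.D γ / (P.C γ * P.PCD γ)) ^ k2)
      ((measurable_invPart γ).pow_const k2).aestronglyMeasurable ?_
    filter_upwards [hP.ae_baseMeasure (P.PCD γ)] with q hq
    obtain ⟨h1, h2⟩ := hP.invPart_mem hγ hC hPCD hq.2.1 hq.2.2
    rw [norm_pow, Real.norm_of_nonneg h1]
    exact pow_le_pow_left₀ h1 h2 _
  unfold invPartIntegral
  unfold baseMeasure at hint ⊢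
  rw [integral_prod _ hint]
  have hsplit : ∀ r : ℝ × ℝ, ∫ y in Ioi (P.PCD γ), P.binomKernel γ k n k1 (r, y) *
      Real.exp (-P.constPart γ (r, y)) * P.invPart γ (r, y) ^ k2 =
      (∫ y in Ioi (P.PCD γ), P.heightFactor γ k n k1 k2 r.1 y) *
        ((P.a γ * r.2 ^ P.nu / P.C γ) ^ (n + k2) * Real.exp (-(P.a γ * r.2 ^ P.nu / P.C γ))) := by
    intro r
    rw [← integral_mul_const]
    refine setIntegral_congr_fun measurableSet_Ioi fun y hy => ?_
    have hy0 : 0 < y := hPCD.trans hy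
    have h1 : P.invPart γ (r, y) = P.a γ * r.2 ^ P.nu / P.C γ * (P.D γ / y) := by
      unfold invPart; field_simp
    simp only [h1, binomKernel, constPart, heightFactor, mul_pow, pow_add]
    ring
  simp_rw [hsplit]
  rw [integral_prod_mul (fun w => ∫ y in Ioi (P.PCD γ), P.heightFactor γ k n k1 k2 w y)
    (fun u => (P.a γ * u ^ P.nu / P.C γ) ^ (n + k2) * Real.exp (-(P.a γ * u ^ P.nu / P.C γ))),
    hP.integral_integral_heightFactor hC hPCD, hP.integral_receiverDistLaw (by fun_prop) ?_ ?_,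
    hP.distBracket_pow_mul_exp hγ hC]
  · have : ContinuousOn (fun u : ℝ => u ^ P.nu) (Ioi 0) :=
      continuousOn_id.rpow_const fun u hu => Or.inl (ne_of_gt hu)
    fun_prop
  · intro u hu
    positivity

lemma Valid.prefactor_mul_psi2Term (hP : P.Valid) (hγ : 0 < γ) (hC : 0 < P.C γ)
    (hPCD : 0 < P.PCD γ) {k m n k1 : ℕ} (k2 : ℕ) (hk1 : k1 ≤ k + n) :
    P.prefactor * P.psi2Term γ k m n k1 k2 =
      P.alphaSR * (P.zeta k * (P.K ^ m * Real.exp (-P.K) / (m.factorial * n.factorial)) *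
        ((k + n).choose k1 : ℝ) *
        ((-1) ^ k2 / (k2.factorial : ℝ) * P.invPartIntegral γ k n k1 k2)) := by
  have ha := hP.a_pos hγ
  have hD := hP.D_pos hγ
  have hβ := hP.betaBar_pos
  have hν := hP.nu_pos
  have h2 := hP.wER_pos
  have h3 := hP.wMin_pos
  have h5 := hP.tan_pos
  have h6 := hP.cube_sub_pos
  -- Both sides are monomials with real exponents in positive quantities; logarithms make this a
  -- linear identity between exponents.
  have key : P.D γ ^ (k + n - k1) * P.D γ ^ k2 / P.C γ ^ (k + 1) *
      (P.betaBar / P.C γ) ^ (-gammaOrder n k1 k2) *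
      (P.betaBar * P.PCD γ / P.C γ) ^ ((gammaOrder n k1 k2 - 1) / 2) *
      (P.a γ / P.C γ) ^ (-2 / P.nu) =
      P.a γ ^ (-2 / P.nu) * P.betaBar ^ (((n : ℝ) - k1 + k2) / 2 - 1) *
      P.PCD γ ^ ((-(n : ℝ) + k1 - k2) / 2) *
      (P.D γ ^ ((k : ℝ) + n - k1 + k2) /
      P.C γ ^ ((k : ℝ) + ((n : ℝ) - k1 + k2) / 2 - 2 / P.nu)) := by
    -- The truncated subtraction is a true one because `k₁ ≤ k + n`.
    have hn : ((k + n - k1 : ℕ) : ℝ) = (k : ℝ) + n - k1 := by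
      rw [Nat.cast_sub hk1]; push_cast; rfl
    simp only [← Real.rpow_natCast, hn]
    rw [Real.rpow_def_of_pos hD, Real.rpow_def_of_pos hD, Real.rpow_def_of_pos hC,
      Real.rpow_def_of_pos (by positivity : 0 < P.betaBar / P.C γ),
      Real.rpow_def_of_pos (by positivity : 0 < P.betaBar * P.PCD γ / P.C γ),
      Real.rpow_def_of_pos (by positivity : 0 < P.a γ / P.C γ), Real.rpow_def_of_pos ha,
      Real.rpow_def_of_pos hβ, Real.rpow_def_of_pos hPCD, Real.rpow_def_of_pos hD,
      Real.rpow_def_of_pos hC, Real.log_div hβ.ne' hC.ne', Real.log_div (by positivity) hC.ne',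
      Real.log_mul hβ.ne' hPCD.ne', Real.log_div ha.ne' hC.ne']
    simp only [← Real.exp_add, ← Real.exp_sub, gammaOrder]
    congr 1
    push_cast
    field_simp
    ring
  rw [hP.invPartIntegral_eq hγ hC hPCD, psi2Term, prefactor, add_comm n k]
  generalize P.h2 ^ 3 - P.h1 ^ 3 = H
  linear_combination (exp := 1) -(P.alphaSR * P.zeta k *
    (P.K ^ m * Real.exp (-P.K) / (m.factorial * n.factorial)) * ((k + n).choose k1 : ℝ) *
    ((-1) ^ k2 / (k2.factorial : ℝ)) * (1 / (P.wER * P.wMin)) *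
    (6 / (Real.tan P.phi ^ 2 * H)) * (1 / P.nu) * P.gammaBracket γ n k2 *
    P.I1 γ k n k1 k2) * key

/-! ### Evaluation of the expanded integrals: lower limit zero -/

/-- Indeed `ς₂ + ς₃ = k₁ + k₂ + 1` and `ς₂ - ς₃ = n + k₂`. Equality occurs for `n = k₂ = 0`, so it
is the shift `q/ν > 0` that makes the poles separable. -/
lemma abs_s3_le (n k1 k2 : ℕ) : |s3 n k1| ≤ s2 n k1 k2 := by
  have h1 : (0 : ℝ) ≤ n := Nat.cast_nonneg n
  have h2 : (0 : ℝ) ≤ k1 := Nat.cast_nonneg k1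
  have h3 : (0 : ℝ) ≤ k2 := Nat.cast_nonneg k2
  unfold s2 s3
  rw [abs_le]
  constructor <;> linarith

/-- The coefficient of `u^ν` in the argument of the kernel. -/
noncomputable def kernelScale (P : Params) (γ w : ℝ) : ℝ :=
  P.a γ * P.D γ * P.betaBar * w ^ 2 / P.C γ ^ 2

lemma Valid.kernelScale_pos (hP : P.Valid) (hγ : 0 < γ) (hC : 0 < P.C γ) {w : ℝ} (hw : 0 < w) :
    0 < P.kernelScale γ w := by
  have ha := hP.a_pos hγ
  have hD := hP.D_pos hγ
  have hβ := hP.betaBar_pos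
  unfold kernelScale
  positivity

lemma Valid.abs_s3_lt (hP : P.Valid) (n k1 k2 : ℕ) {q : ℝ} (hq : 0 < q) :
    |s3 n k1| < s2 n k1 k2 + q / P.nu :=
  (abs_s3_le n k1 k2).trans_lt (lt_add_of_pos_right _ (div_pos hq hP.nu_pos))

lemma Valid.meijerTerm_eq_incompleteKernel (hP : P.Valid) (hγ : 0 < γ) (hC : 0 < P.C γ)
    (n k1 k2 : ℕ) {q h w : ℝ} (hq : 0 < q) (hh : 0 < h) (hw : 0 < w) :
    P.meijerTerm γ n k1 k2 q h w = h ^ (s2 n k1 k2 * P.nu + q) *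
      incompleteKernel (s2 n k1 k2 + q / P.nu) (s3 n k1) (P.kernelScale γ w * h ^ P.nu) := by
  have hA := hP.kernelScale_pos hγ hC hw
  rw [meijerTerm, show 1 - s2 n k1 k2 - q / P.nu = 1 - (s2 n k1 k2 + q / P.nu) by ring,
    show -s2 n k1 k2 - q / P.nu = -(s2 n k1 k2 + q / P.nu) by ring,
    show P.a γ * h ^ P.nu * P.D γ * P.betaBar * w ^ 2 / P.C γ ^ 2 =
      P.kernelScale γ w * h ^ P.nu by unfold kernelScale; ring,
    meijerG2113_eq (hP.abs_s3_lt n k1 k2 hq) (by positivity)]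

/-- The power of `h` in front cancels the one in `incompleteKernel`, so `h` survives only in the
upper limit and a difference of two terms is one integral. -/
lemma Valid.meijerTerm_eq_integral (hP : P.Valid) (hγ : 0 < γ) (hC : 0 < P.C γ)
    (n k1 k2 : ℕ) {q h w : ℝ} (hq : 0 < q) (hh : 0 < h) (hw : 0 < w) :
    P.meijerTerm γ n k1 k2 q h w = P.kernelScale γ w ^ (-(s2 n k1 k2 + q / P.nu)) *
      ∫ t in (0 : ℝ)..(P.kernelScale γ w * h ^ P.nu),
        t ^ (s2 n k1 k2 + q / P.nu - 1) * besselKernel (s3 n k1) t := by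
  have hA := hP.kernelScale_pos hγ hC hw
  have hν := hP.nu_pos
  rw [hP.meijerTerm_eq_incompleteKernel hγ hC n k1 k2 hq hh hw, incompleteKernel,
    Real.mul_rpow hA.le (by positivity), ← Real.rpow_mul hh.le]
  have : h ^ (s2 n k1 k2 * P.nu + q) * h ^ (P.nu * -(s2 n k1 k2 + q / P.nu)) = 1 := by
    rw [← Real.rpow_add hh, ← Real.rpow_zero h]
    congr 1
    field_simp
    ring
  linear_combination (P.kernelScale γ w ^ (-(s2 n k1 k2 + q / P.nu)) *
      ∫ t in (0 : ℝ)..(P.kernelScale γ w * h ^ P.nu),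
        t ^ (s2 n k1 k2 + q / P.nu - 1) * besselKernel (s3 n k1) t) * this

lemma Valid.continuousOn_meijerTerm (hP : P.Valid) (hγ : 0 < γ) (hC : 0 < P.C γ)
    (n k1 k2 : ℕ) {q h : ℝ} (hq : 0 < q) (hh : 0 < h) :
    ContinuousOn (P.meijerTerm γ n k1 k2 q h) (Ioi 0) := by
  refine ContinuousOn.congr (f := fun w => h ^ (s2 n k1 k2 * P.nu + q) *
      incompleteKernel (s2 n k1 k2 + q / P.nu) (s3 n k1) (P.kernelScale γ w * h ^ P.nu)) ?_
    fun w hw => hP.meijerTerm_eq_incompleteKernel hγ hC n k1 k2 hq hh hw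
  refine continuousOn_const.mul ?_
  refine (continuousOn_incompleteKernel (hP.abs_s3_lt n k1 k2 hq)).comp ?_ fun w hw => ?_
  · unfold kernelScale; fun_prop
  · exact mul_pos (hP.kernelScale_pos hγ hC hw) (by positivity)

lemma Valid.continuousOn_meijerIntegrandBetween (hP : P.Valid) (hγ : 0 < γ) (hC : 0 < P.C γ)
    (k n k1 k2 : ℕ) {q x y : ℝ} (hq : 0 < q) (hx : 0 < x) (hy : 0 < y) :
    ContinuousOn (P.meijerIntegrandBetween γ k n k1 k2 q x y) (Ioi 0) := by
  unfold meijerIntegrandBetween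
  refine ((ContinuousOn.sub (hP.continuousOn_meijerTerm hγ hC n k1 k2 hq hy)
    (hP.continuousOn_meijerTerm hγ hC n k1 k2 hq hx)).mul ?_).mul (by fun_prop)
  exact continuousOn_id.rpow_const fun w hw => Or.inl (ne_of_gt hw)

lemma Valid.intervalIntegrable_meijerIntegrandBetween (hP : P.Valid) (hγ : 0 < γ)
    (hC : 0 < P.C γ) (k n k1 k2 : ℕ) {q x y : ℝ} (hq : 0 < q) (hx : 0 < x) (hy : 0 < y) :
    IntervalIntegrable (P.meijerIntegrandBetween γ k n k1 k2 q x y) volume P.wMin P.wMax := by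
  refine ((hP.continuousOn_meijerIntegrandBetween hγ hC k n k1 k2 hq hx hy).mono
    fun w hw => ?_).intervalIntegrable
  rw [uIcc_of_le hP.wMin_lt_wMax.le] at hw
  exact hP.wMin_pos.trans_le hw.1

/-- The weight `u^q` corresponds to the Meijer term of shift `q + 1`, because the substitution `t =
A u^ν` brings the exponent `ν r - 1`. -/
lemma Valid.intervalIntegral_rpow_mul_besselKernel (hP : P.Valid) (hγ : 0 < γ) (hC : 0 < P.C γ)
    (n k1 k2 : ℕ) (q : ℕ) {x y w : ℝ} (hx : 0 < x) (hy : 0 < y) (hw : 0 < w) :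
    ∫ u in x..y, u ^ q * (u ^ (P.nu * s2 n k1 k2) *
      besselKernel (s3 n k1) (P.kernelScale γ w * u ^ P.nu)) =
      1 / P.nu * (P.meijerTerm γ n k1 k2 (q + 1) y w - P.meijerTerm γ n k1 k2 (q + 1) x w) := by
  have hν := hP.nu_pos
  have hA := hP.kernelScale_pos hγ hC hw
  have hq : (0 : ℝ) < q + 1 := by positivity
  have hr := hP.abs_s3_lt n k1 k2 hq
  rw [hP.meijerTerm_eq_integral hγ hC n k1 k2 hq hy hw,
    hP.meijerTerm_eq_integral hγ hC n k1 k2 hq hx hw, ← mul_sub,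
    intervalIntegral.integral_interval_sub_left
      (intervalIntegrable_rpow_mul_besselKernel hr le_rfl (by positivity))
      (intervalIntegrable_rpow_mul_besselKernel hr le_rfl (by positivity)),
    intervalIntegral_comp_rpow (continuousOn_besselKernel _) hA hx hy,
    ← intervalIntegral.integral_const_mul, ← intervalIntegral.integral_const_mul,
    ← intervalIntegral.integral_const_mul]
  refine intervalIntegral.integral_congr fun u hu => ?_
  have hu0 : 0 < u := (lt_min hx hy).trans_le hu.1
  have h1 : u ^ (P.nu * (s2 n k1 k2 + (q + 1) / P.nu) - 1) = u ^ q * u ^ (P.nu * s2 n k1 k2) := by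
    rw [← Real.rpow_natCast, ← Real.rpow_add hu0]
    congr 1
    field_simp
    ring
  have h2 : P.kernelScale γ w ^ (-(s2 n k1 k2 + ((q : ℝ) + 1) / P.nu)) *
      P.kernelScale γ w ^ (s2 n k1 k2 + ((q : ℝ) + 1) / P.nu) = 1 := by
    rw [← Real.rpow_add hA, neg_add_cancel, Real.rpow_zero]
  rw [h1]
  generalize P.kernelScale γ w ^ (-(s2 n k1 k2 + ((q : ℝ) + 1) / P.nu)) = e1 at *
  generalize P.kernelScale γ w ^ (s2 n k1 k2 + ((q : ℝ) + 1) / P.nu) = e2 at *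
  field_simp
  linear_combination -besselKernel (s3 n k1) (P.kernelScale γ w * u ^ P.nu) * h2

/-- The bracket of four differences of Meijer terms. -/
noncomputable def meijerBracket (P : Params) (γ : ℝ) (n k1 k2 : ℕ) (w : ℝ) : ℝ :=
  (P.meijerTerm γ n k1 k2 3 P.h2 w - P.meijerTerm γ n k1 k2 3 P.h1 w) -
  P.h1 * (P.meijerTerm γ n k1 k2 2 (P.h1 / Real.cos P.phi) w - P.meijerTerm γ n k1 k2 2 P.h1 w) +
  P.h2 * (P.meijerTerm γ n k1 k2 2 (P.h2 / Real.cos P.phi) w - P.meijerTerm γ n k1 k2 2 P.h2 w) -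
  Real.cos P.phi * (P.meijerTerm γ n k1 k2 3 (P.h2 / Real.cos P.phi) w -
    P.meijerTerm γ n k1 k2 3 (P.h1 / Real.cos P.phi) w)

lemma Valid.distBracket_rpow_mul_besselKernel (hP : P.Valid) (hγ : 0 < γ) (hC : 0 < P.C γ)
    (n k1 k2 : ℕ) {w : ℝ} (hw : 0 < w) :
    P.distBracket (fun u => u ^ (P.nu * s2 n k1 k2) *
      besselKernel (s3 n k1) (P.kernelScale γ w * u ^ P.nu)) =
      1 / P.nu * P.meijerBracket γ n k1 k2 w := by
  have hc := hP.cos_pos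
  have h1 := hP.h1_pos
  have h2 := hP.h2_pos
  have e2 := fun x y hx hy =>
    hP.intervalIntegral_rpow_mul_besselKernel hγ hC n k1 k2 2 (x := x) (y := y) hx hy hw
  have e1 := fun x y hx hy =>
    hP.intervalIntegral_rpow_mul_besselKernel hγ hC n k1 k2 1 (x := x) (y := y) hx hy hw
  simp only [pow_one] at e1
  norm_num at e1 e2
  unfold distBracket
  rw [e2 _ _ h1 h2, e1 _ _ h1 (div_pos h1 hc), e1 _ _ h2 (div_pos h2 hc),
    e2 _ _ (div_pos h1 hc) (div_pos h2 hc), meijerBracket]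
  ring

lemma continuousOn_rpow_mul_besselKernel (r ς ν : ℝ) {A : ℝ} (hA : 0 < A) :
    ContinuousOn (fun u : ℝ => u ^ r * besselKernel ς (A * u ^ ν)) (Ioi 0) := by
  have h : ∀ e : ℝ, ContinuousOn (fun u : ℝ => u ^ e) (Ioi 0) := fun e =>
    continuousOn_id.rpow_const fun u hu => Or.inl (ne_of_gt hu)
  refine (h r).mul ((continuousOn_besselKernel ς).comp (continuousOn_const.mul (h ν)) ?_)
  intro u hu
  have hu : 0 < u := hu
  exact mul_pos hA (by positivity)

/-- Rescaling `p = b y` with `b = β̄ w² / 𝒞` gives the Bessel kernel: `2 ς₃ - 1 = k₁ - n`, and the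
inverse part is `A u^ν / p` with `A = kernelScale γ w`. Compensating the factor `(A u^ν)^(-ς₃)` of
the kernel raises the exponent of `u^ν` from `n + k₂` to `ς₂`. -/
lemma Valid.integral_binomKernel_mul_exp_invPart (hP : P.Valid) (hγ : 0 < γ) (hC : 0 < P.C γ)
    (k n k1 k2 : ℕ) {w u : ℝ} (hw : 0 < w) (hu : 0 < u) :
    ∫ y in Ioi (0 : ℝ), P.binomKernel γ k n k1 ((w, u), y) *
      Real.exp (-P.invPart γ ((w, u), y)) * P.constPart γ ((w, u), y) ^ k2 =
      w ^ (2 * k + 2) * Real.exp (-(P.D γ * P.betaBar * w ^ 2 / P.C γ)) *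
        (P.D γ ^ (k + n - k1) / P.C γ ^ (k + 1) * (P.a γ / P.C γ) ^ (n + k2)) *
        ((P.betaBar * w ^ 2 / P.C γ) ^ (-(2 * s3 n k1)) * P.kernelScale γ w ^ s3 n k1) *
        (u ^ (P.nu * s2 n k1 k2) *
          besselKernel (s3 n k1) (P.kernelScale γ w * u ^ P.nu)) := by
  have ha := hP.a_pos hγ
  have hD := hP.D_pos hγ
  have hβ := hP.betaBar_pos
  have hA := hP.kernelScale_pos hγ hC hw
  set ς := s3 n k1 with hς
  set b := P.betaBar * w ^ 2 / P.C γ with hb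
  have hb0 : 0 < b := by positivity
  have hx0 : 0 < P.kernelScale γ w * u ^ P.nu := by positivity
  have h1 : ∀ y ∈ Ioi (0 : ℝ), P.binomKernel γ k n k1 ((w, u), y) *
      Real.exp (-P.invPart γ ((w, u), y)) * P.constPart γ ((w, u), y) ^ k2 =
      w ^ (2 * k + 2) / P.C γ ^ (k + 1) * Real.exp (-(P.D γ * P.betaBar * w ^ 2 / P.C γ)) *
        P.D γ ^ (k + n - k1) * (P.a γ * u ^ P.nu / P.C γ) ^ (n + k2) * b ^ (-(2 * ς - 1)) *
        ((b * y) ^ (2 * ς - 1) * Real.exp (-(P.kernelScale γ w * u ^ P.nu / (b * y))) *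
          Real.exp (-(b * y))) := by
    intro y hy
    have hy : 0 < y := hy
    have he : Real.exp (-(P.betaBar * (w ^ 2 * (y + P.D γ) / P.C γ))) =
        Real.exp (-(P.D γ * P.betaBar * w ^ 2 / P.C γ)) * Real.exp (-(b * y)) := by
      rw [← Real.exp_add, hb]; congr 1; ring
    have hp : b ^ (-(2 * ς - 1)) * (b * y) ^ (2 * ς - 1) = y ^ k1 / y ^ n := by
      rw [Real.mul_rpow hb0.le hy.le, ← mul_assoc, ← Real.rpow_add hb0, neg_add_cancel,
        Real.rpow_zero, one_mul, hς, s3, ← Real.rpow_natCast y k1, ← Real.rpow_natCast y n,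
        ← Real.rpow_sub hy]
      congr 1
      ring
    have hT : P.invPart γ ((w, u), y) = P.kernelScale γ w * u ^ P.nu / (b * y) := by
      unfold invPart kernelScale
      rw [hb]
      field_simp
    have hS : P.constPart γ ((w, u), y) = P.a γ * u ^ P.nu / P.C γ := rfl
    rw [hT, hS, binomKernel, he, hS, ← hp, pow_add _ n k2]
    ring
  have h2 := integral_comp_mul_left_Ioi (fun p : ℝ => p ^ (2 * ς - 1) *
    Real.exp (-(P.kernelScale γ w * u ^ P.nu / p)) * Real.exp (-p)) 0 hb0
  rw [mul_zero, smul_eq_mul] at h2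
  rw [setIntegral_congr_fun measurableSet_Ioi h1, integral_const_mul, h2, besselKernel]
  set Λ := ∫ p in Ioi (0 : ℝ), p ^ (2 * ς - 1) *
    Real.exp (-(P.kernelScale γ w * u ^ P.nu / p)) * Real.exp (-p) with hΛ
  have h3 : P.kernelScale γ w ^ ς * (u ^ (P.nu * s2 n k1 k2) *
      (P.kernelScale γ w * u ^ P.nu) ^ (-ς)) = (u ^ P.nu) ^ (n + k2) := by
    rw [Real.mul_rpow hA.le (by positivity), ← Real.rpow_natCast, ← Real.rpow_mul hu.le,
      ← Real.rpow_mul hu.le]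
    have h4 : P.kernelScale γ w ^ ς * P.kernelScale γ w ^ (-ς) = 1 := by
      rw [← Real.rpow_add hA, add_neg_cancel, Real.rpow_zero]
    have h5 : u ^ (P.nu * s2 n k1 k2) * u ^ (P.nu * -ς) = u ^ (P.nu * ((n + k2 : ℕ) : ℝ)) := by
      rw [← Real.rpow_add hu, hς, s2, s3]
      congr 1
      push_cast
      ring
    linear_combination u ^ (P.nu * s2 n k1 k2) * u ^ (P.nu * -ς) * h4 + h5
  have h6 : b ^ (-(2 * ς - 1)) * b⁻¹ = b ^ (-(2 * ς)) := by
    rw [← Real.rpow_neg_one, ← Real.rpow_add hb0]; congr 1; ring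
  rw [← h6, mul_div_right_comm (P.a γ), mul_pow, ← h3]
  ring

lemma Valid.measurable_integral_constPart (k n k1 k2 : ℕ) :
    Measurable (Function.uncurry fun r : ℝ × ℝ => fun y : ℝ => P.binomKernel γ k n k1 (r, y) *
      Real.exp (-P.invPart γ (r, y)) * P.constPart γ (r, y) ^ k2) :=
  ((measurable_binomKernel γ k n k1).mul (measurable_invPart γ).neg.exp).mul
    ((measurable_constPart γ).pow_const k2)

/-- The integral over the fading variable and the distance to the receiver. -/
noncomputable def innerIntegral (P : Params) (γ : ℝ) (k n k1 k2 : ℕ) (w : ℝ) : ℝ :=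
  ∫ u, (∫ y in Ioi (0 : ℝ), P.binomKernel γ k n k1 ((w, u), y) *
      Real.exp (-P.invPart γ ((w, u), y)) * P.constPart γ ((w, u), y) ^ k2) ∂P.receiverDistLaw

lemma Valid.innerIntegral_eq (hP : P.Valid) (hγ : 0 < γ) (hC : 0 < P.C γ)
    (k n k1 k2 : ℕ) {w : ℝ} (hw : 0 < w) :
    P.innerIntegral γ k n k1 k2 w =
      w ^ (2 * k + 2) * Real.exp (-(P.D γ * P.betaBar * w ^ 2 / P.C γ)) *
        (P.D γ ^ (k + n - k1) / P.C γ ^ (k + 1) * (P.a γ / P.C γ) ^ (n + k2)) *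
        ((P.betaBar * w ^ 2 / P.C γ) ^ (-(2 * s3 n k1)) * P.kernelScale γ w ^ s3 n k1) *
        (6 / (Real.tan P.phi ^ 2 * (P.h2 ^ 3 - P.h1 ^ 3)) *
          (1 / P.nu * P.meijerBracket γ n k1 k2 w)) := by
  have hA := hP.kernelScale_pos hγ hC hw
  have hpos : ∀ᵐ u ∂P.receiverDistLaw, 0 < u := by
    filter_upwards [hP.ae_receiverDistLaw] with u hu
    exact hP.h1_pos.trans_le hu.1
  rw [innerIntegral, ← hP.distBracket_rpow_mul_besselKernel hγ hC n k1 k2 hw,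
    ← hP.integral_receiverDistLaw _ (continuousOn_rpow_mul_besselKernel _ _ _ hA),
    ← integral_const_mul]
  · refine integral_congr_ae ?_
    filter_upwards [hpos] with u hu
    exact hP.integral_binomKernel_mul_exp_invPart hγ hC k n k1 k2 hw hu
  · intro u hu
    exact mul_nonneg (by positivity) (besselKernel_nonneg _ (by positivity))
  · exact Measurable.mul (by fun_prop)
      ((measurable_besselKernel _).comp (by fun_prop))

/-- The expanded integral, for the lower limit zero. -/
noncomputable def constPartIntegral (P : Params) (γ : ℝ) (k n k1 k2 : ℕ) : ℝ :=
  ∫ q, P.binomKernel γ k n k1 q * Real.exp (-P.invPart γ q) * P.constPart γ q ^ k2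
    ∂P.baseMeasure 0

lemma Valid.hasSum_constPartIntegral (hP : P.Valid) (hγ : 0 < γ) (hC : 0 < P.C γ)
    (k n k1 : ℕ) :
    HasSum (fun j : ℕ => (-1) ^ j / (j.factorial : ℝ) * P.constPartIntegral γ k n k1 j)
      (P.binomIntegral γ 0 k n k1) := by
  have h := hasSum_integral_mul_exp_neg
    (hP.integrable_binomKernel_mul_exp hγ hC le_rfl k n k1)
    (measurable_constPart (P := P) γ).aestronglyMeasurable
    (B := P.a γ * (P.h2 / Real.cos P.phi) ^ P.nu / P.C γ) ?_
  · have h1 : ∫ q, P.binomKernel γ k n k1 q * Real.exp (-P.invPart γ q) *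
        Real.exp (-P.constPart γ q) ∂P.baseMeasure 0 = P.binomIntegral γ 0 k n k1 :=
      integral_congr_ae ((hP.binomKernel_mul_exp_threshold (γ := γ) le_rfl k n k1).mono
        fun q hq => hq.symm)
    rw [h1] at h
    exact h
  · filter_upwards [hP.ae_baseMeasure 0] with q hq
    exact hP.constPart_mem hγ hC hq.2.1

/-- Here `w` and `u` both occur in the argument of the Bessel kernel and do not separate: `y` and
then `u` are integrated for fixed `w`, and the integral over `w` remains. -/
lemma Valid.constPartIntegral_eq_integral (hP : P.Valid) (hγ : 0 < γ) (hC : 0 < P.C γ)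
    (k n k1 k2 : ℕ) :
    P.constPartIntegral γ k n k1 k2 =
      1 / (P.wER * P.wMin) * ∫ w in P.wMin..P.wMax, w * P.innerIntegral γ k n k1 k2 w := by
  have := hP.isProbabilityMeasure_satelliteDistLaw
  have := hP.isProbabilityMeasure_receiverDistLaw
  have hint : Integrable (fun q => P.binomKernel γ k n k1 q * Real.exp (-P.invPart γ q) *
      P.constPart γ q ^ k2) (P.baseMeasure 0) := by
    refine (hP.integrable_binomKernel_mul_exp hγ hC le_rfl k n k1).mul_bdd
      (c := (P.a γ * (P.h2 / Real.cos P.phi) ^ P.nu / P.C γ) ^ k2)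
      ((measurable_constPart γ).pow_const k2).aestronglyMeasurable ?_
    filter_upwards [hP.ae_baseMeasure 0] with q hq
    obtain ⟨h1, h2⟩ := hP.constPart_mem hγ hC hq.2.1
    rw [norm_pow, Real.norm_of_nonneg h1]
    exact pow_le_pow_left₀ h1 h2 _
  have hm := (Valid.measurable_integral_constPart (P := P) (γ := γ) k n k1 k2)
  have hm2 : StronglyMeasurable fun r : ℝ × ℝ => ∫ y in Ioi (0 : ℝ),
      P.binomKernel γ k n k1 (r, y) * Real.exp (-P.invPart γ (r, y)) *
        P.constPart γ (r, y) ^ k2 :=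
    hm.stronglyMeasurable.integral_prod_right
  unfold constPartIntegral
  unfold baseMeasure at hint ⊢
  rw [integral_prod _ hint, integral_prod _ hint.integral_prod_left]
  change ∫ w, P.innerIntegral γ k n k1 k2 w ∂P.satelliteDistLaw = _
  refine hP.integral_satelliteDistLaw ?_ ?_
  · exact (StronglyMeasurable.integral_prod_right (f := fun w u : ℝ => ∫ y in Ioi (0 : ℝ),
      P.binomKernel γ k n k1 ((w, u), y) * Real.exp (-P.invPart γ ((w, u), y)) *
        P.constPart γ ((w, u), y) ^ k2) hm2).measurable
  -- Continuity in `w` is read off the closed form rather than off the parametric integral.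
  · refine ContinuousOn.congr ?_ fun w hw => hP.innerIntegral_eq hγ hC k n k1 k2 hw
    have hβ := hP.betaBar_pos
    have hc := hP.cos_pos
    have h1 := hP.h1_pos
    have h2 := hP.h2_pos
    have c1 : ContinuousOn (fun w : ℝ => (P.betaBar * w ^ 2 / P.C γ) ^ (-(2 * s3 n k1)))
        (Ioi 0) := by
      refine ContinuousOn.rpow_const (by fun_prop) fun w hw => Or.inl ?_
      have hw : 0 < w := hw
      positivity
    have c2 : ContinuousOn (fun w : ℝ => P.kernelScale γ w ^ s3 n k1) (Ioi 0) := by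
      refine ContinuousOn.rpow_const (by unfold kernelScale; fun_prop) fun w hw => Or.inl ?_
      exact (hP.kernelScale_pos hγ hC hw).ne'
    have c3 : ContinuousOn (P.meijerBracket γ n k1 k2) (Ioi 0) := by
      have hM := fun q h hq hh => hP.continuousOn_meijerTerm hγ hC n k1 k2 (q := q) (h := h) hq hh
      have m1 := hM 3 P.h1 (by norm_num) h1
      have m2 := hM 3 P.h2 (by norm_num) h2
      have m3 := hM 2 P.h1 (by norm_num) h1
      have m4 := hM 2 P.h2 (by norm_num) h2
      have m5 := hM 3 (P.h1 / Real.cos P.phi) (by norm_num) (by positivity)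
      have m6 := hM 3 (P.h2 / Real.cos P.phi) (by norm_num) (by positivity)
      have m7 := hM 2 (P.h1 / Real.cos P.phi) (by norm_num) (by positivity)
      have m8 := hM 2 (P.h2 / Real.cos P.phi) (by norm_num) (by positivity)
      unfold meijerBracket
      exact (((m2.sub m1).sub (continuousOn_const.mul (m7.sub m3))).add
        (continuousOn_const.mul (m8.sub m4))).sub (continuousOn_const.mul (m6.sub m5))
    refine ((ContinuousOn.mul (by fun_prop) continuousOn_const).mul (c1.mul c2)).mul
      (continuousOn_const.mul (continuousOn_const.mul c3))

lemma Valid.integral_meijerBracket (hP : P.Valid) (hγ : 0 < γ) (hC : 0 < P.C γ)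
    (k n k1 k2 : ℕ) :
    ∫ w in P.wMin..P.wMax, P.meijerBracket γ n k1 k2 w * w ^ (2 * (k : ℝ) + n - k1 + 2) *
      Real.exp (-(P.D γ * P.betaBar * w ^ 2 / P.C γ)) =
      P.I2 γ k n k1 k2 - P.I3 γ k n k1 k2 - P.I4 γ k n k1 k2 + P.I5 γ k n k1 k2 := by
  have hc := hP.cos_pos
  have h1 := hP.h1_pos
  have h2 := hP.h2_pos
  have hI := fun q x y hq hx hy =>
    hP.intervalIntegrable_meijerIntegrandBetween hγ hC k n k1 k2 (q := q) (x := x) (y := y) hq hx hy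
  have i2 := hI 3 P.h1 P.h2 (by norm_num) h1 h2
  have i3 := (hI 2 P.h1 (P.h1 / Real.cos P.phi) (by norm_num) h1 (by positivity)).const_mul P.h1
  have i4 := (hI 3 (P.h1 / Real.cos P.phi) (P.h2 / Real.cos P.phi) (by norm_num) (by positivity)
    (by positivity)).const_mul (Real.cos P.phi)
  have i5 := (hI 2 P.h2 (P.h2 / Real.cos P.phi) (by norm_num) h2 (by positivity)).const_mul P.h2
  unfold I2 I3 I4 I5
  rw [← intervalIntegral.integral_sub i2 i3, ← intervalIntegral.integral_sub (i2.sub i3) i4,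
    ← intervalIntegral.integral_add ((i2.sub i3).sub i4) i5]
  refine intervalIntegral.integral_congr fun w _ => ?_
  simp only [meijerBracket, meijerIntegrandBetween]
  ring

lemma Valid.constPartIntegral_eq (hP : P.Valid) (hγ : 0 < γ) (hC : 0 < P.C γ)
    {k n k1 : ℕ} (k2 : ℕ) (hk1 : k1 ≤ k + n) :
    P.constPartIntegral γ k n k1 k2 =
      1 / (P.wER * P.wMin) * (6 / (Real.tan P.phi ^ 2 * (P.h2 ^ 3 - P.h1 ^ 3)) * (1 / P.nu)) *
      (P.D γ ^ ((2 * (k : ℝ) + n - k1 + 1) / 2) /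
        (P.betaBar ^ (s3 n k1) * P.C γ ^ (k + n + k2 + 1)) *
      P.a γ ^ ((n : ℝ) + k2 + s3 n k1)) *
      (P.I2 γ k n k1 k2 - P.I3 γ k n k1 k2 - P.I4 γ k n k1 k2 + P.I5 γ k n k1 k2) := by
  have ha := hP.a_pos hγ
  have hD := hP.D_pos hγ
  have hβ := hP.betaBar_pos
  rw [hP.constPartIntegral_eq_integral hγ hC, ← hP.integral_meijerBracket hγ hC, mul_assoc,
    mul_assoc]
  congr 1
  rw [← intervalIntegral.integral_const_mul, ← intervalIntegral.integral_const_mul]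
  refine intervalIntegral.integral_congr fun w hw => ?_
  rw [uIcc_of_le hP.wMin_lt_wMax.le] at hw
  have hw0 : 0 < w := hP.wMin_pos.trans_le hw.1
  rw [hP.innerIntegral_eq hγ hC k n k1 k2 hw0]
  have key : w * w ^ (2 * k + 2) *
      (P.D γ ^ (k + n - k1) / P.C γ ^ (k + 1) * (P.a γ / P.C γ) ^ (n + k2)) *
      ((P.betaBar * w ^ 2 / P.C γ) ^ (-(2 * s3 n k1)) * P.kernelScale γ w ^ s3 n k1) =
      (P.D γ ^ ((2 * (k : ℝ) + n - k1 + 1) / 2) /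
        (P.betaBar ^ (s3 n k1) * P.C γ ^ (k + n + k2 + 1)) *
      P.a γ ^ ((n : ℝ) + k2 + s3 n k1)) * w ^ (2 * (k : ℝ) + n - k1 + 2) := by
    have hn : ((k + n - k1 : ℕ) : ℝ) = (k : ℝ) + n - k1 := by
      rw [Nat.cast_sub hk1]; push_cast; rfl
    have hlog2 : ∀ x : ℝ, Real.log (x ^ 2) = 2 * Real.log x := fun x => by
      rw [Real.log_pow]; norm_num
    rw [kernelScale, ← Real.rpow_natCast w (2 * k + 2), ← Real.rpow_natCast (P.D γ),
      ← Real.rpow_natCast (P.C γ), ← Real.rpow_natCast (P.a γ / P.C γ),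
      ← Real.rpow_natCast (P.C γ) (k + n + k2 + 1), hn]
    have hw' : w = Real.exp (Real.log w) := (Real.exp_log hw0).symm
    rw [Real.rpow_def_of_pos hw0, Real.rpow_def_of_pos hw0, Real.rpow_def_of_pos hD,
      Real.rpow_def_of_pos hD, Real.rpow_def_of_pos hC, Real.rpow_def_of_pos hC,
      Real.rpow_def_of_pos hβ, Real.rpow_def_of_pos ha,
      Real.rpow_def_of_pos (by positivity : 0 < P.a γ / P.C γ),
      Real.rpow_def_of_pos (by positivity : 0 < P.betaBar * w ^ 2 / P.C γ),
      Real.rpow_def_of_pos (by positivity :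
        0 < P.a γ * P.D γ * P.betaBar * w ^ 2 / P.C γ ^ 2),
      Real.log_div ha.ne' hC.ne', Real.log_div (by positivity) hC.ne',
      Real.log_div (by positivity) (by positivity), Real.log_mul hβ.ne' (by positivity),
      Real.log_mul (by positivity) (by positivity), Real.log_mul (by positivity) hβ.ne',
      Real.log_mul ha.ne' hD.ne', hlog2, hlog2]
    -- The bare factor `w` must become an exponential too, so that both sides are compared through
    -- their exponents.
    nth_rewrite 1 [hw']
    simp only [← Real.exp_add, ← Real.exp_sub, s3]
    congr 1
    push_cast
    ring
  linear_combination (6 / (Real.tan P.phi ^ 2 * (P.h2 ^ 3 - P.h1 ^ 3)) * (1 / P.nu)) *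
    P.meijerBracket γ n k1 k2 w * Real.exp (-(P.D γ * P.betaBar * w ^ 2 / P.C γ)) * key

lemma Valid.prefactor_mul_psi3Term (hP : P.Valid) (hγ : 0 < γ) (hC : 0 < P.C γ)
    {k m n k1 : ℕ} (k2 : ℕ) (hk1 : k1 ≤ k + n) :
    P.prefactor * P.psi3Term γ k m n k1 k2 =
      P.alphaSR * (P.zeta k * (P.K ^ m * Real.exp (-P.K) / (m.factorial * n.factorial)) *
        ((k + n).choose k1 : ℝ) *
        ((-1) ^ k2 / (k2.factorial : ℝ) * P.constPartIntegral γ k n k1 k2)) := by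
  rw [hP.constPartIntegral_eq hγ hC k2 hk1, psi3Term, prefactor]
  generalize P.h2 ^ 3 - P.h1 ^ 3 = H
  ring

end Params

/-! ### The laws of the two power gains -/

lemma besselI0_two_mul_sqrt {t : ℝ} (ht : 0 ≤ t) :
    besselI0 (2 * Real.sqrt t) = ∑' m : ℕ, t ^ m / (m.factorial : ℝ) ^ 2 := by
  unfold besselI0
  refine tsum_congr fun m => ?_
  rw [mul_div_cancel_left₀ _ two_ne_zero, pow_mul, Real.sq_sqrt ht]
  ring

lemma summable_pow_div_factorial_sq {t : ℝ} (ht : 0 ≤ t) :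
    Summable fun m : ℕ => t ^ m / (m.factorial : ℝ) ^ 2 := by
  refine Summable.of_nonneg_of_le (fun m => by positivity) (fun m => ?_)
    (Real.summable_pow_div_factorial t)
  gcongr
  exact le_self_pow₀ (by exact_mod_cast Nat.succ_le_of_lt m.factorial_pos) two_ne_zero

namespace Params

variable {P : Params} {γ : ℝ}

/-- The Bessel series makes the density a Poisson mixture, with weights `K^m e^(-K) / m!`, of Gamma
densities of shape `m + 1` and rate `1 + K`. All terms are nonnegative, so the tails may be summed.
-/
lemma ricianLaw_Ioi (hK : 0 ≤ P.K) {z : ℝ} (hz : 0 ≤ z) :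
    P.ricianLaw (Ioi z) = ENNReal.ofReal (ricianTail P.K ((1 + P.K) * z)) := by
  have h1K : 0 < 1 + P.K := by linarith
  set e : ℕ → ℝ → ℝ := fun m x => P.K ^ m * Real.exp (-P.K) / (m.factorial : ℝ) ^ 2 * (1 + P.K) *
    (((1 + P.K) * x) ^ m * Real.exp (-((1 + P.K) * x))) with he
  have hdens : ∀ x ∈ Ioi z, ENNReal.ofReal ((1 + P.K) * Real.exp (-P.K - (1 + P.K) * x) *
      besselI0 (2 * Real.sqrt (P.K * (1 + P.K) * x))) = ∑' m, ENNReal.ofReal (e m x) := by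
    intro x hx
    have hx0 : 0 ≤ x := hz.trans (le_of_lt hx)
    have ht : 0 ≤ P.K * (1 + P.K) * x := by positivity
    have hterm : ∀ m, e m x = (1 + P.K) * Real.exp (-P.K - (1 + P.K) * x) *
        ((P.K * (1 + P.K) * x) ^ m / (m.factorial : ℝ) ^ 2) := fun m => by
      simp only [he]
      rw [sub_eq_add_neg, Real.exp_add, mul_assoc P.K, mul_pow P.K]
      ring
    rw [besselI0_two_mul_sqrt ht, ← tsum_mul_left, ENNReal.ofReal_tsum_of_nonneg
      (fun m => by positivity) ((summable_pow_div_factorial_sq ht).mul_left _)]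
    simp_rw [hterm]
  have hint : ∀ m, IntegrableOn (e m) (Ioi z) ∧
      ∫ x in Ioi z, e m x = ricianTerm P.K m ((1 + P.K) * z) := by
    intro m
    obtain ⟨hI, hE⟩ := integral_Ioi_pow_mul_exp_neg m ((1 + P.K) * z)
    refine ⟨((integrableOn_Ioi_comp_mul_left_iff
      (fun t => t ^ m * Real.exp (-t)) z h1K).2 hI).const_mul _, ?_⟩
    simp only [he]
    rw [integral_const_mul,
      integral_comp_mul_left_Ioi (fun t => t ^ m * Real.exp (-t)) z h1K, hE, ricianTerm,
      smul_eq_mul]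
    field_simp
    simp_rw [mul_comm (Real.exp _)]
  rw [ricianLaw, withDensity_apply _ measurableSet_Ioi, Measure.restrict_restrict
    measurableSet_Ioi, inter_eq_left.2 (Ioi_subset_Ici hz),
    setLIntegral_congr_fun measurableSet_Ioi hdens, lintegral_tsum fun m => ?_, ricianTail,
    ENNReal.ofReal_tsum_of_nonneg (ricianTerm_nonneg hK (by positivity))
      (hasSum_ricianTail hK (by positivity)).summable]
  · refine tsum_congr fun m => ?_
    rw [← (hint m).2, ofReal_integral_eq_lintegral_ofReal (hint m).1]
    filter_upwards [ae_restrict_mem measurableSet_Ioi] with x hx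
    have hx0 : 0 ≤ x := hz.trans (le_of_lt hx)
    simp only [he, Pi.zero_apply]
    positivity
  · exact (hint m).1.1.aemeasurable.ennreal_ofReal

lemma ae_ricianLaw : ∀ᵐ z ∂P.ricianLaw, 0 ≤ z :=
  (withDensity_absolutelyContinuous _ _).ae_le (ae_restrict_mem measurableSet_Ici)

lemma Valid.deltaSR_nonneg (hP : P.Valid) : 0 ≤ P.deltaSR := by
  have h1 := hP.mSR_cast_pos
  have h2 := hP.bSR_pos
  have h3 := hP.OmegaSR_nonneg
  unfold deltaSR
  positivity

/-- Here `(-1)^k (1 - m)_k = (m - 1)(m - 2)⋯(m - k)`, which is positive for `k < m`. Hence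
`ENNReal.ofReal` truncates nothing in the shadowed-Rician density on the half-line. -/
lemma Valid.zeta_nonneg (hP : P.Valid) {k : ℕ} (hk : k < P.mSR) : 0 ≤ P.zeta k := by
  have h1 := hP.deltaSR_nonneg
  have h2 : (k : ℝ) + 1 ≤ P.mSR := by exact_mod_cast hk
  have h3 : 0 ≤ (descPochhammer ℝ k).eval ((P.mSR : ℝ) - 1) :=
    descPochhammer_nonneg (by linarith)
  unfold zeta
  rw [← neg_sub, ascPochhammer_eval_neg_eq_descPochhammer, ← mul_assoc, ← mul_pow]
  norm_num
  positivity

/-- The shadowed-Rician density of the power gain. -/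
noncomputable def shadowedRicianDensity (P : Params) (x : ℝ) : ℝ :=
  P.alphaSR * ∑ k ∈ Finset.range P.mSR, P.zeta k * x ^ k * Real.exp (-(P.betaSR - P.deltaSR) * x)

lemma measurable_shadowedRicianDensity : Measurable P.shadowedRicianDensity := by
  unfold shadowedRicianDensity; fun_prop

lemma lintegral_shadowedRicianLaw {f : ℝ → ENNReal} (hf : Measurable f) :
    ∫⁻ x, f x ∂P.shadowedRicianLaw =
      ∫⁻ x in Ici 0, ENNReal.ofReal (P.shadowedRicianDensity x) * f x :=
  lintegral_withDensity_eq_lintegral_mul _ (measurable_shadowedRicianDensity.ennreal_ofReal) hf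

/-! ### The success event and its probability -/

lemma Valid.lt_snrSaturated_iff (hP : P.Valid) {X w Z u : ℝ} (hX : 0 < X)
    (hw : w ≠ 0) (hZ : 0 ≤ Z) (hu : 0 ≤ u) :
    γ < P.snrSaturated X w Z u ↔
      γ * P.eta * P.sigmaT ^ 2 * X < P.Pth * Z * u ^ (-P.nu) * (P.C γ * X - P.D γ * w ^ 2) := by
  have h1 := hP.chiRE_pos
  have h2 := hP.muEps_pos
  have h3 := hP.mu_pos
  have h4 := hP.Pth_pos
  have h5 := hP.eta_pos
  have h6 := hP.sigmaT_pos
  have h7 : 0 ≤ u ^ (-P.nu) := Real.rpow_nonneg hu _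
  have hV : 0 < (w ^ 2)⁻¹ := by positivity
  have hVw : (w ^ 2)⁻¹ * w ^ 2 = 1 := inv_mul_cancel₀ (by positivity)
  unfold snrSaturated
  rw [lt_div_iff₀ (by positivity), ← sub_pos, ← sub_pos (a := _ * (_ - _))]
  refine Iff.trans (Eq.to_iff ?_) (mul_pos_iff_of_pos_left hV)
  congr 1
  unfold C D
  linear_combination (γ * P.muEps * P.chiRE * P.Pth * Z * u ^ (-P.nu)) * hVw

/-- The event that the harvester is saturated and the signal-to-noise ratio exceeds `γ`, in terms
of the power gains and the distances. -/
def successSet (P : Params) (γ : ℝ) : Set (ℝ × ℝ × ℝ × ℝ) :=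
  {v | γ < P.snrSaturated v.1 v.2.2.1 v.2.1 v.2.2.2 ∧ P.Pth < P.eta * v.1 * (v.2.2.1 ^ 2)⁻¹}

lemma measurableSet_successSet : MeasurableSet (P.successSet γ) := by
  unfold successSet snrSaturated
  rw [ofPred_and]
  exact (measurableSet_lt (by fun_prop) (by fun_prop)).inter
    (measurableSet_lt (by fun_prop) (by fun_prop))

/-- Saturation alone forces this; at `w = 0` the inverse is `0` by convention, so saturation fails
there. -/
lemma Valid.pos_of_mem_successSet (hP : P.Valid) {X w Z u : ℝ}
    (h : (X, Z, w, u) ∈ P.successSet γ) : 0 < X ∧ w ≠ 0 := by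
  have h2 : P.Pth < P.eta * X * (w ^ 2)⁻¹ := h.2
  have h3 := hP.Pth_pos.trans h2
  have hw : w ≠ 0 := by
    rintro rfl
    simp at h3
  have h4 := hP.eta_pos
  have h5 : 0 < (w ^ 2)⁻¹ := by positivity
  exact ⟨pos_of_mul_pos_right (pos_of_mul_pos_left h3 h5.le) h4.le, hw⟩

variable {Ω : Type*} [MeasurableSpace Ω] {Pr : Measure Ω} {gsr grt : Ω → ℂ} {S T : Ω → Space}

lemma Valid.P4_eq_zero (hP : P.Valid) (hγ : 0 < γ) (hC : P.C γ ≤ 0) :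
    P.P4 Pr gsr grt S T γ = 0 := by
  unfold P4
  convert measureReal_empty (μ := Pr)
  rw [eq_empty_iff_forall_notMem]
  intro ω hω
  obtain ⟨hX, hw⟩ := hP.pos_of_mem_successSet (γ := γ) hω
  have h1 := (hP.lt_snrSaturated_iff hX hw (by positivity) dist_nonneg).1 hω.1
  have h2 := hP.Pth_pos
  have h3 := hP.eta_pos
  have h4 := hP.sigmaT_pos
  have h5 := hP.D_pos hγ
  refine absurd h1 (not_lt.2 (le_trans (mul_nonpos_of_nonneg_of_nonpos ?_ ?_) (by positivity)))
  · have : 0 ≤ dist P.transmitter (T ω) ^ (-P.nu) := Real.rpow_nonneg dist_nonneg _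
    positivity
  · have : P.C γ * ‖gsr ω‖ ^ 2 ≤ 0 := mul_nonpos_of_nonpos_of_nonneg hC hX.le
    have : 0 ≤ P.D γ * dist (S ω) P.transmitter ^ 2 := by positivity
    linarith

lemma hasLaw_gains_distances [IsProbabilityMeasure Pr] (h : IsModel P Pr gsr grt S T) :
    HasLaw (fun ω => (‖gsr ω‖ ^ 2, ‖grt ω‖ ^ 2, dist (S ω) P.transmitter,
      dist P.transmitter (T ω)))
      (P.shadowedRicianLaw.prod (P.ricianLaw.prod
        (P.satelliteDistLaw.prod P.receiverDistLaw))) Pr := by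
  have hS : Measurable fun x : Space => dist x P.transmitter := by fun_prop
  have hT : Measurable fun x : Space => dist P.transmitter x := by fun_prop
  have hg : Measurable fun z : ℂ => ‖z‖ ^ 2 := by fun_prop
  have lS : HasLaw (fun ω => dist (S ω) P.transmitter) P.satelliteDistLaw Pr :=
    HasLaw.comp ⟨hS.aemeasurable, rfl⟩ h.law_S
  have lT : HasLaw (fun ω => dist P.transmitter (T ω)) P.receiverDistLaw Pr :=
    HasLaw.comp ⟨hT.aemeasurable, rfl⟩ h.law_T
  exact (h.indep_gsr.comp hg (hg.prodMap (hS.prodMap hT))).hasLaw_prod h.law_gsr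
    ((h.indep_grt.comp hg (hS.prodMap hT)).hasLaw_prod h.law_grt
      ((h.indep_S.comp hS hT).hasLaw_prod lS lT))

/-- For fixed distances, only gains `x = w² (y + 𝒟) / 𝒞` with `y > y₀` contribute. -/
lemma Valid.ricianLaw_section (hP : P.Valid) (hγ : 0 < γ) (hC : 0 < P.C γ) {w u y : ℝ}
    (hw : 0 < w) (hu : u ∈ Icc P.h1 (P.h2 / Real.cos P.phi))
    (hy : max (P.PCD γ) 0 < y) :
    P.ricianLaw {Z | (w ^ 2 / P.C γ * (y + P.D γ), Z, w, u) ∈ P.successSet γ} =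
      ENNReal.ofReal (ricianTail P.K (P.threshold γ ((w, u), y))) := by
  have hy0 : 0 < y := (le_max_right _ _).trans_lt hy
  have hyP : P.PCD γ < y := (le_max_left _ _).trans_lt hy
  have hu0 : 0 < u := hP.h1_pos.trans_le hu.1
  have hD := hP.D_pos hγ
  have hη := hP.eta_pos
  have hp := hP.Pth_pos
  have hK := hP.K_nonneg
  have h1K : 0 < 1 + P.K := by linarith
  have hthr := hP.threshold_nonneg hγ hC (q := ((w, u), y)) hu hy0
  have hX : 0 < w ^ 2 / P.C γ * (y + P.D γ) := by positivity
  -- Saturation does not involve `Z` and holds throughout `y > 𝒫_{𝒞,𝒟}`, so only the signal-to-noise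
  -- condition restricts `Z`.
  have hsat : P.Pth < P.eta * (w ^ 2 / P.C γ * (y + P.D γ)) * (w ^ 2)⁻¹ := by
    have : P.eta * (w ^ 2 / P.C γ * (y + P.D γ)) * (w ^ 2)⁻¹ = P.eta * (y + P.D γ) / P.C γ := by
      field_simp
    rw [this, lt_div_iff₀ hC]
    have h1 := mul_lt_mul_of_pos_left hyP hη
    have h2 : P.eta * P.PCD γ = P.Pth * P.C γ - P.eta * P.D γ := by
      unfold PCD; field_simp
    linarith
  have hz : (1 + P.K) * (P.threshold γ ((w, u), y) / (1 + P.K)) = P.threshold γ ((w, u), y) := by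
    field_simp
  conv_rhs => rw [← hz]
  rw [← ricianLaw_Ioi hK (by positivity)]
  refine measure_congr ?_
  filter_upwards [P.ae_ricianLaw] with Z hZ
  refine propext (Iff.trans (and_iff_left hsat) ?_)
  refine (hP.lt_snrSaturated_iff hX hw.ne' hZ hu0.le).trans ?_
  change _ ↔ P.threshold γ ((w, u), y) / (1 + P.K) < Z
  have hU : 0 < u ^ P.nu := Real.rpow_pos_of_pos hu0 _
  rw [Real.rpow_neg hu0.le, ← sub_pos, ← sub_pos (b := _ / _)]
  refine Iff.trans (Eq.to_iff ?_)
    (mul_pos_iff_of_pos_left (by positivity : 0 < w ^ 2 * y * P.Pth * (u ^ P.nu)⁻¹))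
  congr 1
  unfold threshold a Theta
  field_simp
  ring

/-- If the maximum is `𝒫_{𝒞,𝒟}`, saturation fails; if it is `0`, then `𝒞 X ≤ 𝒟 w²` and the
signal-to-noise condition fails. -/
lemma Valid.ricianLaw_section_eq_zero (hP : P.Valid) (hγ : 0 < γ) (hC : 0 < P.C γ) {X w u : ℝ}
    (hu : 0 ≤ u) (hX : X ≤ w ^ 2 / P.C γ * (max (P.PCD γ) 0 + P.D γ)) :
    P.ricianLaw {Z | (X, Z, w, u) ∈ P.successSet γ} = 0 := by
  rw [← measure_empty (μ := P.ricianLaw)]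
  refine measure_congr ?_
  filter_upwards [P.ae_ricianLaw] with Z hZ
  refine propext (iff_of_false (fun h => ?_) (notMem_empty Z))
  have h' : (X, Z, w, u) ∈ P.successSet γ := h
  obtain ⟨hX0, hw⟩ := hP.pos_of_mem_successSet h'
  have h1 := (hP.lt_snrSaturated_iff hX0 hw hZ hu).1 h'.1
  have h2 : P.Pth < P.eta * X * (w ^ 2)⁻¹ := h'.2
  have hη := hP.eta_pos
  have hp := hP.Pth_pos
  have hσ := hP.sigmaT_pos
  have hw2 : 0 < w ^ 2 := by positivity
  rw [div_mul_eq_mul_div, le_div_iff₀ hC] at hX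
  rcases max_choice (P.PCD γ) 0 with hm | hm <;> rw [hm] at hX
  · rw [← div_eq_mul_inv, lt_div_iff₀ hw2] at h2
    have h3 : w ^ 2 * (P.PCD γ + P.D γ) = P.Pth * w ^ 2 * P.C γ / P.eta := by
      unfold PCD; field_simp; ring
    rw [h3, le_div_iff₀ hη] at hX
    have := mul_lt_mul_of_pos_right h2 hC
    linarith
  · have h3 : P.C γ * X - P.D γ * w ^ 2 ≤ 0 := by linarith
    have h4 : 0 ≤ P.Pth * Z * u ^ (-P.nu) := by
      have := Real.rpow_nonneg hu (-P.nu)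
      positivity
    have h5 := mul_nonpos_of_nonneg_of_nonpos h4 h3
    have h6 : 0 < γ * P.eta * P.sigmaT ^ 2 * X := by positivity
    linarith

/-- The density of the probability with respect to `baseMeasure`. -/
noncomputable def successDensity (P : Params) (γ : ℝ) (q : (ℝ × ℝ) × ℝ) : ℝ :=
  P.alphaSR * ∑ k ∈ Finset.range P.mSR,
    P.zeta k * (P.fadingKernel γ k q * ricianTail P.K (P.threshold γ q))

lemma measurable_successDensity : Measurable (P.successDensity γ) := by
  have h1 := fun k => measurable_fadingKernel (P := P) γ k
  have h2 := (measurable_ricianTail P.K).comp (measurable_threshold (P := P) γ)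
  unfold successDensity
  refine Measurable.const_mul (Finset.measurable_fun_sum _ fun k _ => ?_) _
  exact ((h1 k).mul h2).const_mul _

lemma successDensity_eq (w u y : ℝ) : P.successDensity γ ((w, u), y) =
    w ^ 2 / P.C γ * (P.shadowedRicianDensity (w ^ 2 / P.C γ * (y + P.D γ)) *
      ricianTail P.K (P.threshold γ ((w, u), y))) := by
  unfold successDensity shadowedRicianDensity
  rw [mul_assoc P.alphaSR, mul_left_comm, Finset.sum_mul]
  congr 1
  rw [Finset.mul_sum]
  refine Finset.sum_congr rfl fun k _ => ?_
  unfold fadingKernel betaBar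
  rw [← div_mul_eq_mul_div, neg_mul]
  ring

lemma Valid.successDensity_nonneg (hP : P.Valid) (hγ : 0 < γ) (hC : 0 < P.C γ)
    {q : (ℝ × ℝ) × ℝ} (hu : q.1.2 ∈ Icc P.h1 (P.h2 / Real.cos P.phi)) (hy : 0 < q.2) :
    0 ≤ P.successDensity γ q :=
  mul_nonneg hP.alphaSR_pos.le <| Finset.sum_nonneg fun k hk =>
    mul_nonneg (hP.zeta_nonneg (Finset.mem_range.1 hk)) <|
      mul_nonneg (hP.fadingKernel_nonneg hγ hC k hy)
        (ricianTail_nonneg hP.K_nonneg (hP.threshold_nonneg hγ hC hu hy))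

/-- The change of variables `X = w² (y + 𝒟) / 𝒞`; its Jacobian `w² / 𝒞` is already part of
`fadingKernel`. -/
lemma Valid.lintegral_ricianLaw_section (hP : P.Valid) (hγ : 0 < γ) (hC : 0 < P.C γ) {w u : ℝ}
    (hw : 0 < w) (hu : u ∈ Icc P.h1 (P.h2 / Real.cos P.phi))
    [SFinite P.ricianLaw] :
    ∫⁻ X, P.ricianLaw {Z | (X, Z, w, u) ∈ P.successSet γ} ∂P.shadowedRicianLaw =
      ∫⁻ y in Ioi (max (P.PCD γ) 0), ENNReal.ofReal (P.successDensity γ ((w, u), y)) := by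
  have hm : Measurable fun X => P.ricianLaw {Z | (X, Z, w, u) ∈ P.successSet γ} :=
    measurable_measure_prodMk_left (s := {p : ℝ × ℝ | (p.1, p.2, w, u) ∈ P.successSet γ})
      (measurableSet_successSet.preimage (by fun_prop))
  have hD := hP.D_pos hγ
  have hc : 0 < w ^ 2 / P.C γ := by positivity
  set y₀ := max (P.PCD γ) 0 with hy₀
  have hy₀0 : 0 ≤ y₀ := le_max_right _ _
  set f : ℝ → ℝ := fun y => w ^ 2 / P.C γ * (y + P.D γ) with hf
  have himg : f '' Ioi y₀ = Ioi (f y₀) := by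
    ext x
    constructor
    · rintro ⟨y, hy, rfl⟩
      have hy' : y₀ < y := hy
      simp only [hf, mem_Ioi]
      gcongr
    · intro hx
      refine ⟨x / (w ^ 2 / P.C γ) - P.D γ, ?_, ?_⟩
      · rw [mem_Ioi, lt_sub_iff_add_lt, lt_div_iff₀ hc, mul_comm]
        exact hx
      · simp only [hf]
        field_simp
        ring
  have hu0 : 0 ≤ u := hP.h1_pos.le.trans hu.1
  rw [lintegral_shadowedRicianLaw hm]
  have hrestr : ∫⁻ x in Ici 0, ENNReal.ofReal (P.shadowedRicianDensity x) *
        P.ricianLaw {Z | (x, Z, w, u) ∈ P.successSet γ} =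
      ∫⁻ x in f '' Ioi y₀, ENNReal.ofReal (P.shadowedRicianDensity x) *
        P.ricianLaw {Z | (x, Z, w, u) ∈ P.successSet γ} := by
    rw [himg, ← lintegral_indicator measurableSet_Ici, ← lintegral_indicator measurableSet_Ioi]
    refine lintegral_congr fun x => ?_
    rcases le_or_gt x (f y₀) with hx | hx
    · rw [indicator_of_notMem (s := Ioi (f y₀)) (by simpa using hx)]
      refine indicator_apply_eq_zero.2 fun _ => ?_
      rw [hP.ricianLaw_section_eq_zero hγ hC hu0 hx, mul_zero]
    · rw [indicator_of_mem (s := Ioi (f y₀)) hx, indicator_of_mem]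
      exact (le_of_lt hx).trans' (by simp only [hf]; positivity)
  rw [hrestr, lintegral_image_eq_lintegral_abs_deriv_mul (f' := fun _ => w ^ 2 / P.C γ)
    measurableSet_Ioi (fun y _ => ?_) (fun y₁ _ y₂ _ h => ?_)]
  · refine setLIntegral_congr_fun measurableSet_Ioi fun y hy => ?_
    have hy0 : 0 < y := hy₀0.trans_lt hy
    have ht := ricianTail_nonneg hP.K_nonneg
      (hP.threshold_nonneg hγ hC (q := ((w, u), y)) hu hy0)
    simp only [hf]
    rw [hP.ricianLaw_section hγ hC hw hu hy, successDensity_eq, ENNReal.ofReal_mul hc.le,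
      ENNReal.ofReal_mul' ht, abs_of_pos hc]
  · simpa using (((hasDerivAt_id y).add_const (P.D γ)).const_mul (w ^ 2 / P.C γ)).hasDerivWithinAt
  · simpa [hf, hc.ne', hw.ne', hC.ne'] using h

lemma measurable_ricianLaw_section [SFinite P.ricianLaw] : Measurable fun p : ℝ × ℝ × ℝ =>
    P.ricianLaw {Z | (p.1, Z, p.2.1, p.2.2) ∈ P.successSet γ} :=
  measurable_measure_prodMk_left
    (s := {p : (ℝ × ℝ × ℝ) × ℝ | (p.1.1, p.2, p.1.2.1, p.1.2.2) ∈ P.successSet γ})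
    (measurableSet_successSet.preimage (by fun_prop))

/-- Tonelli, with `Z` innermost, where the tail is explicit, then `X`, and the distances outermost
as in `baseMeasure`. -/
lemma prod_successSet_eq_lintegral [SFinite P.shadowedRicianLaw] [SFinite P.ricianLaw]
    (μ : Measure (ℝ × ℝ)) [SFinite μ] :
    (P.shadowedRicianLaw.prod (P.ricianLaw.prod μ)) (P.successSet γ) =
      ∫⁻ r, (∫⁻ X, P.ricianLaw {Z | (X, Z, r.1, r.2) ∈ P.successSet γ} ∂P.shadowedRicianLaw)
        ∂μ := by
  have hmeas := measurableSet_successSet (P := P) (γ := γ)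
  rw [← lintegral_lintegral_swap (f := fun X (r : ℝ × ℝ) =>
    P.ricianLaw {Z | (X, Z, r.1, r.2) ∈ P.successSet γ}) measurable_ricianLaw_section.aemeasurable,
    Measure.prod_apply hmeas]
  refine lintegral_congr fun X => ?_
  rw [Measure.prod_apply_symm (hmeas.preimage (by fun_prop))]
  rfl

lemma Valid.lintegral_successDensity (hP : P.Valid) (hγ : 0 < γ) (hC : 0 < P.C γ)
    [SFinite P.ricianLaw] :
    ∫⁻ r, (∫⁻ X, P.ricianLaw {Z | (X, Z, r.1, r.2) ∈ P.successSet γ} ∂P.shadowedRicianLaw)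
      ∂P.satelliteDistLaw.prod P.receiverDistLaw =
      ∫⁻ q, ENNReal.ofReal (P.successDensity γ q) ∂P.baseMeasure (max (P.PCD γ) 0) := by
  have := hP.isProbabilityMeasure_satelliteDistLaw
  have := hP.isProbabilityMeasure_receiverDistLaw
  have h1 : ∀ᵐ r ∂(P.satelliteDistLaw.prod P.receiverDistLaw), r.1 ∈ Icc P.wMin P.wMax :=
    Measure.quasiMeasurePreserving_fst.ae hP.ae_satelliteDistLaw
  have h2 : ∀ᵐ r ∂(P.satelliteDistLaw.prod P.receiverDistLaw),
      r.2 ∈ Icc P.h1 (P.h2 / Real.cos P.phi) :=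
    Measure.quasiMeasurePreserving_snd.ae hP.ae_receiverDistLaw
  unfold baseMeasure
  rw [lintegral_prod _ measurable_successDensity.ennreal_ofReal.aemeasurable]
  refine lintegral_congr_ae ?_
  filter_upwards [h1, h2] with r hr1 hr2
  rw [hP.lintegral_ricianLaw_section hγ hC (hP.wMin_pos.trans_le hr1.1) hr2]

/-- The probability of success as an integral over the distances and a half-line. -/
lemma Valid.P4_eq_sum_fadingIntegral [IsProbabilityMeasure Pr] (hP : P.Valid) (hγ : 0 < γ)
    (hC : 0 < P.C γ) (h : IsModel P Pr gsr grt S T) :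
    P.P4 Pr gsr grt S T γ = P.alphaSR * ∑ k ∈ Finset.range P.mSR,
      P.zeta k * P.fadingIntegral γ (max (P.PCD γ) 0) k := by
  have := hP.isProbabilityMeasure_satelliteDistLaw
  have := hP.isProbabilityMeasure_receiverDistLaw
  -- That the two densities have total mass one is not computed but inherited from the model, whose
  -- gains have these laws.
  have : IsProbabilityMeasure P.shadowedRicianLaw := by
    rw [← h.law_gsr.map_eq]
    exact Measure.isProbabilityMeasure_map h.law_gsr.aemeasurable
  have : IsProbabilityMeasure P.ricianLaw := by
    rw [← h.law_grt.map_eq]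
    exact Measure.isProbabilityMeasure_map h.law_grt.aemeasurable
  have hlaw := hasLaw_gains_distances h
  have hy₀ : (0 : ℝ) ≤ max (P.PCD γ) 0 := le_max_right _ _
  have hprob : P.P4 Pr gsr grt S T γ =
      (∫⁻ q, ENNReal.ofReal (P.successDensity γ q) ∂P.baseMeasure (max (P.PCD γ) 0)).toReal := by
    rw [← hP.lintegral_successDensity hγ hC, ← prod_successSet_eq_lintegral, ← hlaw.map_eq,
      Measure.map_apply_of_aemeasurable hlaw.aemeasurable measurableSet_successSet]
    rfl
  have hint := fun k => hP.integrable_fadingKernel_mul_ricianTail hγ hC hy₀ k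
  rw [hprob, ← integral_eq_lintegral_of_nonneg_ae ?_
    measurable_successDensity.aestronglyMeasurable]
  · unfold successDensity
    rw [integral_const_mul, integral_finsetSum _ fun k _ => (hint k).const_mul _]
    simp_rw [integral_const_mul]
    rfl
  · filter_upwards [hP.ae_baseMeasure (max (P.PCD γ) 0)] with q hq
    exact hP.successDensity_nonneg hγ hC hq.2.1 (hy₀.trans_lt hq.2.2)

lemma Valid.C_pos_iff (hP : P.Valid) : 0 < P.C γ ↔ γ < 1 / P.mu' := by
  have h1 := hP.mu_pos
  unfold C mu'
  rw [mul_pos_iff_of_pos_left (mul_pos hP.chiRE_pos hP.eta_pos), one_div_div, lt_div_iff₀ h1,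
    sub_pos, mul_comm]

lemma Valid.PCD_pos_iff (hP : P.Valid) (hC : 0 < P.C γ) :
    0 < P.PCD γ ↔ P.D γ / P.C γ * P.eta < P.Pth := by
  have h1 := hP.eta_pos
  unfold PCD
  rw [sub_pos, lt_div_iff₀ h1, div_mul_eq_mul_div, div_lt_iff₀ hC]

end Params

end OSAGIN

/-! ### The three cases -/

theorem theorem4 (P : OSAGIN.Params) (hP : P.Valid)
    {Ω : Type*} [MeasurableSpace Ω] (Pr : MeasureTheory.Measure Ω)
    [MeasureTheory.IsProbabilityMeasure Pr]
    (gsr grt : Ω → ℂ) (S T : Ω → OSAGIN.Space)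
    (hmodel : OSAGIN.IsModel P Pr gsr grt S T)
    (γ : ℝ) (hγ : 0 < γ) :
    (γ < 1 / P.mu' → P.D γ / P.C γ * P.eta < P.Pth →
      (∀ k n k1 k2 : ℕ, k1 ≤ k + n →
        IntervalIntegrable (P.I1Integrand γ k n k1 k2) MeasureTheory.volume P.wMin P.wMax) ∧
      P.SeriesConverge (P.psi2Term γ) ∧
      P.P4 Pr gsr grt S T γ = P.Psi2 γ) ∧
    (γ < 1 / P.mu' → P.Pth ≤ P.D γ / P.C γ * P.eta →
      (∀ k n k1 k2 : ℕ, k1 ≤ k + n → ∀ q ∈ ({2, 3} : Set ℝ),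
        ∀ x ∈ ({P.h1, P.h2, P.h1 / Real.cos P.phi, P.h2 / Real.cos P.phi} : Set ℝ),
        ∀ y ∈ ({P.h1, P.h2, P.h1 / Real.cos P.phi, P.h2 / Real.cos P.phi} : Set ℝ),
        IntervalIntegrable (P.meijerIntegrandBetween γ k n k1 k2 q x y)
          MeasureTheory.volume P.wMin P.wMax) ∧
      P.SeriesConverge (P.psi3Term γ) ∧
      P.P4 Pr gsr grt S T γ = P.Psi3 γ) ∧
    (1 / P.mu' ≤ γ → P.P4 Pr gsr grt S T γ = 0) := by
  refine ⟨fun h1 h2 => ?_, fun h1 h2 => ?_, fun h1 => ?_⟩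
  · have hC := hP.C_pos_iff.2 h1
    have hPCD := (hP.PCD_pos_iff hC).2 h2
    have h := hP.seriesConverge_and_sum_eq hγ hC hPCD.le (t := P.psi2Term γ)
      (X := P.invPartIntegral γ) (fun k n k1 _ => hP.hasSum_invPartIntegral hγ hC hPCD k n k1)
      (fun k m n k1 j hk1 => hP.prefactor_mul_psi2Term hγ hC hPCD j hk1)
    refine ⟨fun k n k1 k2 _ => hP.intervalIntegrable_I1Integrand hC hPCD k n k1 k2, h.1, ?_⟩
    rw [hP.P4_eq_sum_fadingIntegral hγ hC hmodel, max_eq_left hPCD.le, ← h.2, OSAGIN.Params.Psi2]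
    simp only [Nat.add_comm]
  · have hC := hP.C_pos_iff.2 h1
    -- The boundary value `𝒫_{𝒞,𝒟} = 0` belongs to this case: the half-line then starts at `0`,
    -- where the inverse part is unbounded.
    have hPCD : P.PCD γ ≤ 0 := not_lt.1 fun h => h2.not_gt ((hP.PCD_pos_iff hC).1 h)
    have h := hP.seriesConverge_and_sum_eq hγ hC le_rfl (t := P.psi3Term γ)
      (X := P.constPartIntegral γ) (fun k n k1 _ => hP.hasSum_constPartIntegral hγ hC k n k1)
      (fun k m n k1 j hk1 => hP.prefactor_mul_psi3Term hγ hC j hk1)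
    have hpos : ∀ x ∈ ({P.h1, P.h2, P.h1 / Real.cos P.phi, P.h2 / Real.cos P.phi} : Set ℝ),
        0 < x := by
      have := hP.h1_pos
      have := hP.h2_pos
      have := hP.cos_pos
      rintro x (rfl | rfl | rfl | rfl) <;> positivity
    refine ⟨fun k n k1 k2 _ q hq x hx y hy => hP.intervalIntegrable_meijerIntegrandBetween hγ hC
      k n k1 k2 ?_ (hpos x hx) (hpos y hy), h.1, ?_⟩
    · rcases hq with rfl | rfl <;> norm_num
    · rw [hP.P4_eq_sum_fadingIntegral hγ hC hmodel, max_eq_right hPCD, ← h.2, OSAGIN.Params.Psi3]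
  · exact hP.P4_eq_zero hγ (not_lt.1 fun h => h1.not_gt (hP.C_pos_iff.1 h))
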